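/- Let $k\ge 1$, let $\boldsymbol n=(n_1,\dots,n_k)$ be a tuple of integers $n_j\ge 1$, put $n=n_1+\cdots+n_k$, and write the points of $\mathbb C^n=\mathbb C^{n_1}\times\cdots\times\mathbb C^{n_k}$ as $z=(z_{(1)},\dots,z_{(k)})$. Let $d\lambda_n(z)=\pi^{-n}e^{-|z|^2}\,dz$ be the Gaussian measure, let $\mathcal F(\mathbb C^n)\subset L^2(\mathbb C^n,\lambda_n)$ be the Fock space of square-integrable entire functions, and let $P:L^2(\mathbb C^n,\lambda_n)\to\mathcal F(\mathbb C^n)$ be the orthogonal projection. For $\varphi\in L^\infty(\mathbb C^n)$ let $T_\varphi f=P(\varphi f)$ be the Toeplitz operator on $\mathcal F(\mathbb C^n)$ with symbol $\varphi$. A measurable, essentially bounded $\varphi:\mathbb C^n\to\mathbb C$ is called $k$-quasi-radial if $\varphi(A_1z_{(1)},\dots,A_kz_{(k)})=\varphi(z)$ for all $z\in\mathbb C^n$ and all unitary matrices $A_j\in\mathrm U_{n_j}$. For $\boldsymbol m\in\mathbb N_0^k$ let $\mathcal P_{\boldsymbol m}=\mathcal P^{m_1}(\mathbb C^{n_1})\otimes\cdots\otimes\mathcal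 P^{m_k}(\mathbb C^{n_k})\subset\mathcal F(\mathbb C^n)$ be the span of the products $p_1(z_{(1)})\cdots p_k(z_{(k)})$, where $p_j$ is a homogeneous polynomial of degree $m_j$. A function $\gamma:\mathbb N_0^k\to\mathbb C$ is called the eigenvalue function of a bounded operator $T$ on $\mathcal F(\mathbb C^n)$ if $Tf=\gamma(\boldsymbol m)f$ for all $\boldsymbol m\in\mathbb N_0^k$ and $f\in\mathcal P_{\boldsymbol m}$. Let $\mathfrak G_{\boldsymbol n}$ be the set of all eigenvalue functions of Toeplitz operators with $k$-quasi-radial symbols. Finally, let $C_{b,u}(\mathbb N_0^k,\rho_k)\subset\ell^\infty(\mathbb N_0^k)$ be the algebra of all bounded functions $\sigma:\mathbb N_0^k\to\mathbb C$ that are uniformly continuous with respect to the square-root metric $\rho_k(\boldsymbol m,\boldsymbol m')=\sum_{j=1}^k\bigl|\sqrt{m_j}-\sqrt{m_j'}\bigr|$, with the supremum norm. Then every Toeplitz operator with $k$-quasi-radial symbol has exactly one eigenvalue function, $\mathfrak G_{\boldsymbol n}$ is contained in $C_{b,u}(\mathbb N_0^k,\rho_k)$, and $\mathfrak G_{\boldsymbol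 n}$ is dense in $C_{b,u}(\mathbb N_0^k,\rho_k)$. Consequently the $C^*$-algebra generated by the Toeplitz operators with $k$-quasi-radial symbols is isometrically $*$-isomorphic to $C_{b,u}(\mathbb N_0^k,\rho_k)$, by an isomorphism that sends each operator to its eigenvalue function. -/

import Mathlib

open MeasureTheory Filter Topology
open scoped ENNReal

noncomputable section

namespace FockToeplitz

/-- The space `ℂ^{n₁} × ⋯ × ℂ^{n_k}`; its points are `z = (z₍₁₎, …, z₍ₖ₎)` with `z₍ⱼ₎ = z j`.
It carries the Lebesgue measure `volume`. -/
abbrev CSpace {k : ℕ} (n : Fin k → ℕ) : Type := (j : Fin k) → Fin (n j) → ℂ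

variable {k : ℕ} (n : Fin k → ℕ)

/-- The Gaussian measure `π^{-(n₁ + ⋯ + n_k)} e^{-|z|²} dz`. -/
def gaussian : Measure (CSpace n) :=
  volume.withDensity fun z =>
    ENNReal.ofReal ((Real.pi ^ (∑ j, n j))⁻¹ * Real.exp (-∑ j, ∑ i, ‖z j i‖ ^ 2))

/-- The Fock space: the elements of `L²` of the Gaussian measure that are represented by an
entire function, as a subspace of that `L²` space. -/
def fockSubmodule : Submodule ℂ (Lp ℂ 2 (gaussian n)) where
  carrier := {f | ∃ g : CSpace n → ℂ, Differentiable ℂ g ∧ ⇑f =ᵐ[gaussian n] g}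
  add_mem' := by
    rintro f₁ f₂ ⟨g₁, hg₁, h₁⟩ ⟨g₂, hg₂, h₂⟩
    exact ⟨g₁ + g₂, hg₁.add hg₂, (Lp.coeFn_add f₁ f₂).trans (h₁.add h₂)⟩
  zero_mem' := ⟨0, differentiable_const 0, Lp.coeFn_zero ℂ 2 (gaussian n)⟩
  smul_mem' := by
    rintro c f ⟨g, hg, h⟩
    exact ⟨c • g, hg.const_smul c, (Lp.coeFn_smul c f).trans (h.const_smul c)⟩

/-! ### The Fock space is complete -/

lemma measurePreserving_rotate (c : Circle) :
    MeasurePreserving (fun w : CSpace n => (c : ℂ) • w) volume volume := by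
  have h1 : MeasurePreserving (fun w : ℂ => (c : ℂ) * w) volume volume :=
    (rotation c).measurePreserving
  have h2 : ∀ j : Fin k, MeasurePreserving (fun w : Fin (n j) → ℂ => (c : ℂ) • w) volume volume :=
    fun j => measurePreserving_pi (fun _ => volume) (fun _ => volume) (fun _ => h1)
  exact measurePreserving_pi (fun _ => volume) (fun _ => volume) h2

lemma lintegral_rotate_ball (c : Circle) {u : CSpace n → ℝ≥0∞} (hu : Measurable u) :
    ∫⁻ w in Metric.ball (0 : CSpace n) 1, u ((c : ℂ) • w)
      = ∫⁻ w in Metric.ball (0 : CSpace n) 1, u w := by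
  have hpre : (fun w : CSpace n => (c : ℂ) • w) ⁻¹' Metric.ball 0 1 = Metric.ball 0 1 := by
    ext w
    rw [Set.mem_preimage, mem_ball_zero_iff, mem_ball_zero_iff, norm_smul, Circle.norm_coe,
      one_mul]
  have := ((measurePreserving_rotate n c).restrict_preimage
    (s := Metric.ball 0 1) Metric.isOpen_ball.measurableSet).lintegral_comp hu
  rwa [hpre] at this

lemma enorm_le_circle {g : CSpace n → ℂ} (hg : Differentiable ℂ g) (x w : CSpace n) :
    ENNReal.ofReal (2 * Real.pi) * ‖g x‖ₑ
      ≤ ∫⁻ θ in Set.Ioc 0 (2 * Real.pi), ‖g (x + (Circle.exp θ : ℂ) • w)‖ₑ := by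
  have hd : Differentiable ℂ (fun t : ℂ => g (x + t • w)) := by fun_prop
  have h := (hd.diffContOnCl (s := Metric.ball (0 : ℂ) |(1 : ℝ)|)).circleAverage
  simp only [zero_smul, add_zero] at h
  rw [Real.circleAverage_def] at h
  have h2 : (2 * Real.pi : ℝ) • g x
      = ∫ θ in Set.Ioc 0 (2 * Real.pi), g (x + (Circle.exp θ : ℂ) • w) := by
    rw [← h, smul_inv_smul₀ (by positivity), intervalIntegral.integral_of_le (by positivity)]
    simp [circleMap, Circle.coe_exp]
  calc ENNReal.ofReal (2 * Real.pi) * ‖g x‖ₑ = ‖(2 * Real.pi : ℝ) • g x‖ₑ := by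
        rw [enorm_smul, Real.enorm_of_nonneg (by positivity)]
    _ ≤ _ := by rw [h2]; exact enorm_integral_le_lintegral_enorm _

lemma enorm_mul_volume_le {g : CSpace n → ℂ} (hg : Differentiable ℂ g) (x : CSpace n) :
    ‖g x‖ₑ * volume (Metric.ball (0 : CSpace n) 1)
      ≤ ∫⁻ w in Metric.ball (0 : CSpace n) 1, ‖g (x + w)‖ₑ := by
  have hc : Continuous g := hg.continuous
  set I := ∫⁻ w in Metric.ball (0 : CSpace n) 1, ‖g (x + w)‖ₑ
  have key : ENNReal.ofReal (2 * Real.pi) * (‖g x‖ₑ * volume (Metric.ball (0 : CSpace n) 1))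
      ≤ ENNReal.ofReal (2 * Real.pi) * I := by
    calc _ = ∫⁻ w in Metric.ball (0 : CSpace n) 1, ENNReal.ofReal (2 * Real.pi) * ‖g x‖ₑ := by
            rw [lintegral_const, Measure.restrict_apply_univ, mul_assoc]
      _ ≤ ∫⁻ w in Metric.ball (0 : CSpace n) 1, ∫⁻ θ in Set.Ioc 0 (2 * Real.pi),
            ‖g (x + (Circle.exp θ : ℂ) • w)‖ₑ := lintegral_mono fun w => enorm_le_circle n hg x w
      _ = ∫⁻ θ in Set.Ioc 0 (2 * Real.pi), ∫⁻ w in Metric.ball (0 : CSpace n) 1,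
            ‖g (x + (Circle.exp θ : ℂ) • w)‖ₑ := by
            refine lintegral_lintegral_swap (Continuous.aemeasurable ?_)
            simp only [Function.uncurry_def]
            fun_prop
      _ = ∫⁻ θ in Set.Ioc 0 (2 * Real.pi), I := by
            refine lintegral_congr fun θ => ?_
            exact lintegral_rotate_ball n (Circle.exp θ) (u := fun w => ‖g (x + w)‖ₑ)
              (hc.comp (continuous_const.add continuous_id)).enorm.measurable
      _ = _ := by
            rw [lintegral_const, Measure.restrict_apply_univ, Real.volume_Ioc, sub_zero, mul_comm]
  exact (ENNReal.mul_le_mul_iff_right (by simp [Real.pi_pos]) ENNReal.ofReal_ne_top).1 key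

lemma exists_volume_restrict_le (R : ℝ) :
    ∃ c : NNReal, volume.restrict (Metric.closedBall (0 : CSpace n) R) ≤ c • gaussian n := by
  set d : CSpace n → ℝ :=
    fun z => (Real.pi ^ (∑ j, n j))⁻¹ * Real.exp (-∑ j, ∑ i, ‖z j i‖ ^ 2) with hd
  have hcont : Continuous d := by fun_prop
  have hpos : ∀ z, 0 < d z := fun z => by positivity
  have hmeas : Measurable fun z => ENNReal.ofReal (d z) := hcont.measurable.ennreal_ofReal
  have hgauss : gaussian n = volume.withDensity fun z => ENNReal.ofReal (d z) := rfl
  clear_value d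
  obtain ⟨M, hM⟩ := (isCompact_closedBall (0 : CSpace n) R).bddAbove_image
    (f := fun z => (d z)⁻¹) (hcont.inv₀ fun z => (hpos z).ne').continuousOn
  refine ⟨M.toNNReal, Measure.le_iff.2 fun s hs => ?_⟩
  rw [Measure.restrict_apply hs, Measure.smul_apply, hgauss, withDensity_apply _ hs]
  calc volume (s ∩ Metric.closedBall 0 R)
      = ∫⁻ z in s ∩ Metric.closedBall 0 R, 1 := by simp
    _ ≤ ∫⁻ z in s ∩ Metric.closedBall 0 R, M.toNNReal * ENNReal.ofReal (d z) := by
        refine setLIntegral_mono (hmeas.const_mul _) fun z hz => ?_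
        have h1 : (d z)⁻¹ ≤ M := hM (Set.mem_image_of_mem _ hz.2)
        have hM0 : 0 ≤ M := (inv_pos.2 (hpos z)).le.trans h1
        change 1 ≤ ENNReal.ofReal M * _
        rw [← ENNReal.ofReal_mul hM0, ← ENNReal.ofReal_one]
        refine ENNReal.ofReal_le_ofReal ?_
        have := mul_le_mul_of_nonneg_right h1 (hpos z).le
        rwa [inv_mul_cancel₀ (hpos z).ne'] at this
    _ ≤ ∫⁻ z in s, M.toNNReal * ENNReal.ofReal (d z) :=
        lintegral_mono_set Set.inter_subset_left
    _ = _ := by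
        rw [lintegral_const_mul _ hmeas]
        rfl

/-- Point evaluations are locally uniformly bounded by the `L²` norm. -/
lemma exists_enorm_le (R : ℝ) :
    ∃ C : NNReal, ∀ g : CSpace n → ℂ, Differentiable ℂ g → ∀ x ∈ Metric.ball (0 : CSpace n) R,
      ‖g x‖ₑ ≤ C * eLpNorm g 2 (gaussian n) := by
  obtain ⟨c, hc⟩ := exists_volume_restrict_le n (R + 1)
  set B := Metric.closedBall (0 : CSpace n) (R + 1) with hB
  set V := volume (Metric.ball (0 : CSpace n) 1) with hV
  have hV0 : V ≠ 0 := (Metric.measure_ball_pos _ _ one_pos).ne'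
  have hV1 : V ≠ ∞ := measure_ball_lt_top.ne
  have hBf : volume B ≠ ∞ := measure_closedBall_lt_top.ne
  set D : ℝ≥0∞ := V⁻¹ * ((c : ℝ≥0∞) ^ (1 / (2 : ℝ≥0∞)).toReal * volume B ^ (1 / 2 : ℝ)) with hD
  have hDf : D ≠ ∞ := by
    refine ENNReal.mul_ne_top (by simpa using hV0) (ENNReal.mul_ne_top ?_ ?_)
    · exact ENNReal.rpow_ne_top_of_nonneg (by positivity) (by simp)
    · exact ENNReal.rpow_ne_top_of_nonneg (by positivity) hBf
  refine ⟨D.toNNReal, fun g hg x hx => ?_⟩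
  rw [ENNReal.coe_toNNReal hDf]
  have hcont : Continuous g := hg.continuous
  have h1 := enorm_mul_volume_le n hg x
  have h2 : ∫⁻ w in Metric.ball (0 : CSpace n) 1, ‖g (x + w)‖ₑ ≤ ∫⁻ w in B, ‖g w‖ₑ := by
    have e : ∫⁻ w in Metric.ball (0 : CSpace n) 1, ‖g (x + w)‖ₑ
        = ∫⁻ w in Metric.ball x 1, ‖g w‖ₑ := by
      have := ((measurePreserving_add_left volume x).restrict_preimage
        (s := Metric.ball x 1) Metric.isOpen_ball.measurableSet).lintegral_comp
          (f := fun w => ‖g w‖ₑ) (by fun_prop)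
      have hpre : (fun w : CSpace n => x + w) ⁻¹' Metric.ball x 1 = Metric.ball 0 1 := by
        ext w
        simp [dist_eq_norm]
      rwa [hpre] at this
    rw [e]
    refine lintegral_mono_set fun w hw => ?_
    rw [hB, Metric.mem_closedBall, dist_zero_right]
    rw [Metric.mem_ball, dist_eq_norm] at hw
    rw [mem_ball_zero_iff] at hx
    calc ‖w‖ = ‖x + (w - x)‖ := by simp
      _ ≤ ‖x‖ + ‖w - x‖ := norm_add_le _ _
      _ ≤ R + 1 := by linarith
  have h3 : ∫⁻ w in B, ‖g w‖ₑ ≤ eLpNorm g 2 (gaussian n) *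
      ((c : ℝ≥0∞) ^ (1 / (2 : ℝ≥0∞)).toReal * volume B ^ (1 / 2 : ℝ)) := by
    rw [← eLpNorm_one_eq_lintegral_enorm]
    have h4 := eLpNorm_le_eLpNorm_mul_rpow_measure_univ (p := 1) (q := 2) (by norm_num)
      (hcont.aestronglyMeasurable (μ := volume.restrict B))
    have h5 : eLpNorm g 2 (volume.restrict B)
        ≤ (c : ℝ≥0∞) ^ (1 / (2 : ℝ≥0∞)).toReal * eLpNorm g 2 (gaussian n) := by
      refine (eLpNorm_mono_measure g hc).trans (le_of_eq ?_)
      have := eLpNorm_smul_measure_of_ne_top (p := 2) (by simp) g (c : ℝ≥0∞) (μ := gaussian n)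
      simpa using this
    refine h4.trans ?_
    rw [Measure.restrict_apply_univ]
    have e2 : 1 / (1 : ℝ≥0∞).toReal - 1 / (2 : ℝ≥0∞).toReal = (1 / 2 : ℝ) := by norm_num
    rw [e2]
    calc _ ≤ ((c : ℝ≥0∞) ^ (1 / (2 : ℝ≥0∞)).toReal * eLpNorm g 2 (gaussian n))
          * volume B ^ (1 / 2 : ℝ) := by gcongr
      _ = _ := by ring
  calc ‖g x‖ₑ = V⁻¹ * (‖g x‖ₑ * V) := by
        rw [mul_comm, mul_assoc, ENNReal.mul_inv_cancel hV0 hV1, mul_one]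
    _ ≤ V⁻¹ * (eLpNorm g 2 (gaussian n) *
      ((c : ℝ≥0∞) ^ (1 / (2 : ℝ≥0∞)).toReal * volume B ^ (1 / 2 : ℝ))) := by
        exact mul_le_mul_right (h1.trans (h2.trans h3)) _
    _ = _ := by rw [hD]; ring

lemma isClosed_fockSubmodule : IsClosed (fockSubmodule n : Set (Lp ℂ 2 (gaussian n))) := by
  refine IsSeqClosed.isClosed fun f F hf hF => ?_
  choose g hg hfg using hf
  have hcauchy : CauchySeq f := hF.cauchySeq
  have hnorm : ∀ p q, eLpNorm (g p - g q) 2 (gaussian n) = ENNReal.ofReal (dist (f p) (f q)) := by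
    intro p q
    rw [dist_eq_norm, Lp.norm_def, ENNReal.ofReal_toReal (Lp.eLpNorm_ne_top _)]
    refine eLpNorm_congr_ae ?_
    exact (((Lp.coeFn_sub (f p) (f q)).trans ((hfg p).sub (hfg q)))).symm
  have hunif : ∀ R : ℝ, ∀ ε > 0, ∃ N, ∀ p ≥ N, ∀ q ≥ N, ∀ x ∈ Metric.ball (0 : CSpace n) R,
      ‖g p x - g q x‖ < ε := by
    intro R ε hε
    obtain ⟨C, hC⟩ := exists_enorm_le n R
    obtain ⟨N, hN⟩ := Metric.cauchySeq_iff.1 hcauchy (ε / (C + 1)) (by positivity)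
    refine ⟨N, fun p hp q hq x hx => ?_⟩
    have h1 := hC (g p - g q) ((hg p).sub (hg q)) x hx
    rw [hnorm, ← ofReal_norm, ← ENNReal.ofReal_coe_nnreal,
      ← ENNReal.ofReal_mul C.coe_nonneg,
      ENNReal.ofReal_le_ofReal_iff (by positivity), Pi.sub_apply] at h1
    have h2 := hN p hp q hq
    calc _ ≤ C * dist (f p) (f q) := h1
      _ ≤ (C + 1) * dist (f p) (f q) := by gcongr; simp
      _ < (C + 1) * (ε / (C + 1)) := by gcongr
      _ = ε := by field_simp
  have hder : ∀ R : ℝ, ∀ ε > 0, ∃ N, ∀ p ≥ N, ∀ q ≥ N, ∀ x ∈ Metric.ball (0 : CSpace n) R,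
      ‖fderiv ℂ (g p) x - fderiv ℂ (g q) x‖ < ε := by
    intro R ε hε
    obtain ⟨N, hN⟩ := hunif (R + 1) (ε / 4) (by positivity)
    refine ⟨N, fun p hp q hq x hx => ?_⟩
    rw [← fderiv_sub (hg p x) (hg q x)]
    have hmem : ∀ y ∈ Metric.ball x 1, y ∈ Metric.ball (0 : CSpace n) (R + 1) := by
      intro y hy
      rw [Metric.mem_ball] at *
      linarith [dist_triangle y x 0]
    have hmaps : Set.MapsTo (g p - g q) (Metric.ball x 1)
        (Metric.closedBall ((g p - g q) x) (ε / 2)) := by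
      intro y hy
      rw [Metric.mem_closedBall, dist_eq_norm]
      refine (norm_sub_le _ _).trans ?_
      have a := hN p hp q hq y (hmem y hy)
      have b := hN p hp q hq x (hmem x (Metric.mem_ball_self one_pos))
      simp only [Pi.sub_apply]
      linarith
    have := Complex.norm_fderiv_le_div_of_mapsTo_ball
      (((hg p).sub (hg q)).differentiableOn) hmaps one_pos
    linarith
  have hcs : ∀ x, ∃ y, Tendsto (fun p => g p x) atTop (𝓝 y) := fun x =>
    cauchySeq_tendsto_of_complete <| Metric.cauchySeq_iff.2 fun ε hε => by
      obtain ⟨N, hN⟩ := hunif (‖x‖ + 1) ε hε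
      exact ⟨N, fun p hp q hq => by
        rw [dist_eq_norm]; exact hN p hp q hq x (by simp)⟩
  have hcd : ∀ x, ∃ y, Tendsto (fun p => fderiv ℂ (g p) x) atTop (𝓝 y) := fun x =>
    cauchySeq_tendsto_of_complete <| Metric.cauchySeq_iff.2 fun ε hε => by
      obtain ⟨N, hN⟩ := hder (‖x‖ + 1) ε hε
      exact ⟨N, fun p hp q hq => by
        rw [dist_eq_norm]; exact hN p hp q hq x (by simp)⟩
  choose G hG using hcs
  choose G' hG' using hcd
  refine ⟨G, fun x => ?_, ?_⟩
  · have hu : UniformCauchySeqOn (fun p => fderiv ℂ (g p)) atTop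
        (Metric.ball (0 : CSpace n) (‖x‖ + 1)) := by
      rw [Metric.uniformCauchySeqOn_iff]
      intro ε hε
      obtain ⟨N, hN⟩ := hder (‖x‖ + 1) ε hε
      exact ⟨N, fun p hp q hq y hy => by rw [dist_eq_norm]; exact hN p hp q hq y hy⟩
    exact (hasFDerivAt_of_tendstoUniformlyOn Metric.isOpen_ball
      (hu.tendstoUniformlyOn_of_tendsto fun y _ => hG' y)
      (fun p y _ => (hg p y).hasFDerivAt) (fun y _ => hG y)
      (show x ∈ Metric.ball (0 : CSpace n) (‖x‖ + 1) by simp)).differentiableAt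
  · obtain ⟨ns, hns, hlim⟩ := (tendstoInMeasure_of_tendsto_Lp hF).exists_seq_tendsto_ae
    have hall : ∀ᵐ z ∂gaussian n, ∀ p, f p z = g p z := ae_all_iff.2 hfg
    filter_upwards [hlim, hall] with z hz hz'
    refine tendsto_nhds_unique hz ?_
    simp only [hz']
    exact (hG z).comp hns.tendsto_atTop

instance : CompleteSpace (fockSubmodule n) := (isClosed_fockSubmodule n).completeSpace_coe

/-- The Fock space as a Hilbert space, with the inner product of `L²` of the Gaussian measure. -/
def Fock : Type := fockSubmodule n

instance : NormedAddCommGroup (Fock n) := inferInstanceAs (NormedAddCommGroup (fockSubmodule n))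

instance : InnerProductSpace ℂ (Fock n) :=
  inferInstanceAs (InnerProductSpace ℂ (fockSubmodule n))

instance : CompleteSpace (Fock n) := inferInstanceAs (CompleteSpace (fockSubmodule n))

/-- The inclusion of the Fock space in `L²` of the Gaussian measure. -/
def Fock.incl : Fock n →L[ℂ] Lp ℂ 2 (gaussian n) := (fockSubmodule n).subtypeL

/-- The Bergman projection: the orthogonal projection of `L²` onto the Fock space. -/
def Fock.proj : Lp ℂ 2 (gaussian n) →L[ℂ] Fock n := (fockSubmodule n).orthogonalProjectionOnto

/-! ### Toeplitz operators with quasi-radial symbols -/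

lemma memLp_gaussian {φ : CSpace n → ℂ} (hφ : MemLp φ ∞ volume) : MemLp φ ∞ (gaussian n) :=
  ⟨hφ.1.mono_ac (withDensity_absolutelyContinuous _ _), by
    rw [eLpNorm_exponent_top]
    exact (eLpNormEssSup_mono_measure φ (withDensity_absolutelyContinuous _ _)).trans_lt
      (by simpa using hφ.2)⟩

/-- The Toeplitz operator `f ↦ P (φ f)` on the Fock space, with `P` the Bergman projection. -/
def toeplitz (φ : CSpace n → ℂ) (hφ : MemLp φ ∞ volume) : Fock n →L[ℂ] Fock n :=
  Fock.proj n ∘L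
    (ContinuousLinearMap.mul ℂ ℂ).holderL (gaussian n) ∞ 2 2 (memLp_gaussian n hφ).toLp ∘L
    Fock.incl n

/-- `φ` belongs to `L^∞(ℂ^n)^G` for `G = U(n₁) × ⋯ × U(n_k)`: it is measurable, essentially
bounded, and invariant under the action of `G`. -/
structure IsQuasiRadial (φ : CSpace n → ℂ) : Prop where
  measurable : Measurable φ
  memLp : MemLp φ ∞ volume
  invariant : ∀ (A : (j : Fin k) → Matrix.unitaryGroup (Fin (n j)) ℂ) (z : CSpace n),
    φ (fun j => (A j : Matrix (Fin (n j)) (Fin (n j)) ℂ).mulVec (z j)) = φ z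

/-- The set of all Toeplitz operators with quasi-radial symbols. -/
def quasiRadialToeplitz : Set (Fock n →L[ℂ] Fock n) :=
  {T | ∃ (φ : CSpace n → ℂ) (hφ : IsQuasiRadial n φ), T = toeplitz n φ hφ.memLp}

/-- The C*-algebra generated by the Toeplitz operators with quasi-radial symbols: the norm closure
of the *-algebra they generate in the bounded operators on the Fock space (the constant symbol `1`
gives the identity operator). -/
def toeplitzAlgebra : StarSubalgebra ℂ (Fock n →L[ℂ] Fock n) :=
  (StarAlgebra.adjoin ℂ (quasiRadialToeplitz n)).topologicalClosure

/-- The subspace `P_{m₁}(ℂ^{n₁}) ⊗ ⋯ ⊗ P_{m_k}(ℂ^{n_k})` of the Fock space: the span of the products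
`p₁(z₍₁₎) ⋯ p_k(z₍ₖ₎)`, with `p_j` a homogeneous polynomial of degree `m_j` in `n_j` variables. -/
def homogeneousPart (m : Fin k → ℕ) : Submodule ℂ (Fock n) :=
  Submodule.span ℂ {f | ∃ p : (j : Fin k) → MvPolynomial (Fin (n j)) ℂ,
    (∀ j, (p j).IsHomogeneous (m j)) ∧
    ⇑(Fock.incl n f) =ᵐ[gaussian n] fun z => ∏ j, MvPolynomial.eval (z j) (p j)}

/-- `γ` is the eigenvalue function of `T`: on each `P_{m₁}(ℂ^{n₁}) ⊗ ⋯ ⊗ P_{m_k}(ℂ^{n_k})` the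
operator `T` acts as the scalar `γ m`. -/
def IsEigenvalueFunction (T : Fock n →L[ℂ] Fock n) (γ : (Fin k → ℕ) → ℂ) : Prop :=
  ∀ m, ∀ f ∈ homogeneousPart n m, T f = γ m • f

/-- The set `𝔊_n` of all eigenvalue functions of Toeplitz operators with quasi-radial symbols. -/
def eigenvalueFunctions : Set ((Fin k → ℕ) → ℂ) :=
  {γ | ∃ T ∈ quasiRadialToeplitz n, IsEigenvalueFunction n T γ}

/-! ### Bounded functions that are uniformly continuous for the square-root metric -/

/-- The square-root metric on `ℕ₀^k`. -/
def sqrtDist {k : ℕ} (m m' : Fin k → ℕ) : ℝ := ∑ j, |√(m j : ℝ) - √(m' j : ℝ)|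

/-- The C*-algebra `ℓ^∞(ℕ₀^k)`. -/
abbrev LInfty (k : ℕ) : Type := lp (fun _ : Fin k → ℕ => ℂ) ∞

/-- The algebra `C_{b,u}(ℕ₀^k, ρ_k)` as a *-subalgebra of `ℓ^∞(ℕ₀^k)`. -/
def Cbu (k : ℕ) : StarSubalgebra ℂ (LInfty k) where
  carrier := {σ | ∀ ε > 0, ∃ δ > 0, ∀ m m', sqrtDist m m' < δ → ‖σ m - σ m'‖ < ε}
  mul_mem' := by
    intro σ τ hσ hτ ε hε
    obtain ⟨δ₁, h₁, H₁⟩ := hσ (ε / (2 * (‖τ‖ + 1))) (by positivity)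
    obtain ⟨δ₂, h₂, H₂⟩ := hτ (ε / (2 * (‖σ‖ + 1))) (by positivity)
    refine ⟨min δ₁ δ₂, lt_min h₁ h₂, fun m m' hm => ?_⟩
    have a := H₁ m m' (hm.trans_le (min_le_left _ _))
    have b := H₂ m m' (hm.trans_le (min_le_right _ _))
    have hs := lp.norm_apply_le_norm ENNReal.top_ne_zero σ m
    have ht := lp.norm_apply_le_norm ENNReal.top_ne_zero τ m'
    have e : (σ * τ) m - (σ * τ) m' = σ m * (τ m - τ m') + (σ m - σ m') * τ m' := by
      simp only [lp.infty_coeFn_mul, Pi.mul_apply]; ring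
    rw [e]
    calc _ ≤ ‖σ m‖ * ‖τ m - τ m'‖ + ‖σ m - σ m'‖ * ‖τ m'‖ := by
          refine (norm_add_le _ _).trans ?_
          rw [norm_mul, norm_mul]
      _ ≤ ‖σ‖ * (ε / (2 * (‖σ‖ + 1))) + (ε / (2 * (‖τ‖ + 1))) * ‖τ‖ := by gcongr
      _ < (‖σ‖ + 1) * (ε / (2 * (‖σ‖ + 1))) + (ε / (2 * (‖τ‖ + 1))) * (‖τ‖ + 1) := by
          gcongr <;> linarith
      _ = ε := by field_simp; ring
  add_mem' := by
    intro σ τ hσ hτ ε hε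
    obtain ⟨δ₁, h₁, H₁⟩ := hσ (ε / 2) (by positivity)
    obtain ⟨δ₂, h₂, H₂⟩ := hτ (ε / 2) (by positivity)
    refine ⟨min δ₁ δ₂, lt_min h₁ h₂, fun m m' hm => ?_⟩
    have a := H₁ m m' (hm.trans_le (min_le_left _ _))
    have b := H₂ m m' (hm.trans_le (min_le_right _ _))
    have e : (σ + τ) m - (σ + τ) m' = (σ m - σ m') + (τ m - τ m') := by
      simp only [lp.coeFn_add, Pi.add_apply]; ring
    rw [e]
    linarith [norm_add_le (σ m - σ m') (τ m - τ m')]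
  algebraMap_mem' := by
    intro c ε hε
    exact ⟨1, one_pos, fun m m' _ => by simpa [Algebra.algebraMap_eq_smul_one] using hε⟩
  star_mem' := by
    intro σ hσ ε hε
    obtain ⟨δ, h, H⟩ := hσ ε hε
    refine ⟨δ, h, fun m m' hm => ?_⟩
    have := H m m' hm
    rw [lp.star_apply, lp.star_apply, ← star_sub, norm_star]
    exact this

end FockToeplitz

end

/-!
The proof has three ingredients.

**The eigenvalues are averages over Gamma distributions.** A quasi-radial symbol is, up to a null
set, a bounded function `a` of the squared radii `|z₍₁₎|², …, |z₍ₖ₎|²`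
(`IsQuasiRadial.exists_ae_eq_comp_sqRadii`), because the unitary group acts transitively on spheres.
Rotating single coordinates shows that distinct monomials are orthogonal for such a weight. If a
point is chosen with density `|z^α|² / α!` with respect to the Gaussian measure, then its squared
radii are independent Gamma variables with parameters `|α₍ⱼ₎| + nⱼ` (`map_sqRadii_withDensity`), so
that the Toeplitz operator multiplies `z^α` by the average of `a` over this product of Gamma
distributions (`isMonomialDiagonal_toeplitz`). The monomials are complete since the reproducing
kernel `exp(w · z̄)` is a series of polynomials (`eq_zero_of_forall_integral_monomialFun`).
Conversely every bounded measurable `a` occurs. The total variation distance of the Gamma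
distributions with parameters `m + 1` and `m + 2` is `O(m ^ (-1/2))`, whence the averages are even
Lipschitz for the square-root metric (`exists_mem_Cbu_eq_integral`).

**Density.** For each coordinate consider the critical birth and death process on `ℕ₀` with
immigration at rate `p + 1`, where `p = nⱼ - 1`. Its transition kernel at time `t` has the
generating function `(1 + (t - 1)(1 - X)) ^ m (1 + t (1 - X)) ^ (-(m + p + 1))` (`branchSeries`), and
the product of these kernels is a contraction semigroup on `ℓ^∞(ℕ₀^k)`, the heat flow (`heatFun`).
At time one the process started at `m` is a Poisson variable whose intensity is Gamma distributed
with parameter `m + p + 1` (`integral_poissonAverage`). Hence the range of the heat flow at time one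
consists of averages over Gamma distributions. The semigroup is analytic: its kernel extends to
complex times near the positive axis with a bound that is uniform in `m`
(`wienerNorm_branchSeries_add_le`). Modulo the closure of the averages, the orbit of `σ` is therefore
an analytic function of the time, and it vanishes for times slightly larger than one by the
semigroup law, so that it vanishes for all times in `(0, 1]` (`mem_of_heatFun_one_mem`). The process
moves by `O(√t)` in the square-root metric, uniformly in the starting point; so the flow is strongly
continuous at `0` on `C_{b,u}`, and letting the time tend to `0` shows that every `σ ∈ C_{b,u}` is in
the closure of the averages (`mem_closure_gammaAverages`).

**The isomorphism.** The normalized monomials form a Hilbert basis, and an operator that is diagonal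
in it has as its norm the supremum of its eigenvalues. Sending an operator to its eigenvalue
function is thus an isometric *-homomorphism from the Toeplitz algebra to `C_{b,u}`; its range is
closed, and dense by the previous step (`surjective_toeplitzSymbolHom`).
-/

noncomputable section

namespace FockToeplitz

section BranchingKernel

open PowerSeries

/-! ### Power series with summable coefficients -/

/-- The `ℓ¹` norm of the coefficient sequence of a power series, possibly infinite. -/
def wienerNorm (p : ℂ⟦X⟧) : ℝ≥0∞ := ∑' l, ‖coeff l p‖ₑ

lemma wienerNorm_add_le (p q : ℂ⟦X⟧) : wienerNorm (p + q) ≤ wienerNorm p + wienerNorm q := by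
  unfold wienerNorm
  rw [← ENNReal.tsum_add]
  refine ENNReal.tsum_le_tsum fun l => ?_
  rw [map_add]
  exact enorm_add_le _ _

lemma wienerNorm_sum_le {ι : Type*} (s : Finset ι) (p : ι → ℂ⟦X⟧) :
    wienerNorm (∑ i ∈ s, p i) ≤ ∑ i ∈ s, wienerNorm (p i) := by
  classical
  induction s using Finset.induction_on with
  | empty => simp [wienerNorm]
  | insert a s ha ih =>
    rw [Finset.sum_insert ha, Finset.sum_insert ha]
    exact (wienerNorm_add_le _ _).trans (by gcongr)

lemma wienerNorm_mul_le (p q : ℂ⟦X⟧) : wienerNorm (p * q) ≤ wienerNorm p * wienerNorm q := by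
  unfold wienerNorm
  calc ∑' l, ‖coeff l (p * q)‖ₑ
      ≤ ∑' l, ∑ x ∈ Finset.HasAntidiagonal.antidiagonal l, ‖coeff x.1 p‖ₑ * ‖coeff x.2 q‖ₑ := by
        refine ENNReal.tsum_le_tsum fun l => ?_
        rw [coeff_mul]
        refine (enorm_sum_le _ _).trans (le_of_eq (Finset.sum_congr rfl fun x _ => enorm_mul _ _))
    _ = ∑' l, ∑' x : Finset.HasAntidiagonal.antidiagonal l,
          ‖coeff x.1.1 p‖ₑ * ‖coeff x.1.2 q‖ₑ :=
        tsum_congr fun l => (Finset.tsum_subtype (Finset.HasAntidiagonal.antidiagonal l)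
          fun x => ‖coeff x.1 p‖ₑ * ‖coeff x.2 q‖ₑ).symm
    _ = ∑' x : ℕ × ℕ, ‖coeff x.1 p‖ₑ * ‖coeff x.2 q‖ₑ := by
        rw [← Finset.HasAntidiagonal.sigmaAntidiagonalEquivProd.tsum_eq, ENNReal.tsum_sigma']
        rfl
    _ = (∑' l, ‖coeff l p‖ₑ) * ∑' l, ‖coeff l q‖ₑ := by
        rw [ENNReal.tsum_prod']
        simp_rw [ENNReal.tsum_mul_left, ENNReal.tsum_mul_right]

lemma wienerNorm_C (c : ℂ) : wienerNorm (C c) = ‖c‖ₑ := by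
  unfold wienerNorm
  rw [tsum_eq_single 0 fun l hl => by simp [coeff_C, hl]]
  simp

lemma wienerNorm_one : wienerNorm 1 = 1 := by
  rw [← map_one (C (R := ℂ)), wienerNorm_C]
  simp

lemma wienerNorm_X : wienerNorm X = 1 := by
  unfold wienerNorm
  rw [tsum_eq_single 1 fun l hl => by simp [coeff_X, hl]]
  simp

lemma wienerNorm_pow_le (p : ℂ⟦X⟧) (a : ℕ) : wienerNorm (p ^ a) ≤ wienerNorm p ^ a := by
  induction a with
  | zero => simp [wienerNorm_one]
  | succ a ih =>
    rw [pow_succ, pow_succ]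
    exact (wienerNorm_mul_le _ _).trans (by gcongr)

lemma wienerNorm_neg (p : ℂ⟦X⟧) : wienerNorm (-p) = wienerNorm p := by simp [wienerNorm]

lemma wienerNorm_one_sub_X_le : wienerNorm (1 - X) ≤ 2 := by
  rw [sub_eq_add_neg]
  refine (wienerNorm_add_le _ _).trans ?_
  rw [wienerNorm_neg, wienerNorm_one, wienerNorm_X]
  norm_num

lemma summable_norm_coeff {p : ℂ⟦X⟧} (hp : wienerNorm p ≠ ∞) : Summable fun l => ‖coeff l p‖ := by
  rw [← summable_norm_iff]
  simp only [norm_norm]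
  exact (tsum_enorm_ne_top_iff_summable_norm).1 hp

/-- The sum of a power series at a point of the closed unit disc; it is meaningful for series of
finite `wienerNorm`. -/
def evalDisc (z : ℂ) (p : ℂ⟦X⟧) : ℂ := ∑' l, coeff l p * z ^ l

lemma summable_evalDisc {z : ℂ} (hz : ‖z‖ ≤ 1) {p : ℂ⟦X⟧} (hp : wienerNorm p ≠ ∞) :
    Summable fun l => ‖coeff l p * z ^ l‖ := by
  refine Summable.of_nonneg_of_le (fun l => norm_nonneg _) (fun l => ?_) (summable_norm_coeff hp)
  rw [norm_mul, norm_pow]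
  exact mul_le_of_le_one_right (norm_nonneg _) (pow_le_one₀ (norm_nonneg _) hz)

lemma evalDisc_mul {z : ℂ} (hz : ‖z‖ ≤ 1) {p q : ℂ⟦X⟧} (hp : wienerNorm p ≠ ∞)
    (hq : wienerNorm q ≠ ∞) : evalDisc z (p * q) = evalDisc z p * evalDisc z q := by
  unfold evalDisc
  rw [tsum_mul_tsum_eq_tsum_sum_antidiagonal_of_summable_norm (summable_evalDisc hz hp)
    (summable_evalDisc hz hq)]
  refine tsum_congr fun l => ?_
  rw [coeff_mul, Finset.sum_mul]
  refine Finset.sum_congr rfl fun x hx => ?_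
  rw [← Finset.HasAntidiagonal.mem_antidiagonal.1 hx, pow_add]
  ring

lemma evalDisc_add {z : ℂ} (hz : ‖z‖ ≤ 1) {p q : ℂ⟦X⟧} (hp : wienerNorm p ≠ ∞)
    (hq : wienerNorm q ≠ ∞) : evalDisc z (p + q) = evalDisc z p + evalDisc z q := by
  unfold evalDisc
  rw [← (summable_evalDisc hz hp).of_norm.tsum_add (summable_evalDisc hz hq).of_norm]
  exact tsum_congr fun l => by rw [map_add, add_mul]

lemma evalDisc_C (z c : ℂ) : evalDisc z (C c) = c := by
  unfold evalDisc
  rw [tsum_eq_single 0 fun l hl => by simp [coeff_C, hl]]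
  simp

lemma evalDisc_X (z : ℂ) : evalDisc z X = z := by
  unfold evalDisc
  rw [tsum_eq_single 1 fun l hl => by simp [coeff_X, hl]]
  simp

lemma wienerNorm_pow_ne_top {p : ℂ⟦X⟧} (hp : wienerNorm p ≠ ∞) (a : ℕ) :
    wienerNorm (p ^ a) ≠ ∞ :=
  ne_top_of_le_ne_top (ENNReal.pow_ne_top hp) (wienerNorm_pow_le p a)

lemma wienerNorm_mul_ne_top {p q : ℂ⟦X⟧} (hp : wienerNorm p ≠ ∞) (hq : wienerNorm q ≠ ∞) :
    wienerNorm (p * q) ≠ ∞ :=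
  ne_top_of_le_ne_top (ENNReal.mul_ne_top hp hq) (wienerNorm_mul_le p q)

lemma evalDisc_pow {z : ℂ} (hz : ‖z‖ ≤ 1) {p : ℂ⟦X⟧} (hp : wienerNorm p ≠ ∞) (a : ℕ) :
    evalDisc z (p ^ a) = evalDisc z p ^ a := by
  induction a with
  | zero => rw [pow_zero, pow_zero, ← map_one (C (R := ℂ)), evalDisc_C]
  | succ a ih => rw [pow_succ, evalDisc_mul hz (wienerNorm_pow_ne_top hp a) hp, ih, pow_succ]

lemma coeff_eq_of_evalDisc_eq {p q : ℂ⟦X⟧} (hp : wienerNorm p ≠ ∞) (hq : wienerNorm q ≠ ∞)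
    (h : ∀ z : ℂ, ‖z‖ < 1 → evalDisc z p = evalDisc z q) : p = q := by
  have key : ∀ r : ℂ⟦X⟧, wienerNorm r ≠ ∞ →
      HasFPowerSeriesAt (fun z => evalDisc z r)
        (FormalMultilinearSeries.ofScalars ℂ fun l => coeff l r) 0 := by
    intro r hr
    refine ⟨1, ?_, one_pos, fun {y} hy => ?_⟩
    · refine FormalMultilinearSeries.le_radius_of_summable_norm _ ?_
      simpa [FormalMultilinearSeries.ofScalars_norm] using summable_norm_coeff hr
    · have hy' : ‖y‖ < 1 := by
        rw [Metric.mem_eball, edist_zero_right] at hy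
        rw [← ofReal_norm, ENNReal.ofReal_lt_one] at hy
        exact hy
      have := (summable_evalDisc hy'.le hr).of_norm.hasSum
      simpa [evalDisc, FormalMultilinearSeries.ofScalars_apply_eq, smul_eq_mul, mul_comm] using this
  have h1 := (key p hp).congr (g := fun z => evalDisc z q) (by
    filter_upwards [Metric.ball_mem_nhds (0 : ℂ) one_pos] with z hz
    exact h z (by simpa using hz))
  have h2 := h1.eq_formalMultilinearSeries (key q hq)
  ext l
  have h3 := congrArg (fun P : FormalMultilinearSeries ℂ ℂ ℂ => P.coeff l) h2
  simpa [FormalMultilinearSeries.coeff_ofScalars] using h3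

/-- A power series all of whose coefficients are nonnegative reals. -/
def NonnegCoeff (p : ℂ⟦X⟧) : Prop := ∀ l, ∃ r : ℝ, 0 ≤ r ∧ coeff l p = r

lemma NonnegCoeff.mul {p q : ℂ⟦X⟧} (hp : NonnegCoeff p) (hq : NonnegCoeff q) :
    NonnegCoeff (p * q) := by
  choose f hf hf' using hp
  choose g hg hg' using hq
  intro l
  refine ⟨∑ x ∈ Finset.HasAntidiagonal.antidiagonal l, f x.1 * g x.2,
    Finset.sum_nonneg fun x _ => mul_nonneg (hf _) (hg _), ?_⟩
  rw [coeff_mul]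
  push_cast
  exact Finset.sum_congr rfl fun x _ => by rw [hf', hg']

lemma NonnegCoeff.pow {p : ℂ⟦X⟧} (hp : NonnegCoeff p) (a : ℕ) : NonnegCoeff (p ^ a) := by
  induction a with
  | zero =>
    intro l
    refine ⟨if l = 0 then 1 else 0, by split_ifs <;> simp, ?_⟩
    rw [pow_zero, coeff_one]
    split_ifs <;> simp
  | succ a ih => rw [pow_succ]; exact ih.mul hp

lemma NonnegCoeff.coeff_eq_norm {p : ℂ⟦X⟧} (hp : NonnegCoeff p) (l : ℕ) :
    coeff l p = (‖coeff l p‖ : ℂ) := by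
  obtain ⟨r, hr, h⟩ := hp l
  rw [h, Complex.norm_real, Real.norm_of_nonneg hr]

lemma NonnegCoeff.tsum_norm {p : ℂ⟦X⟧} (hp : NonnegCoeff p) :
    ((∑' l, ‖coeff l p‖ : ℝ) : ℂ) = evalDisc 1 p := by
  rw [Complex.ofReal_tsum]
  unfold evalDisc
  exact tsum_congr fun l => by rw [one_pow, mul_one, ← hp.coeff_eq_norm]

/-! ### The generating functions of the branching kernel -/

/-- The polynomial `1 + c (1 - X)`. -/
def linSeries (c : ℂ) : ℂ⟦X⟧ := 1 + C c * (1 - X)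

/-- The power series `(1 + t (1 - X))⁻¹`, for `t ≠ -1`. -/
def geomSeries (t : ℂ) : ℂ⟦X⟧ := mk fun l => t ^ l / (1 + t) ^ (l + 1)

lemma linSeries_mul_geomSeries {t : ℂ} (ht : 1 + t ≠ 0) : linSeries t * geomSeries t = 1 := by
  have e : linSeries t = C (1 + t) - C t * X := by
    rw [linSeries, map_add, map_one]; ring
  rw [e]
  ext l
  rw [sub_mul, map_sub, coeff_C_mul, mul_assoc, coeff_C_mul, coeff_one]
  cases l with
  | zero => simp [geomSeries, ht]
  | succ l =>
    rw [coeff_succ_X_mul, geomSeries, coeff_mk, coeff_mk]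
    simp only [Nat.succ_ne_zero, if_false]
    field_simp
    ring

lemma norm_lt_norm_one_add {t : ℂ} (ht : 0 < t.re) : ‖t‖ < ‖1 + t‖ := by
  rw [← sq_lt_sq₀ (norm_nonneg _) (norm_nonneg _), Complex.sq_norm, Complex.sq_norm,
    Complex.normSq_apply, Complex.normSq_apply]
  simp
  nlinarith

lemma one_add_ne_zero_of_re_pos {t : ℂ} (ht : 0 < t.re) : 1 + t ≠ 0 := fun h => by
  have := norm_lt_norm_one_add ht
  rw [h, norm_zero] at this
  exact absurd this (not_lt.2 (norm_nonneg _))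

lemma wienerNorm_geomSeries_ne_top {t : ℂ} (ht : 0 < t.re) : wienerNorm (geomSeries t) ≠ ∞ := by
  have h0 : 0 < ‖1 + t‖ := (norm_nonneg _).trans_lt (norm_lt_norm_one_add ht)
  refine tsum_enorm_ne_top_iff_summable_norm.2 ?_
  have : Summable fun l : ℕ => ‖1 + t‖⁻¹ * (‖t‖ / ‖1 + t‖) ^ l :=
    (summable_geometric_of_lt_one (by positivity)
      ((div_lt_one h0).2 (norm_lt_norm_one_add ht))).mul_left _
  refine this.congr fun l => ?_
  rw [geomSeries, coeff_mk, norm_div, norm_pow, norm_pow, div_pow, pow_succ]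
  field_simp

lemma wienerNorm_linSeries_ne_top (c : ℂ) : wienerNorm (linSeries c) ≠ ∞ := by
  refine ne_top_of_le_ne_top (b := 1 + ‖c‖ₑ * 2) (by finiteness) ?_
  refine (wienerNorm_add_le _ _).trans ?_
  rw [wienerNorm_one]
  gcongr
  refine (wienerNorm_mul_le _ _).trans ?_
  rw [wienerNorm_C]
  gcongr
  exact wienerNorm_one_sub_X_le

lemma evalDisc_linSeries {z : ℂ} (hz : ‖z‖ ≤ 1) (c : ℂ) :
    evalDisc z (linSeries c) = 1 + c * (1 - z) := by
  have e : linSeries c = C (1 + c) + C (-c) * X := by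
    rw [linSeries, map_add, map_one, map_neg]; ring
  have hX : wienerNorm (X : ℂ⟦X⟧) ≠ ∞ := by rw [wienerNorm_X]; simp
  have hC : ∀ a : ℂ, wienerNorm (C a) ≠ ∞ := fun a => by rw [wienerNorm_C]; simp
  rw [e, evalDisc_add hz (hC _) (wienerNorm_mul_ne_top (hC _) hX), evalDisc_mul hz (hC _) hX,
    evalDisc_C, evalDisc_C, evalDisc_X]
  ring

lemma evalDisc_geomSeries {z : ℂ} (hz : ‖z‖ ≤ 1) {t : ℂ} (ht : 0 < t.re) :
    (1 + t * (1 - z)) * evalDisc z (geomSeries t) = 1 := by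
  rw [← evalDisc_linSeries hz, ← evalDisc_mul hz (wienerNorm_linSeries_ne_top t)
    (wienerNorm_geomSeries_ne_top ht), linSeries_mul_geomSeries (one_add_ne_zero_of_re_pos ht),
    ← map_one (C (R := ℂ)), evalDisc_C]

lemma evalDisc_one_geomSeries {t : ℂ} (ht : 0 < t.re) : evalDisc 1 (geomSeries t) = 1 := by
  simpa using evalDisc_geomSeries (z := 1) (by simp) ht

lemma evalDisc_one_linSeries (c : ℂ) : evalDisc 1 (linSeries c) = 1 := by
  simp [evalDisc_linSeries (z := 1) (by simp)]

lemma nonnegCoeff_geomSeries {t : ℝ} (ht : 0 ≤ t) : NonnegCoeff (geomSeries t) := fun l =>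
  ⟨t ^ l / (1 + t) ^ (l + 1), by positivity, by rw [geomSeries, coeff_mk]; push_cast; rfl⟩

lemma nonnegCoeff_linSeries {t : ℝ} (ht : 0 ≤ t) (ht1 : t ≤ 1) :
    NonnegCoeff (linSeries ((t : ℂ) - 1)) := by
  have e : linSeries ((t : ℂ) - 1) = C (t : ℂ) + C (1 - t : ℂ) * X := by
    rw [linSeries, map_sub, map_one, map_sub, map_one]; ring
  rw [e]
  intro l
  match l with
  | 0 => exact ⟨t, ht, by simp⟩
  | 1 => exact ⟨1 - t, by linarith, by simp⟩
  | l + 2 => exact ⟨0, le_rfl, by simp [coeff_succ_mul_X]⟩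

lemma NonnegCoeff.wienerNorm_eq {p : ℂ⟦X⟧} (hp : NonnegCoeff p) (hf : wienerNorm p ≠ ∞)
    (h1 : evalDisc 1 p = 1) : wienerNorm p = 1 := by
  have h2 : (∑' l, ‖coeff l p‖ : ℝ) = 1 := by
    have := hp.tsum_norm
    rw [h1] at this
    exact_mod_cast this
  unfold wienerNorm
  simp_rw [← ofReal_norm]
  rw [← ENNReal.ofReal_tsum_of_nonneg (fun l => norm_nonneg _) (summable_norm_coeff hf), h2,
    ENNReal.ofReal_one]

lemma wienerNorm_geomSeries_pow {t : ℝ} (ht : 0 < t) (a : ℕ) :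
    wienerNorm (geomSeries t ^ a) = 1 := by
  have h := wienerNorm_geomSeries_ne_top (t := t) (by simpa using ht)
  refine ((nonnegCoeff_geomSeries ht.le).pow a).wienerNorm_eq (wienerNorm_pow_ne_top h a) ?_
  rw [evalDisc_pow (by simp) h, evalDisc_one_geomSeries (by simpa using ht), one_pow]

lemma wienerNorm_linSeries_pow {t : ℝ} (ht : 0 ≤ t) (ht1 : t ≤ 1) (a : ℕ) :
    wienerNorm (linSeries ((t : ℂ) - 1) ^ a) = 1 := by
  have h := wienerNorm_linSeries_ne_top ((t : ℂ) - 1)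
  refine ((nonnegCoeff_linSeries ht ht1).pow a).wienerNorm_eq (wienerNorm_pow_ne_top h a) ?_
  rw [evalDisc_pow (by simp) h, evalDisc_one_linSeries, one_pow]

lemma derivative_geomSeries {t : ℂ} (ht : 1 + t ≠ 0) :
    d⁄dX ℂ (geomSeries t) = C t * geomSeries t ^ 2 := by
  have h := linSeries_mul_geomSeries ht
  have h2 := congrArg (d⁄dX ℂ) h
  have h3 : d⁄dX ℂ (linSeries t) = -C t := by
    simp [linSeries, Derivation.leibniz]
  rw [Derivation.leibniz, h3, Derivation.map_one_eq_zero, smul_eq_mul, smul_eq_mul] at h2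
  linear_combination geomSeries t * h2 - (d⁄dX ℂ (geomSeries t)) * h

lemma derivative_geomSeries_pow {t : ℂ} (ht : 1 + t ≠ 0) (a : ℕ) :
    d⁄dX ℂ (geomSeries t ^ a) = C (a * t) * geomSeries t ^ (a + 1) := by
  rw [derivative_pow, derivative_geomSeries ht]
  cases a with
  | zero => simp
  | succ a =>
    rw [map_mul, map_natCast, Nat.add_sub_cancel]
    ring

/-! ### Moments and the smoothing estimate -/

/-- The second moment about `c` of a nonnegative coefficient sequence, through the derivatives of
its generating function at `1`. -/
lemma NonnegCoeff.hasSum_mul_sub_sq {p : ℂ⟦X⟧} (hp : NonnegCoeff p) (h0 : wienerNorm p ≠ ∞)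
    (h1 : wienerNorm (d⁄dX ℂ p) ≠ ∞) (h2 : wienerNorm (d⁄dX ℂ (d⁄dX ℂ p)) ≠ ∞) (c v : ℝ)
    (hv : (v : ℂ) = evalDisc 1 (d⁄dX ℂ (d⁄dX ℂ p)) + (1 - 2 * c) * evalDisc 1 (d⁄dX ℂ p)
      + c ^ 2 * evalDisc 1 p) :
    HasSum (fun l : ℕ => ‖coeff l p‖ * ((l : ℝ) - c) ^ 2) v := by
  have e0 : HasSum (fun l => coeff l p) (evalDisc 1 p) := by
    simpa [evalDisc] using (summable_evalDisc (z := 1) (by simp) h0).of_norm.hasSum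
  have e1 : HasSum (fun l : ℕ => (l : ℂ) * coeff l p) (evalDisc 1 (d⁄dX ℂ p)) := by
    have := (summable_evalDisc (z := 1) (by simp) h1).of_norm.hasSum
    rw [← hasSum_nat_add_iff' 1]
    simpa [evalDisc, coeff_derivative, mul_comm] using this
  have e2 : HasSum (fun l : ℕ => ((l : ℂ) * (l - 1)) * coeff l p)
      (evalDisc 1 (d⁄dX ℂ (d⁄dX ℂ p))) := by
    have := (summable_evalDisc (z := 1) (by simp) h2).of_norm.hasSum
    rw [← hasSum_nat_add_iff' 2]
    simp only [one_pow, mul_one, coeff_derivative] at this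
    convert! this using 2 with l
    · push_cast; ring
    · simp [Finset.sum_range_succ, evalDisc, coeff_derivative]
  have := (e2.add (e1.mul_left (1 - 2 * (c : ℂ)))).add (e0.mul_left ((c : ℂ) ^ 2))
  rw [← hv] at this
  refine (Complex.hasSum_ofReal (f := fun l : ℕ => ‖coeff l p‖ * ((l : ℝ) - c) ^ 2)).1 ?_
  convert! this using 2 with l
  push_cast
  rw [← hp.coeff_eq_norm]
  ring

lemma wienerNorm_C_mul_ne_top (c : ℂ) {p : ℂ⟦X⟧} (hp : wienerNorm p ≠ ∞) :
    wienerNorm (C c * p) ≠ ∞ :=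
  wienerNorm_mul_ne_top (by rw [wienerNorm_C]; simp) hp

lemma evalDisc_C_mul {z : ℂ} (hz : ‖z‖ ≤ 1) (c : ℂ) {p : ℂ⟦X⟧} (hp : wienerNorm p ≠ ∞) :
    evalDisc z (C c * p) = c * evalDisc z p := by
  rw [evalDisc_mul hz (by rw [wienerNorm_C]; simp) hp, evalDisc_C]

lemma wienerNorm_geomSeries_pow_ne_top {t : ℂ} (ht : 0 < t.re) (a : ℕ) :
    wienerNorm (geomSeries t ^ a) ≠ ∞ :=
  wienerNorm_pow_ne_top (wienerNorm_geomSeries_ne_top ht) a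

lemma evalDisc_one_geomSeries_pow {t : ℂ} (ht : 0 < t.re) (a : ℕ) :
    evalDisc 1 (geomSeries t ^ a) = 1 := by
  rw [evalDisc_pow (by simp) (wienerNorm_geomSeries_ne_top ht), evalDisc_one_geomSeries ht, one_pow]

/-- The variance of the negative binomial distribution. -/
lemma hasSum_variance_geomSeries_pow {t : ℝ} (ht : 0 < t) (a : ℕ) :
    HasSum (fun l : ℕ => ‖coeff l (geomSeries t ^ a)‖ * ((l : ℝ) - a * t) ^ 2)
      (a * t * (1 + t)) := by
  have ht' : 0 < (t : ℂ).re := by simpa using ht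
  have hn := wienerNorm_geomSeries_pow_ne_top ht'
  have d1 := derivative_geomSeries_pow (one_add_ne_zero_of_re_pos ht')
  have d2 : d⁄dX ℂ (d⁄dX ℂ (geomSeries (t : ℂ) ^ a))
      = C ((a : ℂ) * t) * (C (((a + 1 : ℕ) : ℂ) * t) * geomSeries t ^ (a + 1 + 1)) := by
    rw [d1, Derivation.leibniz, derivative_C, smul_zero, add_zero, d1, smul_eq_mul]
  refine ((nonnegCoeff_geomSeries ht.le).pow a).hasSum_mul_sub_sq (hn a) ?_ ?_ _ _ ?_
  · rw [d1]; exact wienerNorm_C_mul_ne_top _ (hn _)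
  · rw [d2]; exact wienerNorm_C_mul_ne_top _ (wienerNorm_C_mul_ne_top _ (hn _))
  · have h1 : ‖(1 : ℂ)‖ ≤ 1 := by simp
    rw [d2, d1, evalDisc_C_mul h1 _ (wienerNorm_C_mul_ne_top _ (hn _)),
      evalDisc_C_mul h1 _ (hn _), evalDisc_C_mul h1 _ (hn _), evalDisc_one_geomSeries_pow ht',
      evalDisc_one_geomSeries_pow ht', evalDisc_one_geomSeries_pow ht']
    push_cast
    ring

lemma coeff_X_mul_derivative (p : ℂ⟦X⟧) (l : ℕ) : coeff l (X * d⁄dX ℂ p) = l * coeff l p := by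
  cases l with
  | zero => simp
  | succ l => rw [coeff_succ_X_mul, coeff_derivative, mul_comm]; push_cast; rfl

/-- One difference of a negative binomial distribution gains the inverse of its standard
deviation. -/
lemma wienerNorm_one_sub_X_mul_geomSeries_pow_succ {t : ℝ} (ht : 0 < t) {a : ℕ} (ha : 1 ≤ a) :
    wienerNorm ((1 - X) * geomSeries t ^ (a + 1)) ≤ ENNReal.ofReal (1 / √(a * t)) := by
  have ha' : (0 : ℝ) < a := by exact_mod_cast ha
  have ht' : 1 + (t : ℂ) ≠ 0 := one_add_ne_zero_of_re_pos (by simpa using ht)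
  set v : ℝ := a * t * (1 + t) with hv
  have hv0 : 0 < v := by positivity
  set q := geomSeries (t : ℂ) ^ (a + 1) with hq
  have hcoef : ∀ l, ‖coeff l ((1 - X) * q)‖
      = v⁻¹ * (‖coeff l (geomSeries (t : ℂ) ^ a)‖ * |(l : ℝ) - a * t|) := by
    intro l
    have e1 : C ((a : ℂ) * t * (1 + t)) * ((1 - X) * q)
        = C ((a : ℂ) * t) * geomSeries t ^ a - X * d⁄dX ℂ (geomSeries (t : ℂ) ^ a) := by
      have h := linSeries_mul_geomSeries ht'
      have h2 : geomSeries (t : ℂ) ^ a = linSeries t * q := by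
        rw [hq, pow_succ']
        linear_combination (-geomSeries (t : ℂ) ^ a) * h
      rw [derivative_geomSeries_pow ht', ← hq, h2, linSeries]
      simp only [map_mul, map_add, map_one]
      ring
    have e2 := congrArg (coeff l) e1
    rw [coeff_C_mul, map_sub, coeff_C_mul, coeff_X_mul_derivative] at e2
    have e3 : (v : ℂ) * coeff l ((1 - X) * q)
        = coeff l (geomSeries (t : ℂ) ^ a) * ((-((l : ℝ) - a * t) : ℝ) : ℂ) := by
      rw [hv]; push_cast; rw [e2]; ring
    have e4 := congrArg norm e3
    rw [norm_mul, norm_mul, Complex.norm_real, Complex.norm_real, Real.norm_of_nonneg hv0.le,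
      Real.norm_eq_abs, abs_neg] at e4
    rw [← e4, inv_mul_cancel_left₀ hv0.ne']
  have hs1 := hasSum_variance_geomSeries_pow ht a
  have hs0 : HasSum (fun l => ‖coeff l (geomSeries (t : ℂ) ^ a)‖) 1 := by
    have hn := wienerNorm_geomSeries_pow_ne_top (t := t) (by simpa using ht) a
    have := ((nonnegCoeff_geomSeries ht.le).pow a).tsum_norm
    rw [evalDisc_one_geomSeries_pow (by simpa using ht)] at this
    have h2 : (∑' l, ‖coeff l (geomSeries (t : ℂ) ^ a)‖ : ℝ) = 1 := by exact_mod_cast this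
    rw [← h2]
    exact (summable_norm_coeff hn).hasSum
  set c : ℝ := √v with hc
  have hc0 : 0 < c := Real.sqrt_pos.2 hv0
  have hcv : c ^ 2 = v := Real.sq_sqrt hv0.le
  -- Cauchy–Schwarz in the form `|x| ≤ (x² / c + c) / 2`, with `c` the standard deviation
  have hmaj := ((hs1.mul_left c⁻¹).add (hs0.mul_left c)).mul_left (v⁻¹ / 2)
  have hle : ∀ l, ‖coeff l ((1 - X) * q)‖ ≤ v⁻¹ / 2 *
      (c⁻¹ * (‖coeff l (geomSeries (t : ℂ) ^ a)‖ * ((l : ℝ) - a * t) ^ 2)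
        + c * ‖coeff l (geomSeries (t : ℂ) ^ a)‖) := by
    intro l
    rw [hcoef l]
    set x := (l : ℝ) - a * t
    set y := ‖coeff l (geomSeries (t : ℂ) ^ a)‖
    have hx : |x| ≤ (c⁻¹ * x ^ 2 + c) / 2 := by
      have h3 : 0 ≤ c⁻¹ * (|x| - c) ^ 2 := by positivity
      have h4 : c⁻¹ * (|x| - c) ^ 2 = c⁻¹ * x ^ 2 - 2 * |x| + c := by
        rw [sub_sq, sq_abs]; field_simp
      linarith
    have hy : 0 ≤ y := norm_nonneg _
    calc v⁻¹ * (y * |x|) ≤ v⁻¹ * (y * ((c⁻¹ * x ^ 2 + c) / 2)) := by gcongr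
      _ = _ := by ring
  have hsum : Summable fun l => ‖coeff l ((1 - X) * q)‖ :=
    Summable.of_nonneg_of_le (fun l => norm_nonneg _) hle hmaj.summable
  unfold wienerNorm
  simp_rw [← ofReal_norm]
  rw [← ENNReal.ofReal_tsum_of_nonneg (fun l => norm_nonneg _) hsum]
  refine ENNReal.ofReal_le_ofReal ((hsum.tsum_le_tsum hle hmaj.summable).trans ?_)
  rw [hmaj.tsum_eq, ← hv, ← hcv]
  have h5 : √(a * t) ≤ c := Real.sqrt_le_sqrt (by rw [hv]; nlinarith [mul_pos ha' ht])
  have h6 : 0 < √(a * t) := Real.sqrt_pos.2 (by positivity)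
  calc (c ^ 2)⁻¹ / 2 * (c⁻¹ * c ^ 2 + c * 1) = 1 / c := by field_simp; ring
    _ ≤ _ := by gcongr

lemma wienerNorm_one_sub_X_mul_geomSeries_pow {t : ℝ} (ht : 0 < t) (ht1 : t ≤ 1) {a : ℕ}
    (ha : 1 ≤ a) :
    wienerNorm ((1 - X) * geomSeries t ^ a) ≤ ENNReal.ofReal (2 / √(a * t)) := by
  obtain rfl | ha2 := ha.eq_or_lt
  · refine (wienerNorm_mul_le _ _).trans ?_
    rw [wienerNorm_geomSeries_pow ht, mul_one]
    refine wienerNorm_one_sub_X_le.trans ?_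
    rw [← ENNReal.ofReal_ofNat]
    refine ENNReal.ofReal_le_ofReal ?_
    rw [le_div_iff₀ (Real.sqrt_pos.2 (by positivity))]
    have : √((1 : ℕ) * t) ≤ 1 := Real.sqrt_le_one.2 (by simpa using ht1)
    linarith
  · obtain ⟨b, rfl⟩ : ∃ b, a = b + 1 := ⟨a - 1, by omega⟩
    have hb : 1 ≤ b := by omega
    have hb' : (1 : ℝ) ≤ b := by exact_mod_cast hb
    refine (wienerNorm_one_sub_X_mul_geomSeries_pow_succ ht hb).trans
      (ENNReal.ofReal_le_ofReal ?_)
    have h0 : 0 < √(b * t) := Real.sqrt_pos.2 (by positivity)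
    rw [div_le_div_iff₀ h0 (Real.sqrt_pos.2 (by positivity)), one_mul]
    refine Real.sqrt_le_iff.2 ⟨by positivity, ?_⟩
    rw [mul_pow, Real.sq_sqrt (by positivity)]
    push_cast
    nlinarith

/-- The smoothing estimate: `2j` differences of the `(m + j)`-fold convolution of a geometric
distribution, obtained by distributing the differences over blocks of equal length. -/
lemma wienerNorm_one_sub_X_pow_mul_geomSeries_pow {t : ℝ} (ht : 0 < t) (ht1 : t ≤ 1) {m j : ℕ}
    (hj : j ≤ m) :
    wienerNorm ((1 - X) ^ (2 * j) * geomSeries t ^ (m + j))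
      ≤ ENNReal.ofReal ((16 * j / (m * t)) ^ j) := by
  rcases Nat.eq_zero_or_pos j with rfl | hj0
  · simp [wienerNorm_geomSeries_pow ht]
  set a := (m + j) / (2 * j) with ha
  set r := (m + j) % (2 * j) with hr
  have hdiv : 2 * j * a + r = m + j := Nat.div_add_mod _ _
  have hrlt : r < 2 * j := Nat.mod_lt _ (by omega)
  have ha1 : 1 ≤ a := (Nat.one_le_div_iff (by omega)).2 (by omega)
  have ha4 : m ≤ 4 * j * a := by nlinarith
  have e : (1 - X) ^ (2 * j) * geomSeries (t : ℂ) ^ (m + j)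
      = ((1 - X) * geomSeries (t : ℂ) ^ a) ^ (2 * j) * geomSeries (t : ℂ) ^ r := by
    rw [← hdiv, mul_pow, ← pow_mul, pow_add, mul_comm a]
    ring
  rw [e]
  refine (wienerNorm_mul_le _ _).trans ?_
  rw [wienerNorm_geomSeries_pow ht, mul_one]
  refine (wienerNorm_pow_le _ _).trans ?_
  refine (pow_le_pow_left' (wienerNorm_one_sub_X_mul_geomSeries_pow ht ht1 ha1) _).trans ?_
  rw [← ENNReal.ofReal_pow (by positivity)]
  refine ENNReal.ofReal_le_ofReal ?_
  have haR : (0 : ℝ) < a := by exact_mod_cast ha1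
  have hjR : (0 : ℝ) < j := by exact_mod_cast hj0
  have hmR : (0 : ℝ) < m := by exact_mod_cast (by omega : 0 < m)
  have ha4R : (m : ℝ) ≤ 4 * j * a := by exact_mod_cast ha4
  rw [pow_mul]
  refine pow_le_pow_left₀ (by positivity) ?_ _
  rw [div_pow, Real.sq_sqrt (by positivity), div_le_div_iff₀ (by positivity) (by positivity)]
  nlinarith

/-! ### The branching kernel -/

/-- The generating function in `l` of the branching kernel `K_t(m, l)`. For real `t > 0` it is the
law at time `t` of the critical birth and death process started at `m`, with immigration at rate
`p + 1`; as a Banach-space valued function it continues to complex `t`. -/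
def branchSeries (p : ℕ) (t : ℂ) (m : ℕ) : ℂ⟦X⟧ :=
  linSeries (t - 1) ^ m * geomSeries t ^ (m + p + 1)

lemma wienerNorm_branchSeries_ne_top (p : ℕ) {t : ℂ} (ht : 0 < t.re) (m : ℕ) :
    wienerNorm (branchSeries p t m) ≠ ∞ :=
  wienerNorm_mul_ne_top (wienerNorm_pow_ne_top (wienerNorm_linSeries_ne_top _) _)
    (wienerNorm_geomSeries_pow_ne_top ht _)

lemma nonnegCoeff_branchSeries (p : ℕ) {t : ℝ} (ht : 0 ≤ t) (ht1 : t ≤ 1) (m : ℕ) :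
    NonnegCoeff (branchSeries p t m) :=
  ((nonnegCoeff_linSeries ht ht1).pow _).mul ((nonnegCoeff_geomSeries ht).pow _)

lemma evalDisc_one_branchSeries (p : ℕ) {t : ℂ} (ht : 0 < t.re) (m : ℕ) :
    evalDisc 1 (branchSeries p t m) = 1 := by
  rw [branchSeries, evalDisc_mul (by simp) (wienerNorm_pow_ne_top (wienerNorm_linSeries_ne_top _) _)
    (wienerNorm_geomSeries_pow_ne_top ht _), evalDisc_one_geomSeries_pow ht,
    evalDisc_pow (by simp) (wienerNorm_linSeries_ne_top _), evalDisc_one_linSeries, one_pow, one_mul]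

lemma wienerNorm_branchSeries (p : ℕ) {t : ℝ} (ht : 0 < t) (ht1 : t ≤ 1) (m : ℕ) :
    wienerNorm (branchSeries p t m) = 1 :=
  (nonnegCoeff_branchSeries p ht.le ht1 m).wienerNorm_eq
    (wienerNorm_branchSeries_ne_top p (by simpa using ht) m)
    (evalDisc_one_branchSeries p (by simpa using ht) m)

lemma pow_self_le_factorial_mul (j : ℕ) :
    (j : ℝ) ^ j ≤ Real.exp 1 ^ j * (j.factorial : ℝ) := by
  have := Real.pow_div_factorial_le_exp (x := j) (Nat.cast_nonneg j) j
  rw [div_le_iff₀ (by positivity)] at this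
  rwa [← Real.exp_nat_mul, mul_one]

/-- The branching kernel is bounded on `ℓ^∞`, uniformly for complex times near a real one. This is
what makes the semigroup analytic. The `m`-th power of the one-particle generating function is
expanded around its value at `t`; by the smoothing estimate and `j ^ j ≤ e ^ j * j!` the `j`-th term
is at most `2⁻¹ ^ j` when `‖h‖ ≤ t / 200`. -/
lemma wienerNorm_branchSeries_add_le (p : ℕ) {t : ℝ} (ht : 0 < t) (ht1 : t ≤ 1) {h : ℂ}
    (hh : ‖h‖ ≤ t / 200) (m : ℕ) :
    wienerNorm (branchSeries p (t + h) m) ≤ 2 ^ (p + 2) := by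
  have hre : 0 < ((t : ℂ) + h).re := by
    have := (abs_le.1 ((Complex.abs_re_le_norm h).trans hh)).1
    simp only [Complex.add_re, Complex.ofReal_re]
    linarith
  set G := geomSeries (t : ℂ) with hG
  set s : ℂ⟦X⟧ := 1 - X with hs
  set W := linSeries (t : ℂ) * geomSeries (t + h) with hW
  have hLG : linSeries (t : ℂ) * G = 1 :=
    linSeries_mul_geomSeries (one_add_ne_zero_of_re_pos (by simpa using ht))
  have hLG' : linSeries (t + h : ℂ) * geomSeries (t + h) = 1 :=
    linSeries_mul_geomSeries (one_add_ne_zero_of_re_pos hre)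
  have hG' : geomSeries (t + h : ℂ) = G * W := by
    rw [hW]; linear_combination (-geomSeries (t + h : ℂ)) * hLG
  have hlin : linSeries (t + h : ℂ) = linSeries t + C h * s := by
    simp only [linSeries, map_add, hs]; ring
  have hW1 : W = 1 + (-(C h * s * G)) * W := by
    have h3 : (linSeries (t : ℂ) + C h * s) * (G * W) = 1 := by rw [← hlin, ← hG']; exact hLG'
    linear_combination h3 - W * hLG
  have hWtop : wienerNorm W ≠ ∞ := wienerNorm_mul_ne_top (wienerNorm_linSeries_ne_top _)
    (wienerNorm_geomSeries_ne_top hre)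
  have hhE : ‖h‖ₑ ≤ 4⁻¹ := by
    rw [← ofReal_norm, show (4⁻¹ : ℝ≥0∞) = ENNReal.ofReal (4⁻¹) by
      rw [ENNReal.ofReal_inv_of_pos (by norm_num)]; norm_num]
    exact ENNReal.ofReal_le_ofReal (by linarith)
  have hNG : ∀ a, wienerNorm (G ^ a) = 1 := wienerNorm_geomSeries_pow ht
  have hWle : wienerNorm W ≤ 2 := by
    have h4 : wienerNorm W ≤ 1 + 2⁻¹ * wienerNorm W := by
      conv_lhs => rw [hW1]
      refine (wienerNorm_add_le _ _).trans ?_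
      rw [wienerNorm_one]
      gcongr
      refine (wienerNorm_mul_le _ _).trans ?_
      gcongr
      rw [wienerNorm_neg]
      refine (wienerNorm_mul_le _ _).trans ?_
      have := hNG 1
      rw [pow_one] at this
      rw [this, mul_one]
      refine (wienerNorm_mul_le _ _).trans ?_
      rw [wienerNorm_C]
      calc ‖h‖ₑ * wienerNorm s ≤ 4⁻¹ * 2 := by gcongr; exact wienerNorm_one_sub_X_le
        _ = 2⁻¹ := by
          rw [show (4 : ℝ≥0∞) = 2 * 2 by norm_num, ENNReal.mul_inv (by simp) (by simp), mul_assoc,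
            ENNReal.inv_mul_cancel (by simp) (by simp), mul_one]
    lift wienerNorm W to NNReal using hWtop with w
    have h5 : w ≤ 1 + 2⁻¹ * w := by
      have e2 : (2⁻¹ : ℝ≥0∞) = ((2⁻¹ : NNReal) : ℝ≥0∞) := by
        rw [ENNReal.coe_inv (by norm_num)]; rfl
      rw [e2] at h4
      exact_mod_cast h4
    have h6 : (w : ℝ) ≤ 1 + 2⁻¹ * w := by exact_mod_cast h5
    have h7 : (w : ℝ) ≤ 2 := by linarith
    exact_mod_cast h7
  -- the one-particle generating function is a second order difference away from the one at `t`
  have hΦ : linSeries (t + h - 1 : ℂ) * geomSeries (t + h)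
      = C h * s ^ 2 * G ^ 2 * W + linSeries (t - 1 : ℂ) * G := by
    have hA : linSeries (t + h - 1 : ℂ) = linSeries (t - 1 : ℂ) + C h * s := by
      simp only [linSeries, map_add, map_sub, hs]; ring
    have hC : linSeries (t : ℂ) = linSeries (t - 1 : ℂ) + s := by
      simp only [linSeries, map_sub, map_one, hs]; ring
    rw [hG', hA]
    rw [hC] at hLG
    linear_combination (linSeries (t - 1 : ℂ) * G) * hW1 + (-C h * s * G * W) * hLG
  have hterm : ∀ j ∈ Finset.range (m + 1),
      wienerNorm ((C h * s ^ 2 * G ^ 2 * W) ^ j * (linSeries (t - 1 : ℂ) * G) ^ (m - j)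
        * (m.choose j : ℂ⟦X⟧)) ≤ 2⁻¹ ^ j := by
    intro j hj
    have hjm : j ≤ m := Nat.lt_succ_iff.1 (Finset.mem_range.1 hj)
    have e1 : (C h * s ^ 2 * G ^ 2 * W) ^ j * (linSeries (t - 1 : ℂ) * G) ^ (m - j)
        * (m.choose j : ℂ⟦X⟧)
        = C ((m.choose j : ℂ) * h ^ j) * (W ^ j * (linSeries (t - 1 : ℂ) ^ (m - j)
          * (s ^ (2 * j) * G ^ (m + j)))) := by
      have e2 : m + j = 2 * j + (m - j) := by omega
      rw [e2, map_mul, map_natCast, map_pow, mul_pow, mul_pow, mul_pow, mul_pow, pow_add, pow_mul,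
        pow_mul]
      ring
    rw [e1]
    refine (wienerNorm_mul_le _ _).trans ?_
    rw [wienerNorm_C]
    have h8 : wienerNorm (W ^ j * (linSeries (t - 1 : ℂ) ^ (m - j) * (s ^ (2 * j) * G ^ (m + j))))
        ≤ 2 ^ j * (1 * ENNReal.ofReal ((16 * j / (m * t)) ^ j)) := by
      refine (wienerNorm_mul_le _ _).trans ?_
      gcongr
      · exact (wienerNorm_pow_le _ _).trans (by gcongr)
      · refine (wienerNorm_mul_le _ _).trans ?_
        gcongr
        · rw [wienerNorm_linSeries_pow ht.le ht1]
        · exact wienerNorm_one_sub_X_pow_mul_geomSeries_pow ht ht1 hjm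
    have h9 : ‖(m.choose j : ℂ) * h ^ j‖ₑ * (2 ^ j * (1 * ENNReal.ofReal ((16 * j / (m * t)) ^ j)))
        = ENNReal.ofReal ((m.choose j : ℝ) * ‖h‖ ^ j * 2 ^ j * (16 * j / (m * t)) ^ j) := by
      rw [ENNReal.ofReal_mul (by positivity), ENNReal.ofReal_mul (by positivity), ← ofReal_norm,
        norm_mul, norm_pow, Complex.norm_natCast, ENNReal.ofReal_pow (p := 2) (by norm_num)]
      simp only [ENNReal.ofReal_ofNat]
      ring
    refine (mul_le_mul_right h8 _).trans ?_
    rw [h9, show (2⁻¹ : ℝ≥0∞) ^ j = ENNReal.ofReal (2⁻¹ ^ j) by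
      rw [ENNReal.ofReal_pow (by norm_num), ENNReal.ofReal_inv_of_pos (by norm_num)]; norm_num]
    refine ENNReal.ofReal_le_ofReal ?_
    rcases Nat.eq_zero_or_pos j with rfl | hj0
    · simp
    have hmR : (0 : ℝ) < m := by exact_mod_cast (by omega : 0 < m)
    have hc : (m.choose j : ℝ) ≤ (m : ℝ) ^ j / (j.factorial : ℝ) := Nat.choose_le_pow_div j m
    have hexp : Real.exp 1 ≤ 3 := Real.exp_one_lt_three.le
    calc (m.choose j : ℝ) * ‖h‖ ^ j * 2 ^ j * (16 * j / (m * t)) ^ j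
        ≤ ((m : ℝ) ^ j / (j.factorial : ℝ)) * (t / 200) ^ j * 2 ^ j * (16 * j / (m * t)) ^ j := by
          gcongr
      _ = (m * (t / 200) * 2 * (16 / (m * t))) ^ j * ((j : ℝ) ^ j / (j.factorial : ℝ)) := by
          rw [mul_pow, mul_pow, mul_pow, div_pow (16 * (j : ℝ)), mul_pow, div_pow (16 : ℝ)]
          ring
      _ ≤ (m * (t / 200) * 2 * (16 / (m * t))) ^ j * 3 ^ j := by
          gcongr
          rw [div_le_iff₀ (by positivity)]
          exact (pow_self_le_factorial_mul j).trans (by gcongr)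
      _ = (12 / 25) ^ j := by
          rw [← mul_pow]
          congr 1
          field_simp
          norm_num
      _ ≤ 2⁻¹ ^ j := by gcongr; norm_num
  have hsplit : branchSeries p (t + h) m
      = (linSeries (t + h - 1 : ℂ) * geomSeries (t + h)) ^ m * (G ^ (p + 1) * W ^ (p + 1)) := by
    rw [branchSeries, ← mul_pow, ← hG', mul_pow, add_assoc, pow_add]
    ring
  rw [hsplit, hΦ, add_pow]
  refine (wienerNorm_mul_le _ _).trans ?_
  refine (mul_le_mul' ?_ ?_ : _ ≤ (2 : ℝ≥0∞) * (1 * 2 ^ (p + 1))).trans (le_of_eq (by ring))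
  · refine (wienerNorm_sum_le _ _).trans ((Finset.sum_le_sum hterm).trans ?_)
    refine (ENNReal.sum_le_tsum _).trans ?_
    rw [ENNReal.tsum_geometric, ENNReal.one_sub_inv_two, inv_inv]
  · refine (wienerNorm_mul_le _ _).trans ?_
    gcongr
    · rw [hNG]
    · exact (wienerNorm_pow_le _ _).trans (by gcongr)

lemma derivative_C_mul (c : ℂ) (p : ℂ⟦X⟧) : d⁄dX ℂ (C c * p) = C c * d⁄dX ℂ p := by
  rw [Derivation.leibniz, derivative_C, smul_zero, add_zero, smul_eq_mul]

lemma derivative_linSeries_pow_mul_geomSeries_pow {t : ℂ} (ht : 1 + t ≠ 0) (x y : ℕ) :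
    d⁄dX ℂ (linSeries (t - 1) ^ x * geomSeries t ^ y)
      = C (x * (1 - t)) * (linSeries (t - 1) ^ (x - 1) * geomSeries t ^ y)
        + C (y * t) * (linSeries (t - 1) ^ x * geomSeries t ^ (y + 1)) := by
  have h : d⁄dX ℂ (linSeries (t - 1)) = C (1 - t) := by
    rw [linSeries, map_add, Derivation.map_one_eq_zero, Derivation.leibniz, derivative_C,
      map_sub (d⁄dX ℂ), Derivation.map_one_eq_zero, derivative_X]
    simp
  rw [Derivation.leibniz, derivative_geomSeries_pow ht, derivative_pow, h, smul_eq_mul, smul_eq_mul]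
  simp only [map_mul, map_natCast]
  ring

/-- The branching kernel spreads by `O(√(t (m + 1)))` in time `t ≤ 1`. -/
lemma exists_hasSum_branchSeries_sq (p : ℕ) {t : ℝ} (ht : 0 < t) (ht1 : t ≤ 1) (m : ℕ) :
    ∃ v : ℝ, v ≤ (p + 3) ^ 2 * t * (m + 1) ∧
      HasSum (fun l : ℕ => ‖coeff l (branchSeries p t m)‖ * ((l : ℝ) - m) ^ 2) v := by
  have ht' : 0 < (t : ℂ).re := by simpa using ht
  have hne := one_add_ne_zero_of_re_pos ht'
  have h1 : ‖(1 : ℂ)‖ ≤ 1 := by simp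
  have hl : ∀ x, wienerNorm (linSeries ((t : ℂ) - 1) ^ x) ≠ ∞ := fun x =>
    wienerNorm_pow_ne_top (wienerNorm_linSeries_ne_top _) x
  have hg := wienerNorm_geomSeries_pow_ne_top ht'
  have hn : ∀ x y, wienerNorm (linSeries ((t : ℂ) - 1) ^ x * geomSeries t ^ y) ≠ ∞ := fun x y =>
    wienerNorm_mul_ne_top (hl x) (hg y)
  have he : ∀ x y, evalDisc 1 (linSeries ((t : ℂ) - 1) ^ x * geomSeries t ^ y) = 1 := fun x y => by
    rw [evalDisc_mul h1 (hl x) (hg y), evalDisc_one_geomSeries_pow ht',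
      evalDisc_pow h1 (wienerNorm_linSeries_ne_top _), evalDisc_one_linSeries, one_pow, one_mul]
  have d1 := derivative_linSeries_pow_mul_geomSeries_pow hne
  have hn1 : ∀ x y, wienerNorm (d⁄dX ℂ (linSeries ((t : ℂ) - 1) ^ x * geomSeries t ^ y)) ≠ ∞ := by
    intro x y
    rw [d1]
    exact ne_top_of_le_ne_top (ENNReal.add_ne_top.2 ⟨wienerNorm_C_mul_ne_top _ (hn _ _),
      wienerNorm_C_mul_ne_top _ (hn _ _)⟩) (wienerNorm_add_le _ _)
  have he1 : ∀ x y : ℕ, evalDisc 1 (d⁄dX ℂ (linSeries ((t : ℂ) - 1) ^ x * geomSeries t ^ y))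
      = x * (1 - t) + y * t := by
    intro x y
    rw [d1, evalDisc_add h1 (wienerNorm_C_mul_ne_top _ (hn _ _))
      (wienerNorm_C_mul_ne_top _ (hn _ _)), evalDisc_C_mul h1 _ (hn _ _),
      evalDisc_C_mul h1 _ (hn _ _), he, he, mul_one, mul_one]
  have d2 : ∀ x y : ℕ, d⁄dX ℂ (d⁄dX ℂ (linSeries ((t : ℂ) - 1) ^ x * geomSeries t ^ y))
      = C (x * (1 - t) : ℂ) * d⁄dX ℂ (linSeries (t - 1 : ℂ) ^ (x - 1) * geomSeries t ^ y)
        + C (y * t : ℂ) * d⁄dX ℂ (linSeries (t - 1 : ℂ) ^ x * geomSeries t ^ (y + 1)) := by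
    intro x y
    rw [d1 x y, map_add, derivative_C_mul, derivative_C_mul]
  have hn2 : ∀ x y,
      wienerNorm (d⁄dX ℂ (d⁄dX ℂ (linSeries ((t : ℂ) - 1) ^ x * geomSeries t ^ y))) ≠ ∞ := by
    intro x y
    rw [d2]
    exact ne_top_of_le_ne_top (ENNReal.add_ne_top.2 ⟨wienerNorm_C_mul_ne_top _ (hn1 _ _),
      wienerNorm_C_mul_ne_top _ (hn1 _ _)⟩) (wienerNorm_add_le _ _)
  have he2 : ∀ x y : ℕ, evalDisc 1 (d⁄dX ℂ (d⁄dX ℂ (linSeries ((t : ℂ) - 1) ^ x * geomSeries t ^ y)))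
      = x * (1 - t) * ((x - 1) * (1 - t) + y * t) + y * t * (x * (1 - t) + (y + 1) * t) := by
    intro x y
    rw [d2, evalDisc_add h1 (wienerNorm_C_mul_ne_top _ (hn1 _ _))
      (wienerNorm_C_mul_ne_top _ (hn1 _ _)), evalDisc_C_mul h1 _ (hn1 _ _),
      evalDisc_C_mul h1 _ (hn1 _ _), he1, he1]
    cases x with
    | zero => simp
    | succ x => push_cast; simp
  refine ⟨m * t * (1 - t) + (m + p + 1) * t * (1 + t) + ((p + 1) * t) ^ 2, ?_,
    (nonnegCoeff_branchSeries p ht.le ht1 m).hasSum_mul_sub_sq (hn _ _) (hn1 _ _) (hn2 _ _) _ _ ?_⟩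
  · have hm : (0 : ℝ) ≤ m := Nat.cast_nonneg m
    have hp : (0 : ℝ) ≤ p := Nat.cast_nonneg p
    have e1 : (m : ℝ) * t * (1 - t) ≤ m * t * 1 := by gcongr; linarith
    have e2 : (m + p + 1 : ℝ) * t * (1 + t) ≤ (m + p + 1) * t * 2 := by gcongr; linarith
    have e3 : ((p + 1 : ℝ) * t) ^ 2 ≤ (p + 1) ^ 2 * t := by
      rw [mul_pow]; gcongr; nlinarith
    have e4 : (m : ℝ) * t * 1 + (m + p + 1) * t * 2 + (p + 1) ^ 2 * t
        ≤ (p + 3) ^ 2 * t * (m + 1) := by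
      have : 0 ≤ t * (m * (p ^ 2 + 6 * p + 6) + 2 * p + 6) := by positivity
      nlinarith
    linarith
  · rw [branchSeries, he2, he1, he]
    push_cast
    ring

lemma sqrt_sub_sqrt_sq_le (l m : ℕ) :
    (√(l : ℝ) - √(m : ℝ)) ^ 2 * (m + 1) ≤ 2 * ((l : ℝ) - m) ^ 2 := by
  have hl : √(l : ℝ) ^ 2 = l := Real.sq_sqrt (Nat.cast_nonneg l)
  have hm : √(m : ℝ) ^ 2 = m := Real.sq_sqrt (Nat.cast_nonneg m)
  have h0 : 0 ≤ √(l : ℝ) := Real.sqrt_nonneg _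
  have h1 : 0 ≤ √(m : ℝ) := Real.sqrt_nonneg _
  rcases Nat.eq_zero_or_pos m with rfl | hmp
  · have : (l : ℝ) ≤ (l : ℝ) ^ 2 := by exact_mod_cast Nat.le_self_pow two_ne_zero l
    simp only [Nat.cast_zero, Real.sqrt_zero, sub_zero, hl]
    nlinarith [Nat.cast_nonneg (α := ℝ) l]
  · have hmR : (1 : ℝ) ≤ m := by exact_mod_cast hmp
    have e : ((l : ℝ) - m) ^ 2 = (√(l : ℝ) - √(m : ℝ)) ^ 2 * (√(l : ℝ) + √(m : ℝ)) ^ 2 := by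
      conv_lhs => rw [← hl, ← hm]
      ring
    rw [e]
    have h2 : (m : ℝ) + 1 ≤ 2 * (√(l : ℝ) + √(m : ℝ)) ^ 2 := by nlinarith [mul_nonneg h0 h1]
    calc _ ≤ (√(l : ℝ) - √(m : ℝ)) ^ 2 * (2 * (√(l : ℝ) + √(m : ℝ)) ^ 2) := by gcongr
      _ = _ := by ring

/-- In the square-root scale the branching kernel spreads by `O(√t)`, uniformly in the starting
point. -/
lemma tsum_branchSeries_mul_sqrt_sub_sq_le (p : ℕ) {t : ℝ} (ht : 0 < t) (ht1 : t ≤ 1) (m : ℕ) :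
    ∑' l : ℕ, ‖coeff l (branchSeries p t m)‖ₑ * ENNReal.ofReal ((√(l : ℝ) - √(m : ℝ)) ^ 2)
      ≤ ENNReal.ofReal (2 * (p + 3) ^ 2 * t) := by
  obtain ⟨v, hv, hsum⟩ := exists_hasSum_branchSeries_sq p ht ht1 m
  have hm : (0 : ℝ) < m + 1 := by positivity
  have h2 := hsum.mul_left (2 / (m + 1 : ℝ))
  calc _ ≤ ∑' l : ℕ, ENNReal.ofReal
        (2 / (m + 1 : ℝ) * (‖coeff l (branchSeries p t m)‖ * ((l : ℝ) - m) ^ 2)) := by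
        refine ENNReal.tsum_le_tsum fun l => ?_
        rw [← ofReal_norm, ← ENNReal.ofReal_mul (norm_nonneg _)]
        refine ENNReal.ofReal_le_ofReal ?_
        have := sqrt_sub_sqrt_sq_le l m
        rw [← le_div_iff₀ hm] at this
        calc _ ≤ ‖coeff l (branchSeries p t m)‖ * (2 * ((l : ℝ) - m) ^ 2 / (m + 1)) := by gcongr
          _ = _ := by ring
    _ = ENNReal.ofReal (2 / (m + 1 : ℝ) * v) := by
        rw [← ENNReal.ofReal_tsum_of_nonneg (fun l => by positivity) h2.summable, h2.tsum_eq]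
    _ ≤ _ := by
        refine ENNReal.ofReal_le_ofReal ?_
        rw [div_mul_eq_mul_div, div_le_iff₀ hm]
        linarith

/-! ### The semigroup law and the kernel at time one -/

lemma norm_evalDisc_le {z : ℂ} (hz : ‖z‖ ≤ 1) {p : ℂ⟦X⟧} (hp : wienerNorm p ≤ 1) :
    ‖evalDisc z p‖ ≤ 1 := by
  have hf : wienerNorm p ≠ ∞ := ne_top_of_le_ne_top ENNReal.one_ne_top hp
  have h1 : ∑' l, ‖coeff l p‖ ≤ 1 := by
    unfold wienerNorm at hp
    simp_rw [← ofReal_norm] at hp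
    rwa [← ENNReal.ofReal_tsum_of_nonneg (fun l => norm_nonneg _) (summable_norm_coeff hf),
      ENNReal.ofReal_le_one] at hp
  refine (norm_tsum_le_tsum_norm (summable_evalDisc hz hf)).trans (le_trans ?_ h1)
  refine (summable_evalDisc hz hf).tsum_le_tsum (fun l => ?_) (summable_norm_coeff hf)
  rw [norm_mul, norm_pow]
  exact mul_le_of_le_one_right (norm_nonneg _) (pow_le_one₀ (norm_nonneg _) hz)

lemma evalDisc_branchSeries {z : ℂ} (hz : ‖z‖ ≤ 1) (p : ℕ) {t : ℂ} (ht : 0 < t.re) (m : ℕ) :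
    evalDisc z (branchSeries p t m)
      = (1 + (t - 1) * (1 - z)) ^ m * evalDisc z (geomSeries t) ^ (m + p + 1) := by
  rw [branchSeries, evalDisc_mul hz (wienerNorm_pow_ne_top (wienerNorm_linSeries_ne_top _) _)
    (wienerNorm_geomSeries_pow_ne_top ht _), evalDisc_pow hz (wienerNorm_linSeries_ne_top _),
    evalDisc_pow hz (wienerNorm_geomSeries_ne_top ht), evalDisc_linSeries hz]

/-- The semigroup law, with one of the two times equal to `1`: composing the kernels amounts to
composing their generating functions, which are Möbius transformations. -/
lemma tsum_coeff_branchSeries_one_mul (p : ℕ) {u : ℝ} (hu : 0 < u) (hu1 : u ≤ 1) (m l' : ℕ) :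
    ∑' l, coeff l (branchSeries p 1 m) * coeff l' (branchSeries p u l)
      = coeff l' (branchSeries p (1 + u) m) := by
  have hu' : 0 < (u : ℂ).re := by simpa using hu
  have hone : wienerNorm (branchSeries p 1 m) = 1 := by
    simpa using wienerNorm_branchSeries p one_pos le_rfl m
  have h1u : 0 < (1 + (u : ℂ)).re := by simp; linarith
  set R : ℂ⟦X⟧ := PowerSeries.mk fun l' =>
    ∑' l, coeff l (branchSeries p 1 m) * coeff l' (branchSeries p u l) with hR
  suffices h : R = branchSeries p (1 + u) m by
    rw [← h, hR, coeff_mk]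
  have hdouble : ∑' l, ∑' l', ‖coeff l (branchSeries p 1 m) * coeff l' (branchSeries p u l)‖ₑ
      = 1 := by
    simp_rw [enorm_mul, ENNReal.tsum_mul_left]
    have : ∀ l, ∑' l', ‖coeff l' (branchSeries p u l)‖ₑ = 1 := fun l =>
      wienerNorm_branchSeries p hu hu1 l
    simp_rw [this, mul_one]
    exact hone
  have hRtop : wienerNorm R ≠ ∞ := by
    refine ne_top_of_le_ne_top ENNReal.one_ne_top ?_
    rw [← hdouble, ENNReal.tsum_comm]
    refine ENNReal.tsum_le_tsum fun l' => ?_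
    rw [hR, coeff_mk]
    exact enorm_tsum_le_tsum_enorm
  refine coeff_eq_of_evalDisc_eq hRtop (wienerNorm_branchSeries_ne_top p h1u m) fun z hz => ?_
  set g := evalDisc z (geomSeries (u : ℂ)) with hg
  have hug : (1 + u * (1 - z)) * g = 1 := evalDisc_geomSeries hz.le hu'
  set w := (1 + ((u : ℂ) - 1) * (1 - z)) * g with hw
  have hw1 : ‖w‖ ≤ 1 := by
    rw [hw, norm_mul, ← evalDisc_linSeries hz.le]
    refine mul_le_one₀ (norm_evalDisc_le hz.le ?_) (norm_nonneg _) (norm_evalDisc_le hz.le ?_)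
    · have := wienerNorm_linSeries_pow hu.le hu1 1
      rw [pow_one] at this
      exact this.le
    · have := wienerNorm_geomSeries_pow hu 1
      rw [pow_one] at this
      exact this.le
  have hl : ∀ l, evalDisc z (branchSeries p u l) = w ^ l * g ^ (p + 1) := by
    intro l
    rw [evalDisc_branchSeries hz.le p hu', hw, mul_pow, ← hg, add_assoc, pow_add]
    ring
  set F : ℕ → ℕ → ℂ := fun i l =>
    coeff l (branchSeries p 1 m) * coeff i (branchSeries p u l) * z ^ i with hF
  have hsum : Summable (Function.uncurry F) := by
    refine Summable.of_norm ?_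
    refine Summable.of_nonneg_of_le (f := fun x : ℕ × ℕ =>
      ‖coeff x.2 (branchSeries p 1 m) * coeff x.1 (branchSeries p u x.2)‖)
      (fun x => norm_nonneg _) (fun x => ?_) ?_
    · rw [Function.uncurry_def, hF, norm_mul _ (z ^ _), norm_pow]
      exact mul_le_of_le_one_right (norm_nonneg _) (pow_le_one₀ (norm_nonneg _) hz.le)
    · rw [← tsum_enorm_ne_top_iff_summable_norm, ENNReal.tsum_prod', ENNReal.tsum_comm]
      dsimp only
      rw [hdouble]
      exact ENNReal.one_ne_top
  have e1 : evalDisc z R = evalDisc w (branchSeries p 1 m) * g ^ (p + 1) := by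
    calc evalDisc z R = ∑' i, ∑' l, F i l := by
          refine tsum_congr fun i => ?_
          rw [hR, coeff_mk, ← tsum_mul_right]
      _ = ∑' l, ∑' i, F i l := hsum.tsum_comm.symm
      _ = ∑' l, coeff l (branchSeries p 1 m) * w ^ l * g ^ (p + 1) := by
          refine tsum_congr fun l => ?_
          simp_rw [hF, mul_assoc]
          rw [tsum_mul_left, ← hl l]
          rfl
      _ = _ := by rw [tsum_mul_right]; rfl
  rw [e1, evalDisc_branchSeries hw1 p (by simp), evalDisc_branchSeries hz.le p h1u]
  have hg1 := evalDisc_geomSeries hw1 (t := 1) (by simp)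
  have hg2 := evalDisc_geomSeries hz.le h1u
  set g1 := evalDisc w (geomSeries 1)
  set g2 := evalDisc z (geomSeries (1 + u))
  have hgne : g ≠ 0 := right_ne_zero_of_mul_eq_one hug
  have h2w : 1 + 1 * (1 - w) = (1 + (1 + u) * (1 - z)) * g := by
    rw [hw]; linear_combination (-2 : ℂ) * hug
  have hg12 : g1 = g2 * (1 + u * (1 - z)) := by
    rw [h2w] at hg1
    linear_combination (g2 * (1 + u * (1 - z))) * hg1 - g1 * hg2
      - (g1 * g2 * (1 + (1 + u) * (1 - z))) * hug
  have e3 : (1 + u * (1 - z)) ^ (p + 1) * g ^ (p + 1) = 1 := by rw [← mul_pow, hug, one_pow]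
  rw [hg12, mul_pow, add_assoc m p 1, pow_add (1 + u * (1 - z)) m]
  simp only [sub_self, zero_mul, add_zero, one_pow, one_mul, add_sub_cancel_left]
  linear_combination (g2 ^ (m + (p + 1)) * (1 + u * (1 - z)) ^ m) * e3

lemma coeff_geomSeries_pow_succ {t : ℂ} (ht : 1 + t ≠ 0) (a l : ℕ) :
    coeff l (geomSeries t ^ (a + 1)) = (l + a).choose a * t ^ l / (1 + t) ^ (l + a + 1) := by
  have key : geomSeries t ^ (a + 1)
      = C (((1 + t)⁻¹) ^ (a + 1)) * rescale (t / (1 + t)) (PowerSeries.mk fun l => 1) ^ (a + 1) := by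
    have : geomSeries t = C ((1 + t)⁻¹) * rescale (t / (1 + t)) (PowerSeries.mk fun l => 1) := by
      ext l
      rw [coeff_C_mul, coeff_rescale, coeff_mk, geomSeries, coeff_mk, div_pow, pow_succ]
      field_simp
    rw [this, mul_pow, map_pow]
  rw [key, ← map_pow, show (PowerSeries.mk fun _ => (1 : ℂ)) = PowerSeries.mk 1 from rfl,
    mk_one_pow_eq_mk_choose_add, coeff_C_mul, coeff_rescale, coeff_mk,
    add_comm a l, div_pow, inv_pow, add_assoc l a 1, pow_add (1 + t) l]
  field_simp

lemma coeff_branchSeries_one (p m l : ℕ) :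
    coeff l (branchSeries p 1 m) = (l + (m + p)).choose (m + p) / 2 ^ (l + (m + p) + 1) := by
  have h : (1 : ℂ) + 1 = 2 := by norm_num
  have h0 : linSeries ((1 : ℂ) - 1) = 1 := by simp [linSeries]
  rw [branchSeries, h0, one_pow, one_mul, coeff_geomSeries_pow_succ (by norm_num), h]
  simp

/-! ### Dependence of the kernel on time -/

lemma differentiableOn_coeff_mul {U : Set ℂ} {f g : ℂ → ℂ⟦X⟧}
    (hf : ∀ l, DifferentiableOn ℂ (fun t => coeff l (f t)) U)
    (hg : ∀ l, DifferentiableOn ℂ (fun t => coeff l (g t)) U) (l : ℕ) :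
    DifferentiableOn ℂ (fun t => coeff l (f t * g t)) U := by
  simp_rw [coeff_mul]
  exact DifferentiableOn.fun_sum fun x _ => (hf _).mul (hg _)

lemma differentiableOn_coeff_pow {U : Set ℂ} {f : ℂ → ℂ⟦X⟧}
    (hf : ∀ l, DifferentiableOn ℂ (fun t => coeff l (f t)) U) (a l : ℕ) :
    DifferentiableOn ℂ (fun t => coeff l (f t ^ a)) U := by
  induction a generalizing l with
  | zero => simp only [pow_zero]; exact differentiableOn_const _
  | succ a ih => simp_rw [pow_succ]; exact differentiableOn_coeff_mul ih hf l

lemma differentiableOn_coeff_branchSeries (p m l : ℕ) :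
    DifferentiableOn ℂ (fun t => coeff l (branchSeries p t m)) {t | 0 < t.re} := by
  refine differentiableOn_coeff_mul (differentiableOn_coeff_pow (fun l => ?_) m)
    (differentiableOn_coeff_pow (fun l => ?_) (m + p + 1)) l
  · simp_rw [linSeries, map_add, coeff_C_mul]
    fun_prop
  · simp_rw [geomSeries, coeff_mk]
    exact DifferentiableOn.div (by fun_prop) (by fun_prop) fun t ht =>
      pow_ne_zero _ (one_add_ne_zero_of_re_pos ht)

/-- Coefficientwise domination in absolute value. -/
def CoeffLE (p q : ℂ⟦X⟧) : Prop := ∀ l, ‖coeff l p‖ ≤ ‖coeff l q‖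

lemma CoeffLE.mul {p q P Q : ℂ⟦X⟧} (hP : NonnegCoeff P) (hQ : NonnegCoeff Q) (hp : CoeffLE p P)
    (hq : CoeffLE q Q) : CoeffLE (p * q) (P * Q) := by
  intro l
  have e : ‖coeff l (P * Q)‖
      = ∑ x ∈ Finset.HasAntidiagonal.antidiagonal l, ‖coeff x.1 P‖ * ‖coeff x.2 Q‖ := by
    have h1 := (hP.mul hQ).coeff_eq_norm l
    rw [coeff_mul] at h1
    have h2 : ((∑ x ∈ Finset.HasAntidiagonal.antidiagonal l, ‖coeff x.1 P‖ * ‖coeff x.2 Q‖ : ℝ) : ℂ)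
        = (‖coeff l (P * Q)‖ : ℂ) := by
      rw [coeff_mul, ← h1]
      push_cast
      exact Finset.sum_congr rfl fun x _ => by rw [← hP.coeff_eq_norm, ← hQ.coeff_eq_norm]
    exact_mod_cast h2.symm
  rw [e, coeff_mul]
  refine (norm_sum_le _ _).trans (Finset.sum_le_sum fun x _ => ?_)
  rw [norm_mul]
  exact mul_le_mul (hp _) (hq _) (norm_nonneg _) (norm_nonneg _)

lemma CoeffLE.pow {p P : ℂ⟦X⟧} (hP : NonnegCoeff P) (hp : CoeffLE p P) (a : ℕ) :
    CoeffLE (p ^ a) (P ^ a) := by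
  induction a with
  | zero => intro l; simp
  | succ a ih => rw [pow_succ, pow_succ]; exact ih.mul (hP.pow a) hP hp

/-- For fixed starting point, the branching kernel is dominated by a summable sequence locally
uniformly in time. -/
lemma exists_summable_norm_coeff_branchSeries_le (p m : ℕ) {t₀ : ℝ} (h0 : 0 < t₀) (h1 : t₀ ≤ 1) :
    ∃ u : ℕ → ℝ, Summable u ∧ ∀ t ∈ Metric.ball (t₀ : ℂ) (t₀ / 200), ∀ l,
      ‖coeff l (branchSeries p t m)‖ ≤ u l := by
  set a : ℝ := t₀ + t₀ / 200 with ha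
  set b : ℝ := 1 + t₀ - t₀ / 200 with hb
  have hb0 : 0 < b := by linarith
  -- on the disc `‖t‖ ≤ a` and `b ≤ ‖1 + t‖`, so `G` dominates `geomSeries t` and `L` dominates
  -- `linSeries (t - 1)`; summability of `G` needs `a < b`
  set G : ℂ⟦X⟧ := PowerSeries.mk fun l => ((a ^ l / b ^ (l + 1) : ℝ) : ℂ) with hG
  set L : ℂ⟦X⟧ := PowerSeries.mk fun l => ((if l ≤ 1 then 2 else 0 : ℝ) : ℂ) with hL
  have hGn : NonnegCoeff G := fun l =>
    ⟨a ^ l / b ^ (l + 1), by positivity, by rw [hG, coeff_mk]⟩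
  have hLn : NonnegCoeff L := fun l =>
    ⟨if l ≤ 1 then 2 else 0, by positivity, by rw [hL, coeff_mk]⟩
  have hGt : wienerNorm G ≠ ∞ := by
    refine tsum_enorm_ne_top_iff_summable_norm.2 ?_
    have : Summable fun l : ℕ => b⁻¹ * (a / b) ^ l :=
      (summable_geometric_of_lt_one (by positivity)
        ((div_lt_one hb0).2 (by linarith))).mul_left _
    refine this.congr fun l => ?_
    rw [hG, coeff_mk, Complex.norm_real, Real.norm_of_nonneg (by positivity), div_pow, pow_succ]
    field_simp
  have hLt : wienerNorm L ≠ ∞ := by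
    unfold wienerNorm
    rw [tsum_eq_sum (s := Finset.range 2) fun l hl => by
      rw [Finset.mem_range, not_lt] at hl
      simp [hL, show ¬ l ≤ 1 by omega]]
    exact ENNReal.sum_ne_top.2 fun l _ => enorm_ne_top
  refine ⟨fun l => ‖coeff l (L ^ m * G ^ (m + p + 1))‖, summable_norm_coeff
    (wienerNorm_mul_ne_top (wienerNorm_pow_ne_top hLt _) (wienerNorm_pow_ne_top hGt _)),
    fun t ht => ?_⟩
  rw [Metric.mem_ball, dist_eq_norm] at ht
  have hta : ‖t‖ ≤ a := by
    have : ‖t‖ ≤ ‖t - t₀‖ + ‖(t₀ : ℂ)‖ := by simpa using norm_add_le (t - t₀) (t₀ : ℂ)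
    rw [Complex.norm_real, Real.norm_of_nonneg h0.le] at this
    linarith
  have htb : b ≤ ‖1 + t‖ := by
    have h3 : ‖((1 + t₀ : ℝ) : ℂ)‖ ≤ ‖1 + t‖ + ‖t - t₀‖ := by
      have := norm_sub_le (1 + t) (t - t₀)
      rwa [show 1 + t - (t - t₀) = ((1 + t₀ : ℝ) : ℂ) by push_cast; ring] at this
    rw [Complex.norm_real, Real.norm_of_nonneg (by positivity)] at h3
    linarith
  refine CoeffLE.mul (hLn.pow _) (hGn.pow _) (CoeffLE.pow hLn ?_ _) (CoeffLE.pow hGn ?_ _)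
  · have e : linSeries (t - 1) = C t + C (1 - t) * X := by
      rw [linSeries, map_sub, map_one, map_sub, map_one]; ring
    have ht2 : ‖1 - t‖ ≤ 2 := by
      have h3 := norm_add_le ((1 - t₀ : ℝ) : ℂ) (t₀ - t)
      rw [show ((1 - t₀ : ℝ) : ℂ) + (t₀ - t) = 1 - t by push_cast; ring, Complex.norm_real,
        Real.norm_of_nonneg (by linarith), norm_sub_rev (t₀ : ℂ)] at h3
      linarith
    intro l
    rw [e, hL, coeff_mk]
    match l with
    | 0 => simp; linarith
    | 1 => simpa using ht2
    | l + 2 => simp [coeff_succ_mul_X]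
  · intro l
    rw [geomSeries, coeff_mk, hG, coeff_mk, Complex.norm_real, Real.norm_of_nonneg (by positivity),
      norm_div, norm_pow, norm_pow]
    gcongr

/-! ### Sums over product index sets -/

lemma ENNReal_tsum_pi_prod {k : ℕ} (f : Fin k → ℕ → ℝ≥0∞) :
    ∑' l : Fin k → ℕ, ∏ j, f j (l j) = ∏ j, ∑' i, f j i := by
  induction k with
  | zero => simp
  | succ k ih =>
    rw [← (Fin.consEquiv fun _ : Fin (k + 1) => ℕ).tsum_eq, ENNReal.tsum_prod', Fin.prod_univ_succ]
    simp only [Fin.consEquiv_apply, Fin.prod_univ_succ, Fin.cons_zero, Fin.cons_succ,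
      ENNReal.tsum_mul_left, ENNReal.tsum_mul_right]
    rw [ih]

lemma enorm_finset_prod {ι : Type*} (s : Finset ι) (f : ι → ℂ) :
    ‖∏ j ∈ s, f j‖ₑ = ∏ j ∈ s, ‖f j‖ₑ := by
  classical
  induction s using Finset.induction_on with
  | empty => simp
  | insert a s ha ih => rw [Finset.prod_insert ha, Finset.prod_insert ha, enorm_mul, ih]

lemma summable_norm_pi_prod {k : ℕ} {f : Fin k → ℕ → ℂ} (hf : ∀ j, Summable fun i => ‖f j i‖) :
    Summable fun l : Fin k → ℕ => ‖∏ j, f j (l j)‖ := by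
  rw [← tsum_enorm_ne_top_iff_summable_norm]
  simp_rw [enorm_finset_prod]
  rw [ENNReal_tsum_pi_prod fun j i => ‖f j i‖ₑ]
  exact ENNReal.prod_ne_top fun j _ => tsum_enorm_ne_top_iff_summable_norm.2 (hf j)

lemma tsum_pi_prod {k : ℕ} {f : Fin k → ℕ → ℂ} (hf : ∀ j, Summable fun i => ‖f j i‖) :
    ∑' l : Fin k → ℕ, ∏ j, f j (l j) = ∏ j, ∑' i, f j i := by
  induction k with
  | zero => simp
  | succ k ih =>
    have hs := (summable_norm_pi_prod hf).of_norm
    rw [← (Fin.consEquiv fun _ : Fin (k + 1) => ℕ).summable_iff] at hs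
    rw [← (Fin.consEquiv fun _ : Fin (k + 1) => ℕ).tsum_eq]
    refine hs.tsum_prod.trans ?_
    rw [Fin.prod_univ_succ]
    simp only [Function.comp_apply]
    simp only [Fin.consEquiv_apply, Fin.prod_univ_succ, Fin.cons_zero, Fin.cons_succ,
      tsum_mul_left, tsum_mul_right]
    rw [ih fun j => hf j.succ]

/-! ### The heat flow on bounded functions -/

variable {k : ℕ}

lemma norm_apply_le (σ : LInfty k) (m : Fin k → ℕ) : ‖σ m‖ ≤ ‖σ‖ :=
  lp.norm_apply_le_norm ENNReal.top_ne_zero σ m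

/-- The product over the coordinates of the branching kernels at time `t`. -/
def heatKernel (p : Fin k → ℕ) (t : ℂ) (m l : Fin k → ℕ) : ℂ :=
  ∏ j, coeff (l j) (branchSeries (p j) t (m j))

/-- The heat flow at time `t`, applied to a bounded function on `ℕ₀^k`. -/
def heatFun (p : Fin k → ℕ) (t : ℂ) (σ : LInfty k) (m : Fin k → ℕ) : ℂ :=
  ∑' l, heatKernel p t m l * σ l

open Classical in
/-- The heat flow as an element of `ℓ^∞`, with value `0` where the result is unbounded. -/
def heatLp (p : Fin k → ℕ) (t : ℂ) (σ : LInfty k) : LInfty k :=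
  if h : Memℓp (heatFun p t σ) ∞ then ⟨heatFun p t σ, h⟩ else 0

lemma tsum_enorm_heatKernel (p : Fin k → ℕ) (t : ℂ) (m : Fin k → ℕ) :
    ∑' l, ‖heatKernel p t m l‖ₑ = ∏ j, wienerNorm (branchSeries (p j) t (m j)) := by
  simp_rw [heatKernel, enorm_finset_prod]
  exact ENNReal_tsum_pi_prod fun j i => ‖coeff i (branchSeries (p j) t (m j))‖ₑ

lemma summable_heatKernel (p : Fin k → ℕ) {t : ℂ} (ht : 0 < t.re) (m : Fin k → ℕ) :
    Summable fun l => ‖heatKernel p t m l‖ := by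
  rw [← tsum_enorm_ne_top_iff_summable_norm, tsum_enorm_heatKernel]
  exact ENNReal.prod_ne_top fun j _ => wienerNorm_branchSeries_ne_top _ ht _

lemma summable_heatKernel_mul (p : Fin k → ℕ) {t : ℂ} (ht : 0 < t.re) (m : Fin k → ℕ)
    (σ : LInfty k) : Summable fun l => ‖heatKernel p t m l * σ l‖ := by
  refine Summable.of_nonneg_of_le (fun l => norm_nonneg _) (fun l => ?_)
    ((summable_heatKernel p ht m).mul_right ‖σ‖)
  rw [norm_mul]
  gcongr
  exact norm_apply_le σ l

lemma norm_heatFun_le (p : Fin k → ℕ) {t : ℂ} {m : Fin k → ℕ} {M : ℝ} (hM0 : 0 ≤ M)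
    (hM : ∏ j, wienerNorm (branchSeries (p j) t (m j)) ≤ ENNReal.ofReal M) (σ : LInfty k) :
    ‖heatFun p t σ m‖ ≤ M * ‖σ‖ := by
  have h1 : ‖heatFun p t σ m‖ₑ ≤ ENNReal.ofReal (M * ‖σ‖) := by
    refine enorm_tsum_le_tsum_enorm.trans ?_
    rw [ENNReal.ofReal_mul hM0]
    refine le_trans ?_ (mul_le_mul_left hM _)
    rw [← tsum_enorm_heatKernel, ← ENNReal.tsum_mul_right]
    refine ENNReal.tsum_le_tsum fun l => ?_
    rw [enorm_mul, ← ofReal_norm (σ l)]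
    gcongr
    exact norm_apply_le σ l
  rwa [← ofReal_norm, ENNReal.ofReal_le_ofReal_iff (by positivity)] at h1

lemma coe_heatLp {p : Fin k → ℕ} {t : ℂ} {σ : LInfty k} {M : ℝ}
    (h : ∀ m, ‖heatFun p t σ m‖ ≤ M) : ⇑(heatLp p t σ) = heatFun p t σ := by
  have hmem : Memℓp (heatFun p t σ) ∞ := memℓp_infty ⟨M, by rintro _ ⟨m, rfl⟩; exact h m⟩
  rw [heatLp, dif_pos hmem]

/-- The bound on the heat flow for complex times close to `t₀ ∈ (0, 1]`. -/
lemma norm_heatFun_le_of_mem_ball (p : Fin k → ℕ) {t₀ : ℝ} (h0 : 0 < t₀) (h1 : t₀ ≤ 1) {t : ℂ}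
    (ht : t ∈ Metric.ball (t₀ : ℂ) (t₀ / 200)) (σ : LInfty k) (m : Fin k → ℕ) :
    ‖heatFun p t σ m‖ ≤ (∏ j, (2 : ℝ) ^ (p j + 2)) * ‖σ‖ := by
  refine norm_heatFun_le p (by positivity) ?_ σ
  rw [ENNReal.ofReal_prod_of_nonneg fun j _ => by positivity]
  refine Finset.prod_le_prod' fun j _ => ?_
  rw [ENNReal.ofReal_pow (by norm_num), ENNReal.ofReal_ofNat]
  rw [Metric.mem_ball, dist_eq_norm] at ht
  have := wienerNorm_branchSeries_add_le (p j) h0 h1 ht.le (m j)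
  rwa [add_sub_cancel] at this

lemma re_pos_of_mem_ball {t₀ : ℝ} (h0 : 0 < t₀) {t : ℂ}
    (ht : t ∈ Metric.ball (t₀ : ℂ) (t₀ / 200)) : 0 < t.re := by
  rw [Metric.mem_ball, dist_eq_norm] at ht
  have := (abs_lt.1 ((Complex.abs_re_le_norm _).trans_lt ht)).1
  simp only [Complex.sub_re, Complex.ofReal_re] at this
  linarith

lemma differentiableOn_heatFun (p : Fin k → ℕ) {t₀ : ℝ} (h0 : 0 < t₀) (h1 : t₀ ≤ 1)
    (σ : LInfty k) (m : Fin k → ℕ) :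
    DifferentiableOn ℂ (fun t => heatFun p t σ m) (Metric.ball (t₀ : ℂ) (t₀ / 200)) := by
  choose u hu hle using fun j => exists_summable_norm_coeff_branchSeries_le (p j) (m j) h0 h1
  have hu0 : ∀ j i, 0 ≤ u j i := fun j i => (norm_nonneg _).trans
    (hle j t₀ (Metric.mem_ball_self (by positivity)) i)
  have hs : Summable fun l : Fin k → ℕ => (∏ j, u j (l j)) * ‖σ‖ := by
    refine Summable.mul_right _ ?_
    have := summable_norm_pi_prod (f := fun j i => (u j i : ℂ)) fun j => by
      simpa using (hu j).norm
    refine this.congr fun l => ?_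
    rw [← Complex.ofReal_prod, Complex.norm_real,
      Real.norm_of_nonneg (Finset.prod_nonneg fun j _ => hu0 _ _)]
  refine Complex.differentiableOn_tsum_of_summable_norm hs (fun l => ?_) Metric.isOpen_ball
    fun l t ht => ?_
  · refine DifferentiableOn.mul_const ?_ _
    unfold heatKernel
    refine DifferentiableOn.fun_finsetProd fun j _ => ?_
    exact (differentiableOn_coeff_branchSeries _ _ _).mono fun t ht => re_pos_of_mem_ball h0 ht
  · rw [norm_mul, heatKernel, norm_prod]
    refine mul_le_mul ?_ (norm_apply_le σ l) (norm_nonneg _)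
      (Finset.prod_nonneg fun j _ => hu0 _ _)
    exact Finset.prod_le_prod (fun j _ => norm_nonneg _) fun j _ => hle j t ht _

/-- A bounded map into `ℓ^∞` all of whose coordinates are holomorphic is holomorphic: it is given
by Cauchy's integral formula, which holds coordinatewise. -/
lemma analyticAt_of_forall_apply {F : ℂ → LInfty k} {c : ℂ} {r M : ℝ} (hr : 0 < r)
    (hM : ∀ t ∈ Metric.ball c r, ‖F t‖ ≤ M)
    (hd : ∀ m, DifferentiableOn ℂ (fun t => F t m) (Metric.ball c r)) : AnalyticAt ℂ F c := by
  have hM0 : 0 ≤ M := (norm_nonneg _).trans (hM c (Metric.mem_ball_self hr))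
  set R : ℝ := r / 4 with hR
  have hR0 : 0 < R := by positivity
  -- Cauchy's estimate in each coordinate makes `F` Lipschitz, hence continuous in norm
  have hlip : ∀ x ∈ Metric.closedBall c R, ∀ y ∈ Metric.closedBall c R,
      ‖F x - F y‖ ≤ M / R * ‖x - y‖ := by
    intro x hx y hy
    refine lp.norm_le_of_forall_le (by positivity) fun m => ?_
    have hder : ∀ z ∈ Metric.closedBall c R, ‖deriv (fun t => F t m) z‖ ≤ M / R := by
      intro z hz
      have hsub : Metric.closedBall z R ⊆ Metric.ball c r := by
        intro w hw
        rw [Metric.mem_closedBall] at hw hz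
        rw [Metric.mem_ball]
        linarith [dist_triangle w z c]
      refine Complex.norm_deriv_le_of_forall_mem_sphere_norm_le hR0
        (((hd m).mono hsub).diffContOnCl_ball subset_rfl) fun w hw => ?_
      exact (norm_apply_le _ m).trans (hM w (hsub (Metric.sphere_subset_closedBall hw)))
    have hdiff : ∀ z ∈ Metric.closedBall c R, DifferentiableAt ℂ (fun t => F t m) z := by
      intro z hz
      refine (hd m).differentiableAt (Metric.isOpen_ball.mem_nhds ?_)
      rw [Metric.mem_closedBall] at hz
      rw [Metric.mem_ball]
      linarith
    exact (convex_closedBall c R).norm_image_sub_le_of_norm_deriv_le hdiff hder hy hx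
  have hcont : ContinuousOn F (Metric.closedBall c R) := by
    intro x hx
    rw [ContinuousWithinAt, tendsto_iff_norm_sub_tendsto_zero]
    refine squeeze_zero' (Eventually.of_forall fun _ => norm_nonneg _)
      (eventually_nhdsWithin_of_forall fun y hy => hlip y hy x hx) ?_
    have : Tendsto (fun y => M / R * ‖y - x‖) (𝓝 x) (𝓝 (M / R * ‖x - x‖)) := by
      refine Continuous.tendsto ?_ x
      fun_prop
    rw [sub_self, norm_zero, mul_zero] at this
    exact this.mono_left nhdsWithin_le_nhds
  have hint : CircleIntegrable F c R :=
    (hcont.mono Metric.sphere_subset_closedBall).circleIntegrable hR0.le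
  lift R to NNReal using hR0.le with R'
  have hps := hasFPowerSeriesOn_cauchy_integral hint (by exact_mod_cast hR0)
  refine (hps.analyticAt).congr ?_
  filter_upwards [Metric.ball_mem_nhds c hR0] with w hw
  ext m
  have hw' : w ∉ Metric.sphere c (R' : ℝ) := fun h => by
    rw [Metric.mem_sphere] at h
    rw [Metric.mem_ball] at hw
    linarith
  have hint2 : CircleIntegrable (fun z => (z - w)⁻¹ • F z) c R' := by
    refine ContinuousOn.circleIntegrable hR0.le ?_
    have hinv : ContinuousOn (fun z : ℂ => (z - w)⁻¹) (Metric.sphere c R') :=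
      ContinuousOn.inv₀ (by fun_prop) fun z hz => sub_ne_zero.2 fun h => hw' (h ▸ hz)
    exact hinv.smul (hcont.mono Metric.sphere_subset_closedBall)
  have hsub : Metric.closedBall c (R' : ℝ) ⊆ Metric.ball c r := by
    intro z hz
    rw [Metric.mem_closedBall] at hz
    rw [Metric.mem_ball]
    linarith
  have hcauchy := Complex.circleIntegral_sub_inv_smul_of_differentiable_on_off_countable
    (f := fun z => F z m) Set.countable_empty hw ((hd m).continuousOn.mono hsub) fun z hz =>
      (hd m).differentiableAt (Metric.isOpen_ball.mem_nhds
        (hsub (Metric.ball_subset_closedBall hz.1)))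
  let ev : LInfty k →L[ℂ] ℂ := LinearMap.mkContinuous
    { toFun := fun σ => σ m, map_add' := fun _ _ => rfl, map_smul' := fun _ _ => rfl } 1
    fun σ => by rw [one_mul]; exact norm_apply_le σ m
  have hev : ev (∮ z in C(c, R'), (z - w)⁻¹ • F z) = ∮ z in C(c, R'), (z - w)⁻¹ • F z m := by
    rw [circleIntegral, circleIntegral, ← ContinuousLinearMap.intervalIntegral_comp_comm]
    · rfl
    · exact hint2.out
  change ev ((2 * Real.pi * Complex.I : ℂ)⁻¹ • ∮ z in C(c, R'), (z - w)⁻¹ • F z) = F w m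
  rw [map_smul, hev, hcauchy, smul_smul, inv_mul_cancel₀ (by simp [Real.pi_ne_zero]), one_smul]

lemma analyticAt_heatLp (p : Fin k → ℕ) {t₀ : ℝ} (h0 : 0 < t₀) (h1 : t₀ ≤ 1) (σ : LInfty k) :
    AnalyticAt ℂ (fun t => heatLp p t σ) t₀ := by
  have hcoe : ∀ t ∈ Metric.ball (t₀ : ℂ) (t₀ / 200), ⇑(heatLp p t σ) = heatFun p t σ :=
    fun t ht => coe_heatLp (norm_heatFun_le_of_mem_ball p h0 h1 ht σ)
  refine analyticAt_of_forall_apply (r := t₀ / 200) (M := (∏ j, (2 : ℝ) ^ (p j + 2)) * ‖σ‖)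
    (by positivity) (fun t ht => ?_) fun m => ?_
  · refine lp.norm_le_of_forall_le (by positivity) fun m => ?_
    rw [hcoe t ht]
    exact norm_heatFun_le_of_mem_ball p h0 h1 ht σ m
  · exact (differentiableOn_heatFun p h0 h1 σ m).congr fun t ht => by rw [hcoe t ht]

lemma tsum_enorm_heatKernel_real (p : Fin k → ℕ) {t : ℝ} (ht : 0 < t) (ht1 : t ≤ 1)
    (m : Fin k → ℕ) : ∑' l, ‖heatKernel p t m l‖ₑ = 1 := by
  rw [tsum_enorm_heatKernel]
  exact Finset.prod_eq_one fun j _ => wienerNorm_branchSeries _ ht ht1 _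

lemma norm_heatFun_le_of_real (p : Fin k → ℕ) {t : ℝ} (ht : 0 < t) (ht1 : t ≤ 1) (σ : LInfty k)
    (m : Fin k → ℕ) : ‖heatFun p t σ m‖ ≤ ‖σ‖ := by
  have := norm_heatFun_le (t := t) (m := m) p zero_le_one ?_ σ
  · rwa [one_mul] at this
  · rw [← tsum_enorm_heatKernel, tsum_enorm_heatKernel_real p ht ht1, ENNReal.ofReal_one]

lemma tsum_heatKernel (p : Fin k → ℕ) {t : ℂ} (ht : 0 < t.re) (m : Fin k → ℕ) :
    ∑' l, heatKernel p t m l = 1 := by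
  unfold heatKernel
  rw [tsum_pi_prod (f := fun j i => coeff i (branchSeries (p j) t (m j))) fun j =>
    summable_norm_coeff (wienerNorm_branchSeries_ne_top _ ht _)]
  refine Finset.prod_eq_one fun j _ => ?_
  have := evalDisc_one_branchSeries (p j) ht (m j)
  simpa [evalDisc] using this

lemma tsum_heatKernel_mul_sqrt_le (p : Fin k → ℕ) {t : ℝ} (ht : 0 < t) (ht1 : t ≤ 1)
    (m : Fin k → ℕ) (j : Fin k) :
    ∑' l, ‖heatKernel p t m l‖ₑ * ENNReal.ofReal ((√(l j : ℝ) - √(m j : ℝ)) ^ 2)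
      ≤ ENNReal.ofReal (2 * (p j + 3) ^ 2 * t) := by
  classical
  set f : Fin k → ℕ → ℝ≥0∞ := fun i l => ‖coeff l (branchSeries (p i) t (m i))‖ₑ *
    (if i = j then ENNReal.ofReal ((√(l : ℝ) - √(m j : ℝ)) ^ 2) else 1) with hf
  have e : ∀ l : Fin k → ℕ, ‖heatKernel p t m l‖ₑ * ENNReal.ofReal ((√(l j : ℝ) - √(m j : ℝ)) ^ 2)
      = ∏ i, f i (l i) := by
    intro l
    rw [hf, Finset.prod_mul_distrib, heatKernel, enorm_finset_prod]
    congr 1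
    rw [Finset.prod_ite_eq' Finset.univ j]
    simp
  simp_rw [e]
  rw [ENNReal_tsum_pi_prod f, ← Finset.mul_prod_erase Finset.univ _ (Finset.mem_univ j),
    Finset.prod_eq_one, mul_one]
  · simp only [hf, if_true]
    exact tsum_branchSeries_mul_sqrt_sub_sq_le (p j) ht ht1 (m j)
  · intro i hi
    simp only [hf, if_neg (Finset.ne_of_mem_erase hi), mul_one]
    exact wienerNorm_branchSeries (p i) ht ht1 (m i)

lemma sqrtDist_sq_le (m l : Fin k → ℕ) :
    sqrtDist m l ^ 2 ≤ k * ∑ j, (√(l j : ℝ) - √(m j : ℝ)) ^ 2 := by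
  unfold sqrtDist
  have := sq_sum_le_card_mul_sum_sq (s := Finset.univ)
    (f := fun j : Fin k => |√(m j : ℝ) - √(l j : ℝ)|)
  rw [Finset.card_univ, Fintype.card_fin] at this
  refine this.trans (le_of_eq ?_)
  congr 1
  refine Finset.sum_congr rfl fun j _ => ?_
  rw [sq_abs, ← neg_sub, neg_sq]

/-- The heat flow is strongly continuous at time `0` on `C_{b,u}`. -/
lemma exists_norm_heatLp_sub_lt (p : Fin k → ℕ) {σ : LInfty k} (hσ : σ ∈ Cbu k) {ε : ℝ}
    (hε : 0 < ε) : ∃ t : ℝ, 0 < t ∧ t ≤ 1 ∧ ‖heatLp p t σ - σ‖ < ε := by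
  obtain ⟨δ, hδ, H⟩ := hσ (ε / 4) (by positivity)
  set A : ℝ := 2 * ‖σ‖ / δ ^ 2 * k with hA
  have hA0 : 0 ≤ A := by positivity
  set D : ℝ := A * ∑ j, 2 * ((p j : ℝ) + 3) ^ 2 with hD
  have hD0 : 0 ≤ D := mul_nonneg hA0 (Finset.sum_nonneg fun j _ => by positivity)
  set t : ℝ := min 1 (ε / (4 * (D + 1))) with htdef
  have ht : 0 < t := lt_min one_pos (by positivity)
  have ht1 : t ≤ 1 := min_le_left _ _
  have hDt : D * t ≤ ε / 4 := by
    calc D * t ≤ (D + 1) * (ε / (4 * (D + 1))) := by gcongr; linarith; exact min_le_right _ _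
      _ = ε / 4 := by field_simp
  refine ⟨t, ht, ht1, lt_of_le_of_lt (b := ε / 2) ?_ (by linarith)⟩
  refine lp.norm_le_of_forall_le (by positivity) fun m => ?_
  have htre : 0 < (t : ℂ).re := by simpa using ht
  rw [lp.coeFn_sub, Pi.sub_apply, coe_heatLp (norm_heatFun_le_of_real p ht ht1 σ)]
  have hpt : ∀ l, ‖σ l - σ m‖
      ≤ ε / 4 + ∑ j, A * (√(l j : ℝ) - √(m j : ℝ)) ^ 2 := by
    intro l
    have hS : 0 ≤ ∑ j, A * (√(l j : ℝ) - √(m j : ℝ)) ^ 2 :=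
      Finset.sum_nonneg fun j _ => by positivity
    by_cases hlt : sqrtDist m l < δ
    · have := H m l hlt
      rw [norm_sub_rev]
      linarith
    · have h1 : ‖σ l - σ m‖ ≤ 2 * ‖σ‖ := by
        refine (norm_sub_le _ _).trans ?_
        linarith [norm_apply_le σ l, norm_apply_le σ m]
      have h2 : δ ^ 2 ≤ sqrtDist m l ^ 2 := by
        rw [not_lt] at hlt
        gcongr
      have h3 : 2 * ‖σ‖ ≤ 2 * ‖σ‖ / δ ^ 2 * sqrtDist m l ^ 2 := by
        rw [div_mul_eq_mul_div, le_div_iff₀ (by positivity)]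
        gcongr
      have h4 : 2 * ‖σ‖ / δ ^ 2 * sqrtDist m l ^ 2
          ≤ ∑ j, A * (√(l j : ℝ) - √(m j : ℝ)) ^ 2 := by
        rw [← Finset.mul_sum, hA, mul_assoc]
        gcongr
        exact sqrtDist_sq_le m l
      linarith
  have e : heatFun p t σ m - σ m = ∑' l, heatKernel p t m l * (σ l - σ m) := by
    have hs2 : Summable fun l => heatKernel p t m l * σ m :=
      (summable_heatKernel p htre m).of_norm.mul_right _
    simp_rw [mul_sub]
    rw [(summable_heatKernel_mul p htre m σ).of_norm.tsum_sub hs2, tsum_mul_right,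
      tsum_heatKernel p htre, one_mul]
    rfl
  have key : ‖heatFun p t σ m - σ m‖ₑ ≤ ENNReal.ofReal (ε / 4 + D * t) := by
    rw [e]
    refine enorm_tsum_le_tsum_enorm.trans ?_
    calc ∑' l, ‖heatKernel p t m l * (σ l - σ m)‖ₑ
        ≤ ∑' l, (‖heatKernel p t m l‖ₑ * ENNReal.ofReal (ε / 4)
          + ∑ j, ENNReal.ofReal A * (‖heatKernel p t m l‖ₑ *
              ENNReal.ofReal ((√(l j : ℝ) - √(m j : ℝ)) ^ 2))) := by
          refine ENNReal.tsum_le_tsum fun l => ?_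
          rw [enorm_mul, ← ofReal_norm (σ l - σ m)]
          refine (mul_le_mul_right (ENNReal.ofReal_le_ofReal (hpt l)) _).trans (le_of_eq ?_)
          rw [ENNReal.ofReal_add (by positivity) (Finset.sum_nonneg fun j _ => by positivity),
            mul_add, ENNReal.ofReal_sum_of_nonneg fun j _ => by positivity, Finset.mul_sum]
          congr 1
          refine Finset.sum_congr rfl fun j _ => ?_
          rw [ENNReal.ofReal_mul hA0]
          ring
      _ = ENNReal.ofReal (ε / 4) + ∑ j, ENNReal.ofReal A * ∑' l, ‖heatKernel p t m l‖ₑ *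
              ENNReal.ofReal ((√(l j : ℝ) - √(m j : ℝ)) ^ 2) := by
          rw [ENNReal.tsum_add, ENNReal.tsum_mul_right, tsum_enorm_heatKernel_real p ht ht1, one_mul,
            Summable.tsum_finsetSum fun _ _ => ENNReal.summable]
          simp_rw [ENNReal.tsum_mul_left]
      _ ≤ ENNReal.ofReal (ε / 4)
          + ∑ j, ENNReal.ofReal A * ENNReal.ofReal (2 * (p j + 3) ^ 2 * t) := by
          gcongr with j
          exact tsum_heatKernel_mul_sqrt_le p ht ht1 m j
      _ = ENNReal.ofReal (ε / 4 + D * t) := by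
          rw [ENNReal.ofReal_add (by positivity) (by positivity), hD, mul_assoc, Finset.sum_mul,
            Finset.mul_sum, ENNReal.ofReal_sum_of_nonneg fun j _ => by positivity]
          congr 1
          exact Finset.sum_congr rfl fun j _ => (ENNReal.ofReal_mul hA0).symm
  rw [← ofReal_norm, ENNReal.ofReal_le_ofReal_iff (by positivity)] at key
  linarith

lemma heatFun_one_heatLp (p : Fin k → ℕ) {u : ℝ} (hu : 0 < u) (hu1 : u ≤ 1) (σ : LInfty k) :
    heatFun p 1 (heatLp p u σ) = heatFun p (1 + u) σ := by
  have hure : 0 < (u : ℂ).re := by simpa using hu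
  funext m
  rw [heatFun, coe_heatLp (norm_heatFun_le_of_real p hu hu1 σ)]
  have h1 : ∑' l, ‖heatKernel p 1 m l‖ₑ = 1 := by
    simpa using tsum_enorm_heatKernel_real p one_pos le_rfl m
  have hsum : Summable (Function.uncurry fun l l' : Fin k → ℕ =>
      heatKernel p 1 m l * (heatKernel p u l l' * σ l')) := by
    refine Summable.of_norm ?_
    rw [← tsum_enorm_ne_top_iff_summable_norm, ENNReal.tsum_prod']
    refine ne_top_of_le_ne_top (b := ‖σ‖ₑ) enorm_ne_top ?_
    calc _ ≤ ∑' l, ∑' l', ‖heatKernel p 1 m l‖ₑ * (‖heatKernel p u l l'‖ₑ * ‖σ‖ₑ) := by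
          refine ENNReal.tsum_le_tsum fun l => ENNReal.tsum_le_tsum fun l' => ?_
          rw [Function.uncurry_apply_pair, enorm_mul, enorm_mul, ← ofReal_norm (σ l'),
            ← ofReal_norm σ]
          gcongr
          exact norm_apply_le σ l'
      _ = ‖σ‖ₑ := by
          simp_rw [ENNReal.tsum_mul_left, ENNReal.tsum_mul_right,
            tsum_enorm_heatKernel_real p hu hu1, one_mul]
          rw [ENNReal.tsum_mul_right, h1, one_mul]
  calc ∑' l, heatKernel p 1 m l * heatFun p u σ l
      = ∑' l, ∑' l', heatKernel p 1 m l * (heatKernel p u l l' * σ l') := by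
        refine tsum_congr fun l => ?_
        rw [heatFun, tsum_mul_left]
    _ = ∑' l', ∑' l, heatKernel p 1 m l * (heatKernel p u l l' * σ l') := hsum.tsum_comm.symm
    _ = ∑' l', heatKernel p (1 + u) m l' * σ l' := by
        refine tsum_congr fun l' => ?_
        simp_rw [← mul_assoc]
        rw [tsum_mul_right]
        congr 1
        simp_rw [heatKernel, ← Finset.prod_mul_distrib]
        rw [tsum_pi_prod (f := fun j i => coeff i (branchSeries (p j) 1 (m j))
          * coeff (l' j) (branchSeries (p j) u i)) fun j => ?_]
        · exact Finset.prod_congr rfl fun j _ => tsum_coeff_branchSeries_one_mul _ hu hu1 _ _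
        · refine Summable.of_nonneg_of_le (fun l => norm_nonneg _) (fun i => ?_)
            (summable_norm_coeff (wienerNorm_branchSeries_ne_top (p j) (t := 1) (by simp) (m j)))
          rw [norm_mul]
          refine mul_le_of_le_one_right (norm_nonneg _) ?_
          have h3 : ‖coeff (l' j) (branchSeries (p j) u i)‖ₑ ≤ 1 :=
            (ENNReal.le_tsum (l' j)).trans (wienerNorm_branchSeries (p j) hu hu1 i).le
          rwa [← ofReal_norm, ENNReal.ofReal_le_one] at h3

/-- A closed subspace of `ℓ^∞` that contains the range of the heat flow at time `1` contains
`C_{b,u}`: modulo the subspace the heat flow is a real analytic function of the time which vanishes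
for times slightly larger than `1`, hence for all times in `(0, 1]`. -/
theorem mem_of_heatFun_one_mem (p : Fin k → ℕ) {V : Submodule ℂ (LInfty k)}
    (hV : IsClosed (V : Set (LInfty k))) (h : ∀ τ : LInfty k, ∃ v ∈ V, ⇑v = heatFun p 1 τ)
    {σ : LInfty k} (hσ : σ ∈ Cbu k) : σ ∈ V := by
  have : IsClosed (V : Set (LInfty k)) := hV
  have hmem : ∀ t : ℝ, 0 < t → t ≤ 1 → heatLp p t σ ∈ V := by
    set f : ℝ → LInfty k ⧸ V := fun t => V.mkQL (heatLp p t σ) with hf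
    have han : AnalyticOnNhd ℝ f (Set.Ioc 0 1) := by
      intro t ht
      have h1 : AnalyticAt ℂ (fun t => V.mkQL (heatLp p t σ)) (t : ℂ) :=
        (V.mkQL.analyticAt _).comp (analyticAt_heatLp p ht.1 ht.2 σ)
      exact h1.restrictScalars.comp (Complex.ofRealCLM.analyticAt t)
    have hz : Set.EqOn f 0 (Set.Ioc 0 1) := by
      refine han.eqOn_zero_of_preconnected_of_frequently_eq_zero isPreconnected_Ioc
        (Set.right_mem_Ioc.2 one_pos) ?_
      have hev : ∀ᶠ t : ℝ in 𝓝[>] 1, f t = 0 := by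
        have : Set.Ioo (1 : ℝ) (1 + 1 / 200) ∈ 𝓝[>] (1 : ℝ) := Ioo_mem_nhdsGT (by norm_num)
        filter_upwards [this] with t ht
        have hu : 0 < t - 1 := by linarith [ht.1]
        have hu1 : t - 1 ≤ 1 := by linarith [ht.2]
        obtain ⟨v, hv, hve⟩ := h (heatLp p ((t - 1 : ℝ) : ℂ) σ)
        rw [heatFun_one_heatLp p hu hu1] at hve
        have htc : (1 : ℂ) + ((t - 1 : ℝ) : ℂ) = t := by push_cast; ring
        rw [htc] at hve
        have hball : (t : ℂ) ∈ Metric.ball ((1 : ℝ) : ℂ) (1 / 200) := by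
          rw [Metric.mem_ball, dist_eq_norm, ← Complex.ofReal_sub, Complex.norm_real,
            Real.norm_of_nonneg hu.le]
          linarith [ht.2]
        have hvt : heatLp p t σ = v := by
          refine lp.ext ?_
          rw [hve]
          exact coe_heatLp (norm_heatFun_le_of_mem_ball p one_pos le_rfl hball σ)
        rw [hf]
        simpa [hvt] using hv
      exact hev.frequently.filter_mono (nhdsWithin_mono _ fun t ht => ne_of_gt ht)
    intro t ht ht1
    have := hz ⟨ht, ht1⟩
    simpa [hf] using this
  refine hV.closure_subset (Metric.mem_closure_iff.2 fun ε hε => ?_)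
  obtain ⟨t, ht, ht1, hlt⟩ := exists_norm_heatLp_sub_lt p hσ hε
  exact ⟨_, hmem t ht ht1, by rw [dist_comm, dist_eq_norm]; exact hlt⟩

end BranchingKernel

/-! ### Product measures with product densities -/

lemma lintegral_pi_prod {k : ℕ} {E : Fin k → Type*} [∀ j, MeasurableSpace (E j)]
    (μ : (j : Fin k) → Measure (E j)) [∀ j, SigmaFinite (μ j)] {f : (j : Fin k) → E j → ℝ≥0∞}
    (hf : ∀ j, Measurable (f j)) :
    ∫⁻ x, ∏ j, f j (x j) ∂Measure.pi μ = ∏ j, ∫⁻ x, f j x ∂μ j := by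
  induction k with
  | zero => simp
  | succ k ih =>
    calc _ = ∫⁻ x : E 0 × ((j : Fin k) → E j.succ), f 0 x.1 * ∏ j : Fin k, f j.succ (x.2 j)
            ∂((μ 0).prod (Measure.pi fun j => μ j.succ)) := by
          have hp : MeasurePreserving (MeasurableEquiv.piFinSuccAbove E 0).symm
              ((μ 0).prod (Measure.pi fun j => μ j.succ)) (Measure.pi μ) :=
            (measurePreserving_piFinSuccAbove μ 0).symm
          rw [← hp.lintegral_comp_emb (MeasurableEquiv.measurableEmbedding _)]
          refine lintegral_congr fun x => ?_
          rw [Fin.prod_univ_succ]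
          rfl
      _ = (∫⁻ x, f 0 x ∂μ 0) * ∏ j : Fin k, ∫⁻ x, f j.succ x ∂μ j.succ := by
          rw [← ih (fun j => μ j.succ) fun j => hf _]
          exact lintegral_prod_mul (hf 0).aemeasurable (Measurable.aemeasurable
            (f := fun y : (j : Fin k) → E j.succ => ∏ j : Fin k, f j.succ (y j))
            (Finset.measurable_prod _ fun j _ => (hf _).comp (measurable_pi_apply j)))
      _ = _ := by rw [Fin.prod_univ_succ]

lemma pi_withDensity {k : ℕ} {E : Fin k → Type*} [∀ j, MeasurableSpace (E j)]
    (μ : (j : Fin k) → Measure (E j)) [∀ j, SigmaFinite (μ j)] {f : (j : Fin k) → E j → ℝ≥0∞}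
    (hf : ∀ j, Measurable (f j)) [∀ j, SigmaFinite ((μ j).withDensity (f j))] :
    Measure.pi (fun j => (μ j).withDensity (f j))
      = (Measure.pi μ).withDensity fun x => ∏ j, f j (x j) := by
  refine Measure.pi_eq (μ := fun j => (μ j).withDensity (f j)) fun s hs => ?_
  rw [withDensity_apply _ (MeasurableSet.univ_pi hs), Measure.restrict_pi_pi,
    lintegral_pi_prod _ hf]
  exact Finset.prod_congr rfl fun j _ => (withDensity_apply _ (hs j)).symm

/-! ### Gamma distributions -/

/-- The density of the Gamma distribution with integer parameter `a + 1`. -/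
def gammaDensity (a : ℕ) (x : ℝ) : ℝ := x ^ a * Real.exp (-x) / (a.factorial : ℝ)

/-- The Gamma distribution with integer parameter `a + 1`. -/
def gammaNat (a : ℕ) : Measure ℝ :=
  (volume.restrict (Set.Ioi 0)).withDensity fun x => ENNReal.ofReal (gammaDensity a x)

lemma gammaDensity_nonneg (a : ℕ) {x : ℝ} (hx : 0 ≤ x) : 0 ≤ gammaDensity a x := by
  unfold gammaDensity; positivity

lemma measurable_gammaDensity (a : ℕ) : Measurable (gammaDensity a) := by
  unfold gammaDensity; fun_prop

lemma integral_pow_mul_exp_neg_mul (a : ℕ) {b : ℝ} (hb : 0 < b) :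
    ∫ x in Set.Ioi (0 : ℝ), x ^ a * Real.exp (-(b * x)) = a.factorial / b ^ (a + 1) := by
  have h := Real.integral_rpow_mul_exp_neg_mul_Ioi (a := a + 1) (by positivity) hb
  rw [add_sub_cancel_right, Real.Gamma_nat_eq_factorial, ← Nat.cast_succ, Real.rpow_natCast] at h
  simp_rw [Real.rpow_natCast] at h
  rw [h, one_div, inv_pow, Nat.succ_eq_add_one]
  ring

lemma integrableOn_pow_mul_exp_neg_mul (a : ℕ) {b : ℝ} (hb : 0 < b) :
    IntegrableOn (fun x : ℝ => x ^ a * Real.exp (-(b * x))) (Set.Ioi 0) := by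
  by_contra h
  have h1 := integral_pow_mul_exp_neg_mul a hb
  rw [integral_undef h] at h1
  have : (0 : ℝ) < a.factorial / b ^ (a + 1) := by positivity
  linarith

lemma integrableOn_gammaDensity (a : ℕ) : IntegrableOn (gammaDensity a) (Set.Ioi 0) := by
  have := (integrableOn_pow_mul_exp_neg_mul a one_pos).div_const (a.factorial : ℝ)
  simp only [one_mul] at this
  exact this

lemma integral_gammaDensity (a : ℕ) : ∫ x in Set.Ioi 0, gammaDensity a x = 1 := by
  have := integral_pow_mul_exp_neg_mul a one_pos
  simp only [one_mul, one_pow, div_one] at this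
  simp only [gammaDensity]
  rw [integral_div, this, div_self (by positivity)]

instance (a : ℕ) : IsProbabilityMeasure (gammaNat a) := by
  constructor
  rw [gammaNat, withDensity_apply _ MeasurableSet.univ, Measure.restrict_univ,
    ← ofReal_integral_eq_lintegral_ofReal (integrableOn_gammaDensity a), integral_gammaDensity,
    ENNReal.ofReal_one]
  filter_upwards [ae_restrict_mem measurableSet_Ioi] with x hx
  exact gammaDensity_nonneg a (le_of_lt hx)

lemma integral_gammaNat {E : Type*} [NormedAddCommGroup E] [NormedSpace ℝ E] (a : ℕ) (f : ℝ → E) :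
    ∫ x, f x ∂gammaNat a = ∫ x in Set.Ioi 0, gammaDensity a x • f x := by
  rw [gammaNat, integral_withDensity_eq_integral_toReal_smul
    (measurable_gammaDensity a).ennreal_ofReal (by simp)]
  refine setIntegral_congr_fun measurableSet_Ioi fun x hx => ?_
  rw [ENNReal.toReal_ofReal (gammaDensity_nonneg a (le_of_lt hx))]

lemma integrable_gammaNat_iff {E : Type*} [NormedAddCommGroup E] [NormedSpace ℝ E] (a : ℕ)
    (f : ℝ → E) :
    Integrable f (gammaNat a) ↔ IntegrableOn (fun x => gammaDensity a x • f x) (Set.Ioi 0) := by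
  rw [gammaNat, integrable_withDensity_iff_integrable_smul'
    (measurable_gammaDensity a).ennreal_ofReal (by simp)]
  refine integrable_congr ?_
  filter_upwards [ae_restrict_mem measurableSet_Ioi] with x hx
  rw [ENNReal.toReal_ofReal (gammaDensity_nonneg a (le_of_lt hx))]

lemma gammaNat_succ (a : ℕ) :
    gammaNat (a + 1) = (gammaNat a).withDensity fun x => ENNReal.ofReal (x / (a + 1)) := by
  rw [gammaNat, gammaNat, ← withDensity_mul _ (measurable_gammaDensity a).ennreal_ofReal
    (by fun_prop)]
  refine withDensity_congr_ae ?_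
  filter_upwards [ae_restrict_mem measurableSet_Ioi] with x hx
  rw [Pi.mul_apply, ← ENNReal.ofReal_mul (gammaDensity_nonneg a (le_of_lt hx))]
  congr 1
  rw [gammaDensity, gammaDensity, Nat.factorial_succ]
  push_cast
  field_simp
  ring

lemma ae_gammaNat_pos (a : ℕ) : ∀ᵐ x ∂gammaNat a, 0 < x :=
  (withDensity_absolutelyContinuous _ _).ae_le (ae_restrict_mem measurableSet_Ioi)

lemma integrable_pow_gammaNat (a i : ℕ) : Integrable (fun x : ℝ => x ^ i) (gammaNat a) := by
  rw [integrable_gammaNat_iff]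
  have : IntegrableOn (fun x : ℝ => x ^ (a + i) * Real.exp (-(1 * x)) / (a.factorial : ℝ))
      (Set.Ioi 0) := (integrableOn_pow_mul_exp_neg_mul (a + i) one_pos).div_const _
  refine this.congr_fun (fun x _ => ?_) measurableSet_Ioi
  simp only [gammaDensity, smul_eq_mul]
  ring_nf

lemma integral_pow_gammaNat (a i : ℕ) :
    ∫ x, x ^ i ∂gammaNat a = (a + i).factorial / a.factorial := by
  rw [integral_gammaNat]
  have := integral_pow_mul_exp_neg_mul (a + i) one_pos
  rw [one_pow, div_one] at this
  rw [← this, ← integral_div]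
  refine setIntegral_congr_fun measurableSet_Ioi fun x _ => ?_
  simp only [gammaDensity, smul_eq_mul]
  ring_nf

/-- The `L¹` distance between consecutive Gamma distributions is at most the inverse square root of
the parameter. -/
lemma integral_abs_div_sub_one_gammaNat_le (a : ℕ) :
    ∫ x, |x / (a + 1) - 1| ∂gammaNat a ≤ 1 / √(a + 1 : ℝ) := by
  set c : ℝ := √(a + 1 : ℝ) with hc
  have hc0 : 0 < c := Real.sqrt_pos.2 (by positivity)
  have hc2 : c ^ 2 = a + 1 := Real.sq_sqrt (by positivity)
  have hi := integrable_pow_gammaNat a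
  have hmaj : Integrable (fun x : ℝ => (x ^ 2 / (a + 1) ^ 2 - x ^ 1 * (2 / (a + 1)) + 1) * (c / 2)
      + 1 / (2 * c)) (gammaNat a) :=
    (((((hi 2).div_const _).sub ((hi 1).mul_const _)).add (integrable_const 1)).mul_const _).add
      (integrable_const _)
  -- Cauchy–Schwarz in the form `|y| ≤ (c y² + 1 / c) / 2`
  have hle : ∫ x, |x / (a + 1) - 1| ∂gammaNat a ≤ ∫ x : ℝ, ((x ^ 2 / (a + 1) ^ 2
      - x ^ 1 * (2 / (a + 1)) + 1) * (c / 2) + 1 / (2 * c)) ∂gammaNat a := by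
    refine integral_mono_of_nonneg (Eventually.of_forall fun x => abs_nonneg _) hmaj
      (Eventually.of_forall fun x => ?_)
    have e : x ^ 2 / ((a : ℝ) + 1) ^ 2 - x ^ 1 * (2 / (a + 1)) + 1 = (x / (a + 1) - 1) ^ 2 := by
      field_simp; ring
    dsimp only
    rw [e]
    set y := x / ((a : ℝ) + 1) - 1
    have h3 : 0 ≤ c / 2 * (|y| - 1 / c) ^ 2 := by positivity
    have h4 : c / 2 * (|y| - 1 / c) ^ 2 = y ^ 2 * (c / 2) - |y| + 1 / (2 * c) := by
      rw [sub_sq, sq_abs]; field_simp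
    linarith
  refine hle.trans (le_of_eq ?_)
  have i1 : Integrable (fun x : ℝ => x ^ 2 / ((a : ℝ) + 1) ^ 2) (gammaNat a) := (hi 2).div_const _
  have i2 : Integrable (fun x : ℝ => x ^ 1 * (2 / ((a : ℝ) + 1))) (gammaNat a) :=
    (hi 1).mul_const _
  have i3 : Integrable (fun x : ℝ => x ^ 2 / ((a : ℝ) + 1) ^ 2 - x ^ 1 * (2 / ((a : ℝ) + 1)))
    (gammaNat a) := i1.sub i2
  have i4 : Integrable (fun x : ℝ => x ^ 2 / ((a : ℝ) + 1) ^ 2 - x ^ 1 * (2 / ((a : ℝ) + 1)) + 1)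
    (gammaNat a) := i3.add (integrable_const 1)
  rw [integral_add (i4.mul_const _) (integrable_const _), integral_mul_const,
    integral_add i3 (integrable_const 1), integral_sub i1 i2, integral_div, integral_mul_const,
    integral_pow_gammaNat, integral_pow_gammaNat, integral_const, integral_const]
  have h1 : ((a + 1).factorial : ℝ) = (a + 1) * a.factorial := by
    rw [Nat.factorial_succ]; push_cast; ring
  have h2 : ((a + 2).factorial : ℝ) = (a + 2) * ((a + 1) * a.factorial) := by
    rw [Nat.factorial_succ, Nat.factorial_succ]; push_cast; ring
  rw [h1, h2]
  simp only [probReal_univ, one_smul]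
  have ha : (a : ℝ) = c ^ 2 - 1 := by linarith
  rw [ha]
  field_simp
  ring

/-! ### Averages over products of Gamma distributions -/

variable {k : ℕ}

/-- The product of Gamma distributions whose averages give the eigenvalues of a Toeplitz operator
with quasi-radial symbol, in terms of the squared radii; `p j + 1` is the dimension `n j`. -/
def gammaProd (p m : Fin k → ℕ) : Measure (Fin k → ℝ) := Measure.pi fun j => gammaNat (m j + p j)

instance (p m : Fin k → ℕ) : IsProbabilityMeasure (gammaProd p m) := by
  unfold gammaProd; infer_instance

lemma gammaProd_update_succ (p m : Fin k → ℕ) (j : Fin k) (i : ℕ) :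
    gammaProd p (Function.update m j (i + 1)) = (gammaProd p (Function.update m j i)).withDensity
      fun r => ENNReal.ofReal (r j / (i + p j + 1)) := by
  classical
  set w : (j' : Fin k) → ℝ → ℝ≥0∞ := fun j' x =>
    if j' = j then ENNReal.ofReal (x / (i + p j + 1)) else 1 with hw
  have hmu : ∀ j', gammaNat (Function.update m j (i + 1) j' + p j')
      = (gammaNat (Function.update m j i j' + p j')).withDensity (w j') := by
    intro j'
    by_cases h : j' = j
    · subst h
      have : w j' = fun x => ENNReal.ofReal (x / (((i + p j' : ℕ) : ℝ) + 1)) := by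
        funext x; simp [hw]
      rw [Function.update_self, Function.update_self, this, ← gammaNat_succ, add_right_comm]
    · have : w j' = 1 := by funext x; simp [hw, h]
      rw [Function.update_of_ne h, Function.update_of_ne h, this, withDensity_one]
  have hwm : ∀ j', Measurable (w j') := fun j' => by
    by_cases h : j' = j
    · simp only [hw, h, if_true]; fun_prop
    · simp only [hw, h, if_false]; fun_prop
  have : ∀ j', SigmaFinite ((gammaNat (Function.update m j i j' + p j')).withDensity (w j')) :=
    fun j' => by rw [← hmu]; infer_instance
  unfold gammaProd
  simp_rw [hmu]
  rw [pi_withDensity _ hwm]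
  congr 1
  funext r
  rw [hw, Finset.prod_ite_eq' Finset.univ j]
  simp

lemma integrable_of_bounded {Ω : Type*} [MeasurableSpace Ω] {μ : Measure Ω} [IsFiniteMeasure μ]
    {f : Ω → ℂ} (hf : Measurable f) {M : ℝ} (hM : ∀ x, ‖f x‖ ≤ M) : Integrable f μ :=
  Integrable.of_bound hf.aestronglyMeasurable M (Eventually.of_forall hM)

/-- Averages over consecutive products of Gamma distributions differ by `O(m_j ^ (-1/2))`. -/
lemma norm_integral_gammaProd_update_succ_sub_le (p : Fin k → ℕ) {a : (Fin k → ℝ) → ℂ}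
    (ha : Measurable a) {M : ℝ} (hM : ∀ r, ‖a r‖ ≤ M) (m : Fin k → ℕ) (j : Fin k) (i : ℕ) :
    ‖∫ r, a r ∂gammaProd p (Function.update m j (i + 1))
      - ∫ r, a r ∂gammaProd p (Function.update m j i)‖ ≤ M / √(i + 1 : ℝ) := by
  have hM0 : 0 ≤ M := (norm_nonneg _).trans (hM 0)
  set ν := gammaProd p (Function.update m j i) with hν
  have hpos : ∀ᵐ r ∂ν, 0 ≤ r j / ((i : ℝ) + p j + 1) := by
    have h := (measurePreserving_eval
      (fun j' => gammaNat (Function.update m j i j' + p j')) j).quasiMeasurePreserving.ae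
      (ae_gammaNat_pos _)
    filter_upwards [h] with r hr
    have : 0 < r j := hr
    positivity
  have hint : Integrable (fun r : Fin k → ℝ => r j / ((i : ℝ) + p j + 1)) ν := by
    refine Integrable.div_const ?_ _
    refine integrable_comp_eval (μ := fun j' => gammaNat (Function.update m j i j' + p j'))
      (f := fun x : ℝ => x) ?_
    simpa using integrable_pow_gammaNat (Function.update m j i j + p j) 1
  have hint1 : Integrable (fun r : Fin k → ℝ => |r j / ((i : ℝ) + p j + 1) - 1|) ν :=
    (hint.sub (integrable_const 1)).abs
  have hai : Integrable a ν := integrable_of_bounded ha hM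
  have haw : Integrable (fun r : Fin k → ℝ => (r j / ((i : ℝ) + p j + 1)) • a r) ν :=
    hint.smul_bdd M ha.aestronglyMeasurable (Eventually.of_forall hM)
  have e : ∫ r, a r ∂gammaProd p (Function.update m j (i + 1))
      = ∫ r, (r j / ((i : ℝ) + p j + 1)) • a r ∂ν := by
    rw [gammaProd_update_succ, integral_withDensity_eq_integral_toReal_smul (by fun_prop) (by simp)]
    refine integral_congr_ae ?_
    filter_upwards [hpos] with r hr
    rw [ENNReal.toReal_ofReal hr]
  rw [e, ← integral_sub haw hai]
  calc ‖∫ r, (r j / ((i : ℝ) + p j + 1)) • a r - a r ∂ν‖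
      ≤ ∫ r, M * |r j / ((i : ℝ) + p j + 1) - 1| ∂ν := by
        refine norm_integral_le_of_norm_le (hint1.const_mul M) (Eventually.of_forall fun r => ?_)
        have : (r j / ((i : ℝ) + p j + 1)) • a r - a r = (r j / ((i : ℝ) + p j + 1) - 1) • a r := by
          rw [sub_smul, one_smul]
        rw [this, norm_smul, Real.norm_eq_abs, mul_comm]
        gcongr
        exact hM r
    _ = M * ∫ x, |x / ((i : ℝ) + p j + 1) - 1| ∂gammaNat (i + p j) := by
        rw [integral_const_mul]
        congr 1
        have := integral_comp_eval (μ := fun j' => gammaNat (Function.update m j i j' + p j'))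
          (i := j) (f := fun x : ℝ => |x / ((i : ℝ) + p j + 1) - 1|)
          (Measurable.aestronglyMeasurable (by fun_prop))
        rw [Function.update_self] at this
        exact this
    _ ≤ M * (1 / √((i + p j : ℕ) + 1 : ℝ)) := by
        gcongr
        have := integral_abs_div_sub_one_gammaNat_le (i + p j)
        push_cast at this ⊢
        exact this
    _ ≤ M / √(i + 1 : ℝ) := by
        rw [mul_one_div]
        gcongr
        linarith [Nat.cast_nonneg (α := ℝ) (p j)]

/-! ### Lipschitz functions for the square-root metric -/

/-- Summing `1 / √(i + 1) ≤ 2 (√(i + 1) - √i)`. -/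
lemma norm_sub_le_of_step {g : ℕ → ℂ} {M : ℝ} (hM : 0 ≤ M)
    (h : ∀ i : ℕ, ‖g (i + 1) - g i‖ ≤ M / √(i + 1 : ℝ)) (a b : ℕ) :
    ‖g a - g b‖ ≤ 2 * M * |√(a : ℝ) - √(b : ℝ)| := by
  wlog hab : b ≤ a generalizing a b
  · rw [norm_sub_rev, abs_sub_comm]
    exact this b a (by omega)
  induction a, hab using Nat.le_induction with
  | base => simp
  | succ a hab ih =>
    have h1 : √(b : ℝ) ≤ √(a : ℝ) := Real.sqrt_le_sqrt (by exact_mod_cast hab)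
    have h2 : √(a : ℝ) ≤ √((a + 1 : ℕ) : ℝ) := Real.sqrt_le_sqrt (by push_cast; linarith)
    rw [abs_of_nonneg (by linarith)] at ih ⊢
    have h3 : 1 / √(a + 1 : ℝ) ≤ 2 * (√((a + 1 : ℕ) : ℝ) - √(a : ℝ)) := by
      have hx : √((a + 1 : ℕ) : ℝ) ^ 2 = a + 1 := by
        rw [Real.sq_sqrt (by positivity)]; push_cast; ring
      have hy : √(a : ℝ) ^ 2 = a := Real.sq_sqrt (by positivity)
      have hx0 : 0 < √((a + 1 : ℕ) : ℝ) := Real.sqrt_pos.2 (by positivity)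
      have hy0 : 0 ≤ √(a : ℝ) := Real.sqrt_nonneg _
      have : (a : ℝ) + 1 = ((a + 1 : ℕ) : ℝ) := by push_cast; ring
      rw [this, div_le_iff₀ hx0]
      nlinarith
    calc ‖g (a + 1) - g b‖ ≤ ‖g (a + 1) - g a‖ + ‖g a - g b‖ := norm_sub_le_norm_sub_add_norm_sub _ _ _
      _ ≤ M * (1 / √(a + 1 : ℝ)) + 2 * M * (√(a : ℝ) - √(b : ℝ)) := by
          rw [mul_one_div]
          exact add_le_add (h a) ih
      _ ≤ M * (2 * (√((a + 1 : ℕ) : ℝ) - √(a : ℝ))) + 2 * M * (√(a : ℝ) - √(b : ℝ)) := by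
          gcongr
      _ = _ := by ring

/-- The coordinates of `m` are replaced by those of `m'` one at a time. -/
lemma norm_sub_le_sqrtDist {f : (Fin k → ℕ) → ℂ} {M : ℝ} (hM : 0 ≤ M)
    (h : ∀ (m : Fin k → ℕ) (j : Fin k) (i : ℕ),
      ‖f (Function.update m j (i + 1)) - f (Function.update m j i)‖ ≤ M / √(i + 1 : ℝ))
    (m m' : Fin k → ℕ) : ‖f m - f m'‖ ≤ 2 * M * sqrtDist m m' := by
  classical
  have key : ∀ s : Finset (Fin k), ‖f (s.piecewise m m') - f m'‖
      ≤ 2 * M * ∑ j ∈ s, |√(m j : ℝ) - √(m' j : ℝ)| := by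
    intro s
    induction s using Finset.induction_on with
    | empty => simp
    | insert j s hj ih =>
      rw [Finset.piecewise_insert, Finset.sum_insert hj, mul_add]
      refine (norm_sub_le_norm_sub_add_norm_sub _ (f (s.piecewise m m')) _).trans
        (add_le_add ?_ ih)
      have h1 := norm_sub_le_of_step (g := fun i => f (Function.update (s.piecewise m m') j i)) hM
        (h (s.piecewise m m') j) (m j) (m' j)
      have h2 : Function.update (s.piecewise m m') j (m' j) = s.piecewise m m' := by
        rw [Function.update_eq_self_iff, Finset.piecewise_eq_of_notMem _ _ _ hj]
      rwa [h2] at h1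
  have := key Finset.univ
  rwa [Finset.piecewise_univ] at this

/-! ### The heat flow at time one factors through averages over Gamma distributions -/

/-- The Poisson weight of `i` for the intensity `|x|`. The absolute value makes the weights
nonnegative on all of `ℝ`, although only positive `x` matter. -/
def poissonWeight (x : ℝ) (i : ℕ) : ℝ := Real.exp (-|x|) * |x| ^ i / (i.factorial : ℝ)

lemma poissonWeight_nonneg (x : ℝ) (i : ℕ) : 0 ≤ poissonWeight x i := by
  unfold poissonWeight; positivity

lemma hasSum_poissonWeight (x : ℝ) : HasSum (poissonWeight x) 1 := by
  have h := NormedSpace.expSeries_div_hasSum_exp (𝔸 := ℝ) |x|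
  rw [← Real.exp_eq_exp_ℝ] at h
  have := h.mul_left (Real.exp (-|x|))
  rw [← Real.exp_add, neg_add_cancel, Real.exp_zero] at this
  have e : poissonWeight x = fun i => Real.exp (-|x|) * (|x| ^ i / (i.factorial : ℝ)) :=
    funext fun i => by rw [poissonWeight, mul_div_assoc]
  rw [e]
  exact this

lemma measurable_poissonWeight (i : ℕ) : Measurable fun x => poissonWeight x i := by
  unfold poissonWeight
  fun_prop

lemma integral_poissonWeight_gammaNat (a i : ℕ) :
    ∫ x, poissonWeight x i ∂gammaNat a = (i + a).choose a / 2 ^ (i + a + 1) := by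
  rw [integral_gammaNat]
  have h := integral_pow_mul_exp_neg_mul (i + a) two_pos
  have e : ∀ x ∈ Set.Ioi (0 : ℝ), gammaDensity a x • poissonWeight x i
      = x ^ (i + a) * Real.exp (-(2 * x)) * ((a.factorial : ℝ) * (i.factorial : ℝ))⁻¹ := by
    intro x hx
    have : Real.exp (-(2 * x)) = Real.exp (-x) * Real.exp (-x) := by
      rw [← Real.exp_add]; ring_nf
    rw [gammaDensity, poissonWeight, abs_of_pos hx, smul_eq_mul, this, pow_add]
    field_simp
  rw [setIntegral_congr_fun measurableSet_Ioi e, integral_mul_const, h,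
    Nat.cast_choose ℝ (Nat.le_add_left a i), Nat.add_sub_cancel]
  field_simp

/-- The average of a bounded function on `ℕ₀^k` over independent Poisson variables. -/
def poissonAverage (σ : LInfty k) (r : Fin k → ℝ) : ℂ :=
  ∑' l : Fin k → ℕ, (∏ j, (poissonWeight (r j) (l j) : ℂ)) * σ l

lemma tsum_enorm_poissonWeight (r : Fin k → ℝ) :
    ∑' l : Fin k → ℕ, ‖∏ j, (poissonWeight (r j) (l j) : ℂ)‖ₑ = 1 := by
  simp_rw [enorm_finset_prod]
  rw [ENNReal_tsum_pi_prod fun j i => ‖(poissonWeight (r j) i : ℂ)‖ₑ]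
  refine Finset.prod_eq_one fun j _ => ?_
  have : ∀ i, ‖(poissonWeight (r j) i : ℂ)‖ₑ = ENNReal.ofReal (poissonWeight (r j) i) := fun i => by
    rw [← ofReal_norm, Complex.norm_real, Real.norm_of_nonneg (poissonWeight_nonneg _ _)]
  simp_rw [this]
  rw [← ENNReal.ofReal_tsum_of_nonneg (fun i => poissonWeight_nonneg _ _)
    (hasSum_poissonWeight _).summable, (hasSum_poissonWeight _).tsum_eq, ENNReal.ofReal_one]

lemma tsum_enorm_poissonWeight_mul_le (σ : LInfty k) (r : Fin k → ℝ) :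
    ∑' l : Fin k → ℕ, ‖(∏ j, (poissonWeight (r j) (l j) : ℂ)) * σ l‖ₑ ≤ ‖σ‖ₑ := by
  calc _ ≤ ∑' l : Fin k → ℕ, ‖∏ j, (poissonWeight (r j) (l j) : ℂ)‖ₑ * ‖σ‖ₑ := by
        refine ENNReal.tsum_le_tsum fun l => ?_
        rw [enorm_mul, ← ofReal_norm (σ l), ← ofReal_norm σ]
        gcongr
        exact norm_apply_le σ l
    _ = ‖σ‖ₑ := by rw [ENNReal.tsum_mul_right, tsum_enorm_poissonWeight, one_mul]

lemma norm_poissonAverage_le (σ : LInfty k) (r : Fin k → ℝ) : ‖poissonAverage σ r‖ ≤ ‖σ‖ := by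
  have := (enorm_tsum_le_tsum_enorm (f := fun l : Fin k → ℕ =>
    (∏ j, (poissonWeight (r j) (l j) : ℂ)) * σ l)).trans (tsum_enorm_poissonWeight_mul_le σ r)
  rwa [← ofReal_norm, ← ofReal_norm, ENNReal.ofReal_le_ofReal_iff (norm_nonneg _)] at this

lemma measurable_poissonTerm (σ : LInfty k) (l : Fin k → ℕ) :
    Measurable fun r : Fin k → ℝ => (∏ j, (poissonWeight (r j) (l j) : ℂ)) * σ l := by
  refine Measurable.mul_const (Finset.measurable_prod _ fun j _ => ?_) _
  exact Complex.measurable_ofReal.comp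
    ((measurable_poissonWeight (l j)).comp (measurable_pi_apply j))

lemma measurable_poissonAverage (σ : LInfty k) : Measurable (poissonAverage σ) := by
  refine measurable_of_tendsto_metrizable' (u := atTop) (f := fun s : Finset (Fin k → ℕ) =>
    fun r : Fin k → ℝ => ∑ l ∈ s, (∏ j, (poissonWeight (r j) (l j) : ℂ)) * σ l)
    (fun s => Finset.measurable_sum _ fun l _ => measurable_poissonTerm σ l) ?_
  rw [tendsto_pi_nhds]
  intro r
  have hs : Summable fun l : Fin k → ℕ => ‖(∏ j, (poissonWeight (r j) (l j) : ℂ)) * σ l‖ :=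
    tsum_enorm_ne_top_iff_summable_norm.1
      (ne_top_of_le_ne_top enorm_ne_top (tsum_enorm_poissonWeight_mul_le σ r))
  exact hs.of_norm.hasSum

lemma integral_poissonAverage (p : Fin k → ℕ) (σ : LInfty k) (m : Fin k → ℕ) :
    ∫ r, poissonAverage σ r ∂gammaProd p m = heatFun p 1 σ m := by
  unfold poissonAverage heatFun
  rw [integral_tsum fun l => (measurable_poissonTerm σ l).aestronglyMeasurable]
  · refine tsum_congr fun l => ?_
    rw [integral_mul_const, heatKernel, gammaProd,
      integral_fintype_prod_eq_prod (𝕜 := ℂ) fun j (x : ℝ) => (poissonWeight x (l j) : ℂ)]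
    congr 1
    refine Finset.prod_congr rfl fun j _ => ?_
    rw [integral_complex_ofReal, integral_poissonWeight_gammaNat, coeff_branchSeries_one]
    push_cast
    rfl
  · rw [← lintegral_tsum fun l => (measurable_poissonTerm σ l).enorm.aemeasurable]
    refine ne_top_of_le_ne_top (b := ‖σ‖ₑ) enorm_ne_top ?_
    calc _ ≤ ∫⁻ r, ‖σ‖ₑ ∂gammaProd p m :=
          lintegral_mono fun r => tsum_enorm_poissonWeight_mul_le σ r
      _ = ‖σ‖ₑ := by simp

/-- The bounded functions on `ℕ₀^k` that arise as averages of a bounded measurable function over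
products of Gamma distributions. -/
def gammaAverages (p : Fin k → ℕ) : Submodule ℂ (LInfty k) where
  carrier := {σ | ∃ a : (Fin k → ℝ) → ℂ, Measurable a ∧ (∃ M : ℝ, ∀ r, ‖a r‖ ≤ M) ∧
    ∀ m, σ m = ∫ r, a r ∂gammaProd p m}
  add_mem' := by
    rintro σ τ ⟨a, ha, ⟨M, hM⟩, h⟩ ⟨b, hb, ⟨M', hM'⟩, h'⟩
    refine ⟨a + b, ha.add hb, ⟨M + M', fun r => (norm_add_le _ _).trans
      (add_le_add (hM r) (hM' r))⟩, fun m => ?_⟩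
    rw [lp.coeFn_add, Pi.add_apply, h, h',
      ← integral_add (integrable_of_bounded ha hM) (integrable_of_bounded hb hM')]
    rfl
  zero_mem' := ⟨0, measurable_zero, ⟨0, fun r => by simp⟩, fun m => by simp⟩
  smul_mem' := by
    rintro c σ ⟨a, ha, ⟨M, hM⟩, h⟩
    refine ⟨c • a, ha.const_smul c, ⟨‖c‖ * M, fun r => ?_⟩, fun m => ?_⟩
    · rw [Pi.smul_apply, norm_smul]
      gcongr
      exact hM r
    · rw [lp.coeFn_smul, Pi.smul_apply, h, ← integral_smul]
      rfl

lemma norm_integral_gammaProd_le {a : (Fin k → ℝ) → ℂ} {M : ℝ} (hM : ∀ r, ‖a r‖ ≤ M)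
    (p m : Fin k → ℕ) : ‖∫ r, a r ∂gammaProd p m‖ ≤ M := by
  have := norm_integral_le_of_norm_le_const (μ := gammaProd p m) (Eventually.of_forall hM)
  simpa using this

/-- Averages over products of Gamma distributions lie in `C_{b,u}`; they are even Lipschitz for the
square-root metric. -/
lemma exists_mem_Cbu_eq_integral (p : Fin k → ℕ) {a : (Fin k → ℝ) → ℂ} (ha : Measurable a) {M : ℝ}
    (hM : ∀ r, ‖a r‖ ≤ M) : ∃ σ : Cbu k, ∀ m, σ.1 m = ∫ r, a r ∂gammaProd p m := by
  have hM0 : 0 ≤ M := (norm_nonneg _).trans (hM 0)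
  have hmem : Memℓp (fun m => ∫ r, a r ∂gammaProd p m) ∞ :=
    memℓp_infty ⟨M, by rintro _ ⟨m, rfl⟩; exact norm_integral_gammaProd_le hM p m⟩
  refine ⟨⟨⟨_, hmem⟩, fun ε hε => ⟨ε / (2 * M + 1), by positivity, fun m m' hm => ?_⟩⟩,
    fun m => rfl⟩
  have h := norm_sub_le_sqrtDist (f := fun m => ∫ r, a r ∂gammaProd p m) hM0
    (norm_integral_gammaProd_update_succ_sub_le p ha hM) m m'
  have h0 : 0 ≤ sqrtDist m m' := Finset.sum_nonneg fun j _ => abs_nonneg _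
  rw [lt_div_iff₀ (by positivity)] at hm
  calc _ ≤ 2 * M * sqrtDist m m' := h
    _ ≤ sqrtDist m m' * (2 * M + 1) := by nlinarith
    _ < ε := hm

/-- Averages over products of Gamma distributions are dense in `C_{b,u}`. -/
theorem mem_closure_gammaAverages (p : Fin k → ℕ) {σ : LInfty k} (hσ : σ ∈ Cbu k) :
    σ ∈ (gammaAverages p).topologicalClosure := by
  refine mem_of_heatFun_one_mem p (Submodule.isClosed_topologicalClosure _) (fun τ => ?_) hσ
  have h1 : ∀ m, ‖heatFun p 1 τ m‖ ≤ ‖τ‖ := by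
    simpa using norm_heatFun_le_of_real p one_pos le_rfl τ
  refine ⟨heatLp p 1 τ, Submodule.le_topologicalClosure _ ⟨poissonAverage τ,
    measurable_poissonAverage τ, ⟨‖τ‖, norm_poissonAverage_le τ⟩, fun m => ?_⟩, coe_heatLp h1⟩
  rw [coe_heatLp h1, integral_poissonAverage]

/-! ### Sums of independent Gamma variables -/

lemma integral_pow_mul_cexp_neg_mul (s : ℝ) (a : ℕ) :
    ∫ x in Set.Ioi (0 : ℝ), ((x : ℂ) ^ a / (a.factorial : ℂ)) * Complex.exp (-((1 - s * Complex.I) * x))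
      = (1 - s * Complex.I)⁻¹ ^ (a + 1) := by
  set b : ℂ := 1 - s * Complex.I with hb
  have hb0 : b ≠ 0 := by
    intro h
    have := congrArg Complex.re h
    simp [hb] at this
  have hnorm : ∀ x : ℝ, ‖Complex.exp (-(b * x))‖ = Real.exp (-x) := by
    intro x
    rw [Complex.norm_exp]
    congr 1
    simp [hb]
  have hint : ∀ a : ℕ, IntegrableOn (fun x : ℝ => ((x : ℂ) ^ a / (a.factorial : ℂ))
      * Complex.exp (-(b * x))) (Set.Ioi 0) := by
    intro a
    refine (integrableOn_gammaDensity a).mono' (Continuous.aestronglyMeasurable (by fun_prop)) ?_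
    filter_upwards [ae_restrict_mem measurableSet_Ioi] with x hx
    rw [norm_mul, hnorm, norm_div, norm_pow, Complex.norm_real, Complex.norm_natCast,
      Real.norm_of_nonneg (le_of_lt hx), gammaDensity]
    exact le_of_eq (by ring)
  have hexp : ∀ x : ℝ, HasDerivAt (fun x : ℝ => Complex.exp (-(b * x)))
      (-b * Complex.exp (-(b * x))) x := by
    intro x
    have h1 : HasDerivAt (fun x : ℝ => -(b * (x : ℂ))) (-(b * 1)) x :=
      ((Complex.ofRealCLM.hasDerivAt (x := x)).const_mul b).neg
    convert h1.cexp using 1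
    ring
  have hlim : ∀ a : ℕ, Tendsto (fun x : ℝ => ((x : ℂ) ^ a / (a.factorial : ℂ))
      * Complex.exp (-(b * x))) atTop (𝓝 0) := by
    intro a
    rw [tendsto_zero_iff_norm_tendsto_zero]
    have := (Real.tendsto_pow_mul_exp_neg_atTop_nhds_zero a).div_const (a.factorial : ℝ)
    rw [zero_div] at this
    refine this.congr' ?_
    filter_upwards [eventually_ge_atTop 0] with x hx
    rw [norm_mul, hnorm, norm_div, norm_pow, Complex.norm_real, Complex.norm_natCast,
      Real.norm_of_nonneg hx]
    ring
  induction a with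
  | zero =>
    have := integral_Ioi_of_hasDerivAt_of_tendsto' (a := 0)
      (f := fun x : ℝ => -b⁻¹ * Complex.exp (-(b * x)))
      (f' := fun x : ℝ => ((x : ℂ) ^ 0 / ((0 : ℕ).factorial : ℂ)) * Complex.exp (-(b * x))) (m := 0)
      (fun x _ => by
        refine ((hexp x).const_mul (-b⁻¹)).congr_deriv ?_
        rw [← mul_assoc, neg_mul_neg, inv_mul_cancel₀ hb0]
        simp) (hint 0) (by
        have := (hlim 0).const_mul (-b⁻¹)
        simpa using this)
    rw [this]
    simp
  | succ a ih =>
    have hd : ∀ x : ℝ, HasDerivAt (fun x : ℝ => ((x : ℂ) ^ (a + 1) / ((a + 1).factorial : ℂ))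
        * Complex.exp (-(b * x))) (((x : ℂ) ^ a / (a.factorial : ℂ)) * Complex.exp (-(b * x))
          - b * (((x : ℂ) ^ (a + 1) / ((a + 1).factorial : ℂ)) * Complex.exp (-(b * x)))) x := by
      intro x
      have h1 := ((((Complex.ofRealCLM.hasDerivAt (x := x)).pow (a + 1)).div_const
        ((a + 1).factorial : ℂ))).mul (hexp x)
      refine h1.congr_deriv ?_
      have : (a.factorial : ℂ) ≠ 0 := by exact_mod_cast a.factorial_ne_zero
      have : (a : ℂ) + 1 ≠ 0 := by exact_mod_cast a.succ_ne_zero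
      simp only [Complex.ofRealCLM_apply, Nat.factorial_succ, Nat.add_sub_cancel]
      push_cast
      simp
      field_simp
      ring
    have h := integral_Ioi_of_hasDerivAt_of_tendsto' (a := 0) (fun x _ => hd x)
      ((hint a).sub ((hint (a + 1)).const_mul b)) (hlim (a + 1))
    rw [integral_sub (hint a) ((hint (a + 1)).const_mul b), integral_const_mul, ih] at h
    have h0 : (((0 : ℝ) : ℂ) ^ (a + 1) / ((a + 1).factorial : ℂ))
        * Complex.exp (-(b * ((0 : ℝ) : ℂ))) = 0 := by simp
    rw [h0, sub_zero, sub_eq_zero] at h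
    rw [pow_succ, h]
    field_simp

lemma charFun_gammaNat (a : ℕ) (s : ℝ) :
    charFun (gammaNat a) s = (1 - s * Complex.I)⁻¹ ^ (a + 1) := by
  rw [← integral_pow_mul_cexp_neg_mul, charFun_apply_real, integral_gammaNat]
  refine setIntegral_congr_fun measurableSet_Ioi fun x _ => ?_
  have : Complex.exp (-((1 - s * Complex.I) * x))
      = Complex.exp (-x) * Complex.exp (s * x * Complex.I) := by
    rw [← Complex.exp_add]; ring_nf
  simp only [gammaDensity, Complex.real_smul, this]
  push_cast
  ring

/-- A sum of independent Gamma variables is a Gamma variable whose parameter is the sum of the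
parameters. -/
lemma map_sum_pi_gammaNat {d : ℕ} (hd : 1 ≤ d) (a : Fin d → ℕ) :
    (Measure.pi fun i => gammaNat (a i)).map (fun x => ∑ i, x i)
      = gammaNat (∑ i, a i + (d - 1)) := by
  have hm : Measurable fun x : Fin d → ℝ => ∑ i, x i := by fun_prop
  have : IsProbabilityMeasure ((Measure.pi fun i => gammaNat (a i)).map fun x => ∑ i, x i) :=
    Measure.isProbabilityMeasure_map hm.aemeasurable
  refine Measure.ext_of_charFun ?_
  rw [ProbabilityTheory.charFun_map_sum_pi_eq_prod]
  funext s
  rw [Finset.prod_apply, charFun_gammaNat]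
  simp_rw [charFun_gammaNat]
  rw [Finset.prod_pow_eq_pow_sum, Finset.sum_add_distrib]
  congr 1
  simp
  omega

/-! ### Radial distributions on the complex plane -/

/-- The probability measure on `ℂ` with density `|z|^{2a} / a!` with respect to the standard Gaussian
measure. -/
def gaussMoment (a : ℕ) : Measure ℂ :=
  volume.withDensity fun z =>
    ENNReal.ofReal (Real.pi⁻¹ * Real.exp (-‖z‖ ^ 2) * ((‖z‖ ^ 2) ^ a / (a.factorial : ℝ)))

lemma lintegral_comp_norm_sq {f : ℝ → ℝ≥0∞} (hf : Measurable f) :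
    ∫⁻ z : ℂ, f (‖z‖ ^ 2) = ∫⁻ x in Set.Ioi (0 : ℝ), ENNReal.ofReal Real.pi * f x := by
  rw [← Complex.lintegral_comp_polarCoord_symm, polarCoord_target, Measure.volume_eq_prod,
    ← Measure.prod_restrict]
  have himg : (fun r : ℝ => r ^ 2) '' Set.Ioi 0 = Set.Ioi 0 := by
    ext x
    constructor
    · rintro ⟨r, hr, rfl⟩
      exact pow_pos (Set.mem_Ioi.1 hr) 2
    · intro hx
      exact ⟨√x, Real.sqrt_pos.2 hx, Real.sq_sqrt (le_of_lt hx)⟩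
  have hsub := lintegral_image_eq_lintegral_abs_deriv_mul (s := Set.Ioi (0 : ℝ))
    (f := fun r : ℝ => r ^ 2) (f' := fun r => 2 * r) measurableSet_Ioi
    (fun x _ => by simpa using (hasDerivAt_pow 2 x).hasDerivWithinAt)
    (fun x hx y hy h => by
      exact (pow_left_inj₀ (le_of_lt hx) (le_of_lt hy) two_ne_zero).1 h)
    (fun x => ENNReal.ofReal Real.pi * f x)
  rw [himg] at hsub
  rw [hsub]
  simp only [Complex.norm_polarCoord_symm, sq_abs, smul_eq_mul]
  rw [lintegral_prod _ (Measurable.aemeasurable (by fun_prop))]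
  refine setLIntegral_congr_fun measurableSet_Ioi fun r hr => ?_
  have hr' : (0 : ℝ) < r := hr
  simp only [lintegral_const, Measure.restrict_apply_univ, Real.volume_Ioo, sub_neg_eq_add]
  rw [abs_of_pos (by positivity), mul_right_comm, ← mul_assoc, ← ENNReal.ofReal_mul hr'.le,
    ← ENNReal.ofReal_mul (by positivity)]
  congr 2
  ring

lemma map_norm_sq_gaussMoment (a : ℕ) :
    (gaussMoment a).map (fun z => ‖z‖ ^ 2) = gammaNat a := by
  have hm : Measurable fun z : ℂ => ‖z‖ ^ 2 := by fun_prop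
  refine Measure.ext fun s hs => ?_
  rw [Measure.map_apply hm hs, gaussMoment, withDensity_apply _ (hm hs), gammaNat,
    withDensity_apply _ hs, ← lintegral_indicator (hm hs), ← lintegral_indicator hs]
  have hg : Measurable (s.indicator fun x : ℝ =>
      ENNReal.ofReal (Real.pi⁻¹ * Real.exp (-x) * (x ^ a / (a.factorial : ℝ)))) :=
    Measurable.indicator (by fun_prop) hs
  have := lintegral_comp_norm_sq hg
  calc _ = ∫⁻ z : ℂ, s.indicator (fun x : ℝ =>
      ENNReal.ofReal (Real.pi⁻¹ * Real.exp (-x) * (x ^ a / (a.factorial : ℝ)))) (‖z‖ ^ 2) := by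
        refine lintegral_congr fun z => ?_
        by_cases h : ‖z‖ ^ 2 ∈ s
        · rw [Set.indicator_of_mem h, Set.indicator_of_mem (by exact h)]
        · rw [Set.indicator_of_notMem h, Set.indicator_of_notMem (by exact h)]
    _ = _ := this
    _ = _ := by
        refine lintegral_congr fun x => ?_
        by_cases h : x ∈ s
        · rw [Set.indicator_of_mem h, Set.indicator_of_mem h, ← ENNReal.ofReal_mul Real.pi_pos.le,
            gammaDensity]
          congr 1
          field_simp
        · rw [Set.indicator_of_notMem h, Set.indicator_of_notMem h, mul_zero]

instance (a : ℕ) : IsProbabilityMeasure (gaussMoment a) := by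
  have hm : Measurable fun z : ℂ => ‖z‖ ^ 2 := by fun_prop
  have h : IsProbabilityMeasure ((gaussMoment a).map fun z => ‖z‖ ^ 2) := by
    rw [map_norm_sq_gaussMoment]; infer_instance
  constructor
  have := h.measure_univ
  rwa [Measure.map_apply hm MeasurableSet.univ, Set.preimage_univ] at this

lemma measurePreserving_mul_circle_gaussMoment (a : ℕ) (c : Circle) :
    MeasurePreserving (fun z : ℂ => (c : ℂ) * z) (gaussMoment a) (gaussMoment a) := by
  have h1 : MeasurePreserving (fun w : ℂ => (c : ℂ) * w) volume volume :=
    (rotation c).measurePreserving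
  refine ⟨h1.measurable, ?_⟩
  refine Measure.ext fun s hs => ?_
  rw [Measure.map_apply h1.measurable hs, gaussMoment, withDensity_apply _ (h1.measurable hs),
    withDensity_apply _ hs, ← (h1.restrict_preimage hs).lintegral_comp (by fun_prop)]
  simp only [norm_mul, Circle.norm_coe, one_mul]

/-! ### The Gaussian measure in polar coordinates -/

variable (n : Fin k → ℕ)

/-- The factorial `α!` of a multi-index. -/
def multiFactorial (α : (j : Fin k) → Fin (n j) → ℕ) : ℝ := ∏ j, ∏ i, ((α j i).factorial : ℝ)

/-- The monomial `z ^ α`. -/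
def monomialFun (α : (j : Fin k) → Fin (n j) → ℕ) (z : CSpace n) : ℂ := ∏ j, ∏ i, z j i ^ α j i

/-- The squared radii `(|z₍₁₎|², …, |z₍ₖ₎|²)`. -/
def sqRadii (z : CSpace n) (j : Fin k) : ℝ := ∑ i, ‖z j i‖ ^ 2

variable {n}

/-- The degrees `(|α₍₁₎|, …, |α₍ₖ₎|)` of a multi-index. -/
def blockDegree (α : (j : Fin k) → Fin (n j) → ℕ) (j : Fin k) : ℕ := ∑ i, α j i

lemma multiFactorial_pos (α : (j : Fin k) → Fin (n j) → ℕ) : 0 < multiFactorial n α :=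
  Finset.prod_pos fun _ _ => Finset.prod_pos fun _ _ => by positivity

lemma continuous_monomialFun (α : (j : Fin k) → Fin (n j) → ℕ) :
    Continuous (monomialFun n α) := by
  unfold monomialFun; fun_prop

lemma measurable_sqRadii : Measurable (sqRadii n) := by
  unfold sqRadii; fun_prop

lemma pi_gaussMoment (α : (j : Fin k) → Fin (n j) → ℕ) :
    (Measure.pi fun j => Measure.pi fun i => gaussMoment (α j i)) = volume.withDensity fun z =>
      ENNReal.ofReal ((Real.pi ^ (∑ j, n j))⁻¹ * Real.exp (-∑ j, ∑ i, ‖z j i‖ ^ 2)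
        * (‖monomialFun n α z‖ ^ 2 / multiFactorial n α)) := by
  set w : ℕ → ℂ → ℝ≥0∞ := fun a z =>
    ENNReal.ofReal (Real.pi⁻¹ * Real.exp (-‖z‖ ^ 2) * ((‖z‖ ^ 2) ^ a / (a.factorial : ℝ))) with hw
  have hwm : ∀ a, Measurable (w a) := fun a => by fun_prop
  have : ∀ a, SigmaFinite ((volume : Measure ℂ).withDensity (w a)) := fun a =>
    inferInstanceAs (SigmaFinite (gaussMoment a))
  have h1 : ∀ j, (Measure.pi fun i => gaussMoment (α j i))
      = (volume : Measure (Fin (n j) → ℂ)).withDensity fun x => ∏ i, w (α j i) (x i) := fun j =>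
    pi_withDensity (fun _ : Fin (n j) => (volume : Measure ℂ)) (f := fun i => w (α j i))
      fun i => hwm _
  have : ∀ j, SigmaFinite ((volume : Measure (Fin (n j) → ℂ)).withDensity
      fun x => ∏ i, w (α j i) (x i)) := fun j => by rw [← h1]; infer_instance
  simp_rw [h1]
  rw [pi_withDensity (fun j : Fin k => (volume : Measure (Fin (n j) → ℂ)))
    (f := fun j x => ∏ i, w (α j i) (x i)) fun j => by fun_prop]
  change (volume : Measure (CSpace n)).withDensity _ = _
  congr 1
  funext z
  simp only [hw]
  have hj : ∀ j, ∏ i, ENNReal.ofReal (Real.pi⁻¹ * Real.exp (-‖z j i‖ ^ 2)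
      * ((‖z j i‖ ^ 2) ^ α j i / ((α j i).factorial : ℝ))) = ENNReal.ofReal (∏ i, (Real.pi⁻¹ *
        Real.exp (-‖z j i‖ ^ 2) * ((‖z j i‖ ^ 2) ^ α j i / ((α j i).factorial : ℝ)))) := fun j =>
    (ENNReal.ofReal_prod_of_nonneg fun i _ => by positivity).symm
  simp_rw [hj]
  rw [← ENNReal.ofReal_prod_of_nonneg (fun j _ => by positivity)]
  congr 1
  simp_rw [Finset.prod_mul_distrib, Finset.prod_div_distrib, ← Real.exp_sum,
    Finset.sum_neg_distrib]
  congr 1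
  · congr 1
    simp [Finset.prod_pow_eq_pow_sum]
  · rw [multiFactorial, monomialFun]
    simp_rw [norm_prod, norm_pow, ← Finset.prod_pow, ← pow_mul, mul_comm]

lemma pi_gaussMoment_zero :
    (Measure.pi fun j => Measure.pi fun _ : Fin (n j) => gaussMoment 0) = gaussian n := by
  have := pi_gaussMoment (n := n) fun _ _ => 0
  rw [this, gaussian]
  simp [multiFactorial, monomialFun]

instance : IsProbabilityMeasure (gaussian n) := by
  rw [← pi_gaussMoment_zero]; infer_instance

lemma gaussian_withDensity_monomialFun (α : (j : Fin k) → Fin (n j) → ℕ) :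
    (gaussian n).withDensity (fun z =>
        ENNReal.ofReal (‖monomialFun n α z‖ ^ 2 / multiFactorial n α))
      = Measure.pi fun j => Measure.pi fun i => gaussMoment (α j i) := by
  have := continuous_monomialFun α
  rw [pi_gaussMoment, gaussian, ← withDensity_mul _ (Measurable.ennreal_ofReal (by fun_prop))
    (Measurable.ennreal_ofReal (Continuous.measurable (by fun_prop)))]
  congr 1
  funext z
  rw [Pi.mul_apply, ← ENNReal.ofReal_mul (by positivity)]

/-- The squared radii of a point chosen with density `|z^α|² / α!` are independent Gamma variables.
This is why the eigenvalues depend only on the degrees of `α`. -/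
lemma map_sqRadii_withDensity (hn : ∀ j, 1 ≤ n j) (α : (j : Fin k) → Fin (n j) → ℕ) :
    ((gaussian n).withDensity fun z =>
        ENNReal.ofReal (‖monomialFun n α z‖ ^ 2 / multiFactorial n α)).map (sqRadii n)
      = gammaProd (fun j => n j - 1) (blockDegree α) := by
  rw [gaussian_withDensity_monomialFun]
  have h1 : ∀ j, (Measure.pi fun i => gaussMoment (α j i)).map
      (fun x : Fin (n j) → ℂ => ∑ i, ‖x i‖ ^ 2) = gammaNat (blockDegree α j + (n j - 1)) := by
    intro j
    have : ∀ i, SigmaFinite ((gaussMoment (α j i)).map fun z => ‖z‖ ^ 2) := fun i => by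
      rw [map_norm_sq_gaussMoment]; infer_instance
    have h2 := Measure.pi_map_pi (μ := fun i => gaussMoment (α j i))
      (f := fun (_ : Fin (n j)) (z : ℂ) => ‖z‖ ^ 2) fun i => Measurable.aemeasurable (by fun_prop)
    simp_rw [map_norm_sq_gaussMoment] at h2
    rw [blockDegree, ← map_sum_pi_gammaNat (hn j), ← h2, Measure.map_map (by fun_prop) (by fun_prop)]
    rfl
  have : ∀ j, SigmaFinite ((Measure.pi fun i => gaussMoment (α j i)).map
      (fun x : Fin (n j) → ℂ => ∑ i, ‖x i‖ ^ 2)) := fun j => by rw [h1]; infer_instance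
  have h3 := Measure.pi_map_pi (μ := fun j => Measure.pi fun i => gaussMoment (α j i))
    (f := fun (j : Fin k) (x : Fin (n j) → ℂ) => ∑ i, ‖x i‖ ^ 2)
    fun j => Measurable.aemeasurable (by fun_prop)
  simp_rw [h1] at h3
  exact h3

/-! ### Quasi-radial functions are functions of the squared radii -/

lemma sum_norm_sq_unitary_mulVec {d : ℕ} (A : Matrix.unitaryGroup (Fin d) ℂ) (x : Fin d → ℂ) :
    ∑ i, ‖(A : Matrix (Fin d) (Fin d) ℂ).mulVec x i‖ ^ 2 = ∑ i, ‖x i‖ ^ 2 := by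
  have h : ∀ y : Fin d → ℂ, ((∑ i, ‖y i‖ ^ 2 : ℝ) : ℂ) = star y ⬝ᵥ y := fun y => by
    rw [dotProduct]
    push_cast
    exact Finset.sum_congr rfl fun i _ => (Complex.conj_mul' _).symm
  have hA : (A : Matrix (Fin d) (Fin d) ℂ).conjTranspose * A = 1 :=
    Matrix.mem_unitaryGroup_iff'.1 A.2
  have : ((∑ i, ‖(A : Matrix (Fin d) (Fin d) ℂ).mulVec x i‖ ^ 2 : ℝ) : ℂ)
      = ((∑ i, ‖x i‖ ^ 2 : ℝ) : ℂ) := by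
    rw [h, h, Matrix.star_mulVec, Matrix.dotProduct_mulVec, Matrix.vecMul_vecMul, hA,
      Matrix.vecMul_one]
  exact_mod_cast this

/-- The unitary group acts transitively on spheres. -/
lemma exists_unitary_mulVec_single {d : ℕ} (i₀ : Fin d) (x : Fin d → ℂ) :
    ∃ A : Matrix.unitaryGroup (Fin d) ℂ,
      (A : Matrix (Fin d) (Fin d) ℂ).mulVec (Pi.single i₀ ((√(∑ i, ‖x i‖ ^ 2) : ℝ) : ℂ)) = x := by
  by_cases hx : x = 0
  · exact ⟨1, by simp [hx]⟩
  set y : EuclideanSpace ℂ (Fin d) := WithLp.toLp 2 x with hy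
  have hy0 : y ≠ 0 := fun h => hx (by simpa [hy] using h)
  have hnorm : ‖y‖ = √(∑ i, ‖x i‖ ^ 2) := EuclideanSpace.norm_eq y
  have hon : Orthonormal ℂ (Set.domRestrict ({i₀} : Set (Fin d))
      fun _ => ((‖y‖⁻¹ : ℝ) : ℂ) • y) := by
    constructor
    · intro i
      simp only [Set.domRestrict_apply]
      rw [norm_smul, Complex.norm_real, norm_inv, norm_norm,
        inv_mul_cancel₀ (norm_ne_zero_iff.2 hy0)]
    · intro i j hij
      exact absurd (Subsingleton.elim i j) hij
  obtain ⟨b, hb⟩ := hon.exists_orthonormalBasis_extension_of_card_eq (by simp)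
  refine ⟨⟨_, OrthonormalBasis.toMatrix_orthonormalBasis_mem_unitary
    (EuclideanSpace.basisFun (Fin d) ℂ) b⟩, ?_⟩
  funext i
  rw [Matrix.mulVec_single, ← hnorm]
  have h1 : b i₀ = ((‖y‖⁻¹ : ℝ) : ℂ) • y := hb i₀ rfl
  simp only [Pi.smul_apply, Matrix.col_apply, Module.Basis.toMatrix_apply,
    OrthonormalBasis.coe_toBasis_repr_apply, EuclideanSpace.basisFun_repr, h1]
  have h2 : (‖y‖ : ℂ) ≠ 0 := by exact_mod_cast norm_ne_zero_iff.2 hy0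
  have h3 : y.ofLp i = x i := rfl
  simp only [PiLp.smul_apply, h3, smul_eq_mul, op_smul_eq_mul, Complex.ofReal_inv]
  field_simp

lemma isQuasiRadial_comp_sqRadii {a : (Fin k → ℝ) → ℂ} (ha : Measurable a) {M : ℝ}
    (hM : ∀ r, ‖a r‖ ≤ M) : IsQuasiRadial n (a ∘ sqRadii n) where
  measurable := ha.comp measurable_sqRadii
  memLp := memLp_top_of_bound (ha.comp measurable_sqRadii).aestronglyMeasurable M
    (Eventually.of_forall fun z => hM _)
  invariant A z := by
    rw [Function.comp_apply, Function.comp_apply]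
    congr 1
    funext j
    exact sum_norm_sq_unitary_mulVec (A j) (z j)

/-- A quasi-radial function agrees almost everywhere with a bounded measurable function of the
squared radii. -/
lemma IsQuasiRadial.exists_ae_eq_comp_sqRadii (hn : ∀ j, 1 ≤ n j) {φ : CSpace n → ℂ}
    (hφ : IsQuasiRadial n φ) : ∃ a : (Fin k → ℝ) → ℂ, Measurable a ∧ (∃ M : ℝ, ∀ r, ‖a r‖ ≤ M) ∧
      φ =ᵐ[volume] a ∘ sqRadii n := by
  set i₀ : (j : Fin k) → Fin (n j) := fun j => ⟨0, hn j⟩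
  set b : (Fin k → ℝ) → CSpace n := fun r j => Pi.single (i₀ j) ((√(r j) : ℝ) : ℂ) with hb
  have hbm : Measurable b := by
    refine measurable_pi_lambda _ fun j => measurable_pi_lambda _ fun i => ?_
    by_cases h : i = i₀ j
    · subst h
      simp only [hb, Pi.single_eq_same]
      fun_prop
    · simp only [hb, Pi.single_eq_of_ne h]
      exact measurable_const
  have hφb : ∀ z, φ (b (sqRadii n z)) = φ z := by
    intro z
    choose A hA using fun j => exists_unitary_mulVec_single (i₀ j) (z j)
    rw [← hφ.invariant A]
    congr 1
    funext j
    exact hA j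
  -- `φ` may be unbounded on a null set, so it is cut off at its essential supremum
  obtain ⟨M, hM⟩ : ∃ M : ℝ, ∀ᵐ z, ‖φ z‖ ≤ M := by
    have h := hφ.memLp.2
    rw [eLpNorm_exponent_top] at h
    refine ⟨(eLpNormEssSup φ volume).toReal, ?_⟩
    filter_upwards [ae_le_eLpNormEssSup (f := φ) (μ := volume)] with z hz
    rwa [← toReal_enorm, ENNReal.toReal_le_toReal (by simp) h.ne]
  have hbs : MeasurableSet {r | ‖φ (b r)‖ ≤ M} :=
    measurableSet_le (hφ.measurable.comp hbm).norm measurable_const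
  refine ⟨{r | ‖φ (b r)‖ ≤ M}.indicator (φ ∘ b),
    (hφ.measurable.comp hbm).indicator hbs, ⟨max M 0, fun r => ?_⟩, ?_⟩
  · by_cases hr : r ∈ {r | ‖φ (b r)‖ ≤ M}
    · rw [Set.indicator_of_mem hr]
      exact le_max_of_le_left hr
    · rw [Set.indicator_of_notMem hr]
      simp
  · filter_upwards [hM] with z hz
    have : sqRadii n z ∈ {r | ‖φ (b r)‖ ≤ M} := by
      simp only [Set.mem_ofPred_eq, hφb]
      exact hz
    rw [Function.comp_apply, Set.indicator_of_mem this, Function.comp_apply, hφb]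

/-! ### Moments of monomials -/

lemma isProbabilityMeasure_withDensity_monomialFun (α : (j : Fin k) → Fin (n j) → ℕ) :
    IsProbabilityMeasure ((gaussian n).withDensity fun z =>
      ENNReal.ofReal (‖monomialFun n α z‖ ^ 2 / multiFactorial n α)) := by
  rw [gaussian_withDensity_monomialFun]; infer_instance

lemma memLp_monomialFun (α : (j : Fin k) → Fin (n j) → ℕ) :
    MemLp (monomialFun n α) 2 (gaussian n) := by
  have hc := continuous_monomialFun α
  rw [memLp_two_iff_integrable_sq_norm hc.aestronglyMeasurable]
  have h := (isProbabilityMeasure_withDensity_monomialFun α).measure_univ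
  rw [withDensity_apply _ MeasurableSet.univ, Measure.restrict_univ] at h
  have hi : Integrable (fun z => ‖monomialFun n α z‖ ^ 2 / multiFactorial n α) (gaussian n) := by
    refine ⟨Continuous.aestronglyMeasurable (by fun_prop), ?_⟩
    rw [hasFiniteIntegral_iff_ofReal (Eventually.of_forall fun z =>
      div_nonneg (sq_nonneg _) (multiFactorial_pos α).le), h]
    exact ENNReal.one_lt_top
  refine (hi.mul_const (multiFactorial n α)).congr (Eventually.of_forall fun z => ?_)
  exact div_mul_cancel₀ _ (multiFactorial_pos α).ne'

/-- The diagonal matrix coefficients of a radial symbol with respect to monomials. -/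
lemma integral_comp_sqRadii_mul_norm_sq (hn : ∀ j, 1 ≤ n j) {a : (Fin k → ℝ) → ℂ}
    (ha : Measurable a) (α : (j : Fin k) → Fin (n j) → ℕ) :
    ∫ z, a (sqRadii n z) * (monomialFun n α z * (starRingEnd ℂ) (monomialFun n α z)) ∂gaussian n
      = multiFactorial n α * ∫ r, a r ∂gammaProd (fun j => n j - 1) (blockDegree α) := by
  have hc := continuous_monomialFun α
  have h0 : (multiFactorial n α : ℂ) ≠ 0 := by exact_mod_cast (multiFactorial_pos α).ne'
  rw [← map_sqRadii_withDensity hn, integral_map measurable_sqRadii.aemeasurable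
    ha.aestronglyMeasurable, integral_withDensity_eq_integral_toReal_smul
      (Measurable.ennreal_ofReal (Continuous.measurable (by fun_prop))) (by simp),
    ← integral_const_mul]
  refine integral_congr_ae (Eventually.of_forall fun z => ?_)
  simp only
  rw [ENNReal.toReal_ofReal (div_nonneg (sq_nonneg _) (multiFactorial_pos α).le),
    Complex.mul_conj', Complex.real_smul]
  push_cast
  field_simp

/-- Rotation of every coordinate. -/
def torusAct (u : (j : Fin k) → Fin (n j) → Circle) (z : CSpace n) : CSpace n :=
  fun j i => (u j i : ℂ) * z j i

lemma measurePreserving_torusAct (u : (j : Fin k) → Fin (n j) → Circle) :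
    MeasurePreserving (torusAct u) (gaussian n) (gaussian n) := by
  rw [← pi_gaussMoment_zero]
  exact measurePreserving_pi _ _ (f := fun j (x : Fin (n j) → ℂ) i => (u j i : ℂ) * x i)
    fun j => measurePreserving_pi _ _ (f := fun i (x : ℂ) => (u j i : ℂ) * x)
      fun i => measurePreserving_mul_circle_gaussMoment 0 _

lemma measurableEmbedding_torusAct (u : (j : Fin k) → Fin (n j) → Circle) :
    MeasurableEmbedding (torusAct u) := by
  have hc : ∀ u : (j : Fin k) → Fin (n j) → Circle, Continuous (torusAct u) := fun u => by
    unfold torusAct; fun_prop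
  have hinv : ∀ (u v : (j : Fin k) → Fin (n j) → Circle), (∀ j i, u j i * v j i = 1) →
      ∀ z, torusAct u (torusAct v z) = z := by
    intro u v huv z
    funext j i
    have : (u j i : ℂ) * (v j i : ℂ) = 1 := by rw [← Circle.coe_mul, huv, Circle.coe_one]
    rw [torusAct, torusAct, ← mul_assoc, this, one_mul]
  exact (Homeomorph.mk ⟨torusAct u, torusAct fun j i => (u j i)⁻¹, hinv _ _ (by simp),
    hinv _ _ (by simp)⟩ (hc _) (hc _)).measurableEmbedding

/-- Distinct monomials are orthogonal for every radial weight. -/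
lemma integral_comp_sqRadii_mul_eq_zero (a : (Fin k → ℝ) → ℂ)
    {α β : (j : Fin k) → Fin (n j) → ℕ} (hαβ : α ≠ β) :
    ∫ z, a (sqRadii n z) * (monomialFun n α z * (starRingEnd ℂ) (monomialFun n β z)) ∂gaussian n
      = 0 := by
  obtain ⟨j, hj⟩ := Function.ne_iff.1 hαβ
  obtain ⟨i, hi⟩ := Function.ne_iff.1 hj
  have hsub : (α j i : ℝ) - β j i ≠ 0 := sub_ne_zero.2 (by exact_mod_cast hi)
  -- the coordinate `(j, i)` is rotated by an angle that changes the sign of the integrand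
  set c : Circle := Circle.exp (Real.pi / (α j i - β j i)) with hc
  set u : (j : Fin k) → Fin (n j) → Circle :=
    Function.update (fun _ _ => 1) j (Function.update (fun _ => 1) i c) with hu
  have hmono : ∀ (γ : (j : Fin k) → Fin (n j) → ℕ) (z : CSpace n),
      monomialFun n γ (torusAct u z) = (c : ℂ) ^ γ j i * monomialFun n γ z := by
    intro γ z
    simp only [monomialFun, torusAct, mul_pow, Finset.prod_mul_distrib]
    congr 1
    rw [Finset.prod_eq_single j, Finset.prod_eq_single i]
    · simp [hu]
    · intro i' _ hi'
      simp [hu, hi']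
    · simp
    · intro j' _ hj'
      simp [hu, hj']
    · simp
  have hrad : ∀ z : CSpace n, sqRadii n (torusAct u z) = sqRadii n z := by
    intro z
    funext j'
    simp only [sqRadii, torusAct, norm_mul, Circle.norm_coe, one_mul]
  have hsign : (c : ℂ) ^ α j i * (starRingEnd ℂ) ((c : ℂ) ^ β j i) = -1 := by
    have h1 : (starRingEnd ℂ) (c : ℂ) = Complex.exp (-((Real.pi / (α j i - β j i) : ℝ) : ℂ)
        * Complex.I) := by
      rw [hc, ← Circle.coe_inv_eq_conj, ← Circle.exp_neg, Circle.coe_exp]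
      push_cast
      rfl
    rw [map_pow, h1, hc, Circle.coe_exp, ← Complex.exp_nat_mul, ← Complex.exp_nat_mul,
      ← Complex.exp_add, ← Complex.exp_pi_mul_I]
    congr 1
    have : (α j i : ℂ) - β j i ≠ 0 := by exact_mod_cast hsub
    push_cast
    field_simp
    ring
  set I := ∫ z, a (sqRadii n z) *
    (monomialFun n α z * (starRingEnd ℂ) (monomialFun n β z)) ∂gaussian n with hI
  have h := (measurePreserving_torusAct u).integral_comp (measurableEmbedding_torusAct u)
    fun z => a (sqRadii n z) * (monomialFun n α z * (starRingEnd ℂ) (monomialFun n β z))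
  simp only [hmono, hrad, map_mul] at h
  have h2 : ∀ z, a (sqRadii n z) * ((c : ℂ) ^ α j i * monomialFun n α z *
      ((starRingEnd ℂ) ((c : ℂ) ^ β j i) * (starRingEnd ℂ) (monomialFun n β z)))
      = -(a (sqRadii n z) * (monomialFun n α z * (starRingEnd ℂ) (monomialFun n β z))) := by
    intro z
    linear_combination (a (sqRadii n z) * (monomialFun n α z *
      (starRingEnd ℂ) (monomialFun n β z))) * hsign
  simp_rw [h2] at h
  rw [integral_neg, ← hI] at h
  exact self_eq_neg.1 h.symm

/-! ### The mean value property and the reproducing kernel -/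

lemma measurable_gaussianDensity : Measurable fun z : CSpace n =>
    ENNReal.ofReal ((Real.pi ^ (∑ j, n j))⁻¹ * Real.exp (-∑ j, ∑ i, ‖z j i‖ ^ 2)) :=
  Measurable.ennreal_ofReal (Continuous.measurable (by fun_prop))

lemma integrable_gaussian_iff {f : CSpace n → ℂ} : Integrable f (gaussian n) ↔
    Integrable fun z => ((Real.pi ^ (∑ j, n j))⁻¹ * Real.exp (-∑ j, ∑ i, ‖z j i‖ ^ 2)) • f z := by
  rw [gaussian, integrable_withDensity_iff_integrable_smul' measurable_gaussianDensity (by simp)]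
  refine integrable_congr (Eventually.of_forall fun z => ?_)
  simp only
  rw [ENNReal.toReal_ofReal (by positivity)]

lemma integral_gaussian (f : CSpace n → ℂ) : ∫ z, f z ∂gaussian n
    = ∫ z, ((Real.pi ^ (∑ j, n j))⁻¹ * Real.exp (-∑ j, ∑ i, ‖z j i‖ ^ 2)) • f z := by
  rw [gaussian, integral_withDensity_eq_integral_toReal_smul measurable_gaussianDensity (by simp)]
  refine integral_congr_ae (Eventually.of_forall fun z => ?_)
  simp only
  rw [ENNReal.toReal_ofReal (by positivity)]

/-- The mean value property for the Gaussian measure. -/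
lemma integral_gaussian_eq_apply_zero {h : CSpace n → ℂ} (hd : Differentiable ℂ h)
    (hi : Integrable h (gaussian n)) : ∫ z, h z ∂gaussian n = h 0 := by
  have hrot : ∀ θ : ℝ, MeasurePreserving (fun z : CSpace n => (Circle.exp θ : ℂ) • z)
      (gaussian n) (gaussian n) := fun θ => measurePreserving_torusAct fun _ _ => Circle.exp θ
  have hemb : ∀ θ : ℝ, MeasurableEmbedding (fun z : CSpace n => (Circle.exp θ : ℂ) • z) := fun θ =>
    measurableEmbedding_torusAct fun _ _ => Circle.exp θ
  have hcirc : ∀ z, ∫ θ in Set.Ioc 0 (2 * Real.pi), h ((Circle.exp θ : ℂ) • z)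
      = (2 * Real.pi : ℝ) • h 0 := by
    intro z
    have hdz : Differentiable ℂ (fun t : ℂ => h (t • z)) := by fun_prop
    have e := (hdz.diffContOnCl (s := Metric.ball (0 : ℂ) |(1 : ℝ)|)).circleAverage
    simp only [zero_smul] at e
    rw [Real.circleAverage_def] at e
    rw [← e, smul_inv_smul₀ (by positivity), intervalIntegral.integral_of_le (by positivity)]
    simp [circleMap, Circle.coe_exp]
  have hc := hd.continuous
  have hprod : Integrable (Function.uncurry fun (z : CSpace n) (θ : ℝ) =>
      h ((Circle.exp θ : ℂ) • z)) ((gaussian n).prod (volume.restrict (Set.Ioc 0 (2 * Real.pi)))) := by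
    rw [integrable_prod_iff' (Continuous.aestronglyMeasurable (by
      simp only [Function.uncurry_def]; fun_prop))]
    refine ⟨Eventually.of_forall fun θ => ?_, ?_⟩
    · exact ((hrot θ).integrable_comp_emb (hemb θ)).2 hi
    · have : ∀ θ : ℝ, ∫ z, ‖Function.uncurry (fun (z : CSpace n) (θ : ℝ) =>
          h ((Circle.exp θ : ℂ) • z)) (z, θ)‖ ∂gaussian n = ∫ z, ‖h z‖ ∂gaussian n := fun θ =>
        (hrot θ).integral_comp (hemb θ) fun z => ‖h z‖
      simp_rw [this]
      exact integrable_const _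
  have hswap := integral_integral_swap hprod
  simp_rw [hcirc] at hswap
  have hθ : ∀ θ : ℝ, ∫ z, h ((Circle.exp θ : ℂ) • z) ∂gaussian n = ∫ z, h z ∂gaussian n := fun θ =>
    (hrot θ).integral_comp (hemb θ) h
  simp_rw [hθ] at hswap
  rw [integral_const, integral_const, probReal_univ, one_smul, measureReal_restrict_apply_univ,
    Real.volume_real_Ioc_of_le (by positivity), sub_zero] at hswap
  exact (smul_right_injective ℂ (show (2 * Real.pi : ℝ) ≠ 0 by positivity) hswap).symm

/-- The bilinear pairing `w₁ z₁ + ⋯ + w_n z_n`. -/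
def pairing (w z : CSpace n) : ℂ := ∑ j, ∑ i, w j i * z j i

lemma continuous_pairing (w : CSpace n) : Continuous (pairing w) := by
  unfold pairing; fun_prop

lemma norm_pairing_le (w z : CSpace n) :
    ‖pairing w z‖ ≤ ∑ j, ∑ i, ‖w j i‖ ^ 2 + (1 / 4) * ∑ j, ∑ i, ‖z j i‖ ^ 2 := by
  rw [Finset.mul_sum, ← Finset.sum_add_distrib]
  refine (norm_sum_le _ _).trans (Finset.sum_le_sum fun j _ => ?_)
  rw [Finset.mul_sum, ← Finset.sum_add_distrib]
  refine (norm_sum_le _ _).trans (Finset.sum_le_sum fun i _ => ?_)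
  rw [norm_mul]
  nlinarith [sq_nonneg (‖w j i‖ - ‖z j i‖ / 2)]

lemma memLp_exp_quarter_norm_sq :
    MemLp (fun z : CSpace n => Real.exp ((1 / 4) * ∑ j, ∑ i, ‖z j i‖ ^ 2)) 2 (gaussian n) := by
  rw [memLp_two_iff_integrable_sq_norm (Continuous.aestronglyMeasurable (by fun_prop))]
  have h1 : Integrable (fun z : ℂ => Real.exp ((1 / 2) * ‖z‖ ^ 2)) (gaussMoment 0) := by
    have h : Integrable (fun x : ℝ => Real.exp ((1 / 2) * x))
        ((gaussMoment 0).map fun z => ‖z‖ ^ 2) := by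
      rw [map_norm_sq_gaussMoment, integrable_gammaNat_iff]
      refine (integrableOn_pow_mul_exp_neg_mul 0 (b := 1 / 2) (by norm_num)).congr_fun
        (fun x _ => ?_) measurableSet_Ioi
      simp only [gammaDensity, pow_zero, one_mul, Nat.factorial_zero, Nat.cast_one, div_one,
        smul_eq_mul, ← Real.exp_add]
      ring_nf
    exact h.comp_measurable (by fun_prop)
  have h2 := Integrable.fintype_prod_dep (μ := fun j => Measure.pi fun _ : Fin (n j) => gaussMoment 0)
    (f := fun j (x : Fin (n j) → ℂ) => ∏ i, Real.exp ((1 / 2) * ‖x i‖ ^ 2))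
    fun j => Integrable.fintype_prod (f := fun _ (z : ℂ) => Real.exp ((1 / 2) * ‖z‖ ^ 2)) fun _ => h1
  rw [pi_gaussMoment_zero] at h2
  refine h2.congr (Eventually.of_forall fun z => ?_)
  simp only [← Real.exp_sum]
  rw [Real.norm_of_nonneg (Real.exp_pos _).le, ← Real.exp_nat_mul, Finset.mul_sum, Finset.mul_sum]
  congr 1
  refine Finset.sum_congr rfl fun j _ => ?_
  rw [← Finset.mul_sum]
  push_cast
  ring

lemma integrable_mul_exp_norm_pairing {g : CSpace n → ℂ} (hg : MemLp g 2 (gaussian n))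
    (w : CSpace n) : Integrable (fun z => ‖g z‖ * Real.exp ‖pairing w z‖) (gaussian n) := by
  have hc := continuous_pairing w
  have h := (MemLp.integrable_mul hg.norm memLp_exp_quarter_norm_sq).const_mul
    (Real.exp (∑ j, ∑ i, ‖w j i‖ ^ 2))
  refine h.mono' (hg.1.norm.mul (Continuous.aestronglyMeasurable (by fun_prop)))
    (Eventually.of_forall fun z => ?_)
  rw [Real.norm_of_nonneg (by positivity), Pi.mul_apply, mul_left_comm, ← Real.exp_add]
  gcongr
  exact norm_pairing_le w z

lemma norm_pairing_conj (w z : CSpace n) :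
    ‖pairing w (fun j i => (starRingEnd ℂ) (z j i))‖
      = ‖pairing (fun j i => (starRingEnd ℂ) (w j i)) z‖ := by
  rw [← Complex.norm_conj]
  simp [pairing, map_sum]

lemma integrable_mul_exp_pairing {g : CSpace n → ℂ} (hg : MemLp g 2 (gaussian n))
    (w : CSpace n) : Integrable (fun z =>
      g z * Complex.exp (pairing w fun j i => (starRingEnd ℂ) (z j i))) (gaussian n) := by
  have hc := continuous_pairing w
  refine (integrable_mul_exp_norm_pairing hg fun j i => (starRingEnd ℂ) (w j i)).mono'
    (hg.1.mul (Continuous.aestronglyMeasurable (by fun_prop))) (Eventually.of_forall fun z => ?_)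
  rw [norm_mul, ← norm_pairing_conj]
  gcongr
  exact Complex.norm_exp_le_exp_norm _

/-- The reproducing property of the kernel `exp(w · z̄)`: translation by `w` turns it into the mean
value property of `z ↦ g(z + w) exp(-z · w̄)`. -/
lemma integral_mul_exp_pairing {g : CSpace n → ℂ} (hd : Differentiable ℂ g)
    (hg : MemLp g 2 (gaussian n)) (w : CSpace n) :
    ∫ z, g z * Complex.exp (pairing w fun j i => (starRingEnd ℂ) (z j i)) ∂gaussian n = g w := by
  set h : CSpace n → ℂ := fun z =>
    g (z + w) * Complex.exp (-pairing (fun j i => (starRingEnd ℂ) (w j i)) z) with hh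
  have hhd : Differentiable ℂ h := by
    simp only [hh, pairing]
    fun_prop
  set F : CSpace n → ℂ := fun z =>
    ((Real.pi ^ (∑ j, n j))⁻¹ * Real.exp (-∑ j, ∑ i, ‖z j i‖ ^ 2)) •
      (g z * Complex.exp (pairing w fun j i => (starRingEnd ℂ) (z j i))) with hF
  have hFi : Integrable F := integrable_gaussian_iff.1 (integrable_mul_exp_pairing hg w)
  have key : ∀ z, ((Real.pi ^ (∑ j, n j))⁻¹ * Real.exp (-∑ j, ∑ i, ‖z j i‖ ^ 2)) • h z
      = F (z + w) := by
    intro z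
    have e : ((-∑ j, ∑ i, ‖z j i‖ ^ 2 : ℝ) : ℂ) + -pairing (fun j i => (starRingEnd ℂ) (w j i)) z
        = ((-∑ j, ∑ i, ‖(z + w) j i‖ ^ 2 : ℝ) : ℂ)
          + pairing w (fun j i => (starRingEnd ℂ) ((z + w) j i)) := by
      simp only [pairing]
      push_cast
      simp only [← Finset.sum_neg_distrib, ← Finset.sum_add_distrib]
      refine Finset.sum_congr rfl fun j _ => Finset.sum_congr rfl fun i _ => ?_
      rw [← Complex.mul_conj', ← Complex.mul_conj']
      simp only [Pi.add_apply, map_add]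
      ring
    have e' := congrArg Complex.exp e
    rw [Complex.exp_add, Complex.exp_add] at e'
    simp only [hF, hh, Complex.real_smul]
    push_cast at e' ⊢
    linear_combination (((Real.pi : ℂ) ^ (∑ j, n j))⁻¹ * g (z + w)) * e'
  have hi : Integrable h (gaussian n) := by
    rw [integrable_gaussian_iff]
    simp_rw [key]
    exact hFi.comp_add_right w
  have h0 := integral_gaussian_eq_apply_zero hhd hi
  rw [integral_gaussian] at h0
  simp_rw [key] at h0
  rw [integral_add_right_eq_self] at h0
  rw [integral_gaussian]
  change ∫ z, F z = g w
  rw [h0]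
  simp [hh, pairing]

/-! ### Completeness of the monomials -/

lemma mul_coord_mem_span_monomialFun {p : CSpace n → ℂ}
    (hp : p ∈ Submodule.span ℂ (Set.range (monomialFun n))) (j : Fin k) (i : Fin (n j)) :
    (fun z => z j i * p z) ∈ Submodule.span ℂ (Set.range (monomialFun n)) := by
  classical
  induction hp using Submodule.span_induction with
  | mem p hp =>
    obtain ⟨α, rfl⟩ := hp
    refine Submodule.subset_span ⟨Function.update α j (Function.update (α j) i (α j i + 1)), ?_⟩
    funext z
    rw [monomialFun, monomialFun, ← Finset.mul_prod_erase _ _ (Finset.mem_univ j),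
      ← Finset.mul_prod_erase Finset.univ (fun j => ∏ i, z j i ^ α j i) (Finset.mem_univ j),
      ← mul_assoc]
    congr 1
    · rw [← Finset.mul_prod_erase _ _ (Finset.mem_univ i),
        ← Finset.mul_prod_erase Finset.univ (fun i => z j i ^ α j i) (Finset.mem_univ i),
        ← mul_assoc, Function.update_self, Function.update_self, pow_succ']
      congr 1
      refine Finset.prod_congr rfl fun i' hi' => ?_
      rw [Function.update_of_ne (Finset.ne_of_mem_erase hi')]
    · refine Finset.prod_congr rfl fun j' hj' => ?_
      rw [Function.update_of_ne (Finset.ne_of_mem_erase hj')]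
  | zero =>
    have : (fun z : CSpace n => z j i * (0 : CSpace n → ℂ) z) = 0 := by
      funext z; simp
    rw [this]
    exact Submodule.zero_mem _
  | add p q _ _ hp hq =>
    have : (fun z : CSpace n => z j i * (p + q) z)
        = (fun z => z j i * p z) + fun z => z j i * q z := by
      funext z; simp [mul_add]
    rw [this]
    exact Submodule.add_mem _ hp hq
  | smul c p _ hp =>
    have : (fun z : CSpace n => z j i * (c • p) z) = c • fun z => z j i * p z := by
      funext z; simp [mul_left_comm]
    rw [this]
    exact Submodule.smul_mem _ c hp

lemma pairing_pow_mem_span_monomialFun (w : CSpace n) (d : ℕ) :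
    (fun z => pairing w z ^ d) ∈ Submodule.span ℂ (Set.range (monomialFun n)) := by
  induction d with
  | zero => exact Submodule.subset_span ⟨0, by funext z; simp [monomialFun]⟩
  | succ d ih =>
    have : (fun z : CSpace n => pairing w z ^ (d + 1))
        = ∑ j, ∑ i, w j i • fun z : CSpace n => z j i * pairing w z ^ d := by
      funext z
      simp only [Finset.sum_apply, Pi.smul_apply, smul_eq_mul, ← mul_assoc]
      simp only [← Finset.sum_mul]
      rw [pow_succ', ← pairing]
    rw [this]
    exact Submodule.sum_mem _ fun j _ => Submodule.sum_mem _ fun i _ =>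
      Submodule.smul_mem _ _ (mul_coord_mem_span_monomialFun ih j i)

lemma integral_mul_conj_eq_zero_of_mem_span {g : CSpace n → ℂ} (hg : MemLp g 2 (gaussian n))
    (h : ∀ α, ∫ z, g z * (starRingEnd ℂ) (monomialFun n α z) ∂gaussian n = 0) {p : CSpace n → ℂ}
    (hp : p ∈ Submodule.span ℂ (Set.range (monomialFun n))) :
    MemLp p 2 (gaussian n) ∧ ∫ z, g z * (starRingEnd ℂ) (p z) ∂gaussian n = 0 := by
  have hint : ∀ q : CSpace n → ℂ, MemLp q 2 (gaussian n) →
      Integrable (fun z => g z * (starRingEnd ℂ) (q z)) (gaussian n) := fun q hq =>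
    MemLp.integrable_mul hg hq.star
  induction hp using Submodule.span_induction with
  | mem p hp =>
    obtain ⟨α, rfl⟩ := hp
    exact ⟨memLp_monomialFun α, h α⟩
  | zero => exact ⟨MemLp.zero, by simp⟩
  | add p q _ _ hp hq =>
    refine ⟨hp.1.add hq.1, ?_⟩
    simp only [Pi.add_apply, map_add, mul_add]
    rw [integral_add (hint p hp.1) (hint q hq.1), hp.2, hq.2, add_zero]
  | smul c p _ hp =>
    refine ⟨hp.1.const_smul c, ?_⟩
    have e : ∀ z, g z * (starRingEnd ℂ) ((c • p) z)
        = (starRingEnd ℂ) c * (g z * (starRingEnd ℂ) (p z)) := fun z => by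
      rw [Pi.smul_apply, smul_eq_mul, map_mul]; ring
    simp_rw [e]
    rw [integral_const_mul, hp.2, mul_zero]

/-- An entire function that is orthogonal to all monomials vanishes: the reproducing kernel is a
series of polynomials. -/
lemma eq_zero_of_forall_integral_monomialFun {g : CSpace n → ℂ} (hd : Differentiable ℂ g)
    (hg : MemLp g 2 (gaussian n))
    (h : ∀ α, ∫ z, g z * (starRingEnd ℂ) (monomialFun n α z) ∂gaussian n = 0) : g = 0 := by
  funext w
  set s : CSpace n → ℂ := fun z => pairing w fun j i => (starRingEnd ℂ) (z j i) with hs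
  have hsc : Continuous s := (continuous_pairing w).comp (by fun_prop)
  have hterm : ∀ d : ℕ, ∫ z, g z * (s z ^ d / (d.factorial : ℂ)) ∂gaussian n = 0 := by
    intro d
    have h1 := (integral_mul_conj_eq_zero_of_mem_span hg h
      (pairing_pow_mem_span_monomialFun (fun j i => (starRingEnd ℂ) (w j i)) d)).2
    have h2 : ∀ z : CSpace n, (starRingEnd ℂ) (pairing (fun j i => (starRingEnd ℂ) (w j i)) z ^ d)
        = s z ^ d := fun z => by simp [hs, pairing, map_sum]
    simp_rw [h2] at h1
    simp_rw [← mul_div_assoc]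
    rw [integral_div, h1, zero_div]
  have hexp : ∀ x : ℝ, HasSum (fun d : ℕ => x ^ d / (d.factorial : ℝ)) (Real.exp x) := fun x => by
    rw [Real.exp_eq_exp_ℝ]
    exact NormedSpace.expSeries_div_hasSum_exp x
  have hsum := hasSum_integral_of_dominated_convergence (μ := gaussian n)
    (F := fun (d : ℕ) z => g z * (s z ^ d / (d.factorial : ℂ)))
    (f := fun z => g z * Complex.exp (s z))
    (fun d z => ‖g z‖ * (‖s z‖ ^ d / (d.factorial : ℝ)))
    (fun d => hg.1.mul (Continuous.aestronglyMeasurable (by fun_prop)))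
    (fun d => Eventually.of_forall fun z => by simp)
    (Eventually.of_forall fun z => ((hexp ‖s z‖).mul_left _).summable)
    (by
      have e : ∀ z, ∑' d : ℕ, ‖g z‖ * (‖s z‖ ^ d / (d.factorial : ℝ))
          = ‖g z‖ * Real.exp ‖pairing (fun j i => (starRingEnd ℂ) (w j i)) z‖ := fun z => by
        rw [((hexp ‖s z‖).mul_left _).tsum_eq, ← norm_pairing_conj]
      simp_rw [e]
      exact integrable_mul_exp_norm_pairing hg _)
    (Eventually.of_forall fun z => by
      have := NormedSpace.expSeries_div_hasSum_exp (s z)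
      rw [← Complex.exp_eq_exp_ℂ] at this
      exact this.mul_left _)
  simp_rw [hterm] at hsum
  rw [integral_mul_exp_pairing hd hg w] at hsum
  exact hsum.unique hasSum_zero

/-! ### Diagonal operators -/

section Diagonal

variable {ι H : Type*} [NormedAddCommGroup H] [InnerProductSpace ℂ H]

lemma hilbertBasis_ext_inner (b : HilbertBasis ι ℂ H) {x y : H}
    (h : ∀ i, inner ℂ (b i) x = inner ℂ (b i) y) : x = y := by
  apply b.repr.injective
  ext i
  rw [b.repr_apply_apply, b.repr_apply_apply, h]

lemma adjoint_apply_hilbertBasis [CompleteSpace H] (b : HilbertBasis ι ℂ H) {T : H →L[ℂ] H} {c : ι → ℂ}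
    (hT : ∀ i, T (b i) = c i • b i) (i : ι) :
    ContinuousLinearMap.adjoint T (b i) = (starRingEnd ℂ) (c i) • b i := by
  classical
  refine hilbertBasis_ext_inner b fun j => ?_
  rw [ContinuousLinearMap.adjoint_inner_right, hT, inner_smul_left, inner_smul_right,
    orthonormal_iff_ite.1 b.orthonormal]
  by_cases h : j = i
  · subst h; simp
  · simp [h]

lemma hasSum_norm_inner_sq (b : HilbertBasis ι ℂ H) (x : H) :
    HasSum (fun i => ‖inner ℂ (b i) x‖ ^ 2) (‖x‖ ^ 2) := by
  have h := lp.hasSum_norm (p := 2) (by norm_num) (b.repr x)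
  simp only [ENNReal.toReal_ofNat, b.repr.norm_map, b.repr_apply_apply] at h
  exact_mod_cast h

/-- A diagonal operator is bounded by the supremum of its eigenvalues. -/
lemma opNorm_le_of_diagonal [CompleteSpace H] (b : HilbertBasis ι ℂ H) {T : H →L[ℂ] H} {c : ι → ℂ}
    (hT : ∀ i, T (b i) = c i • b i) {M : ℝ} (hM0 : 0 ≤ M) (hM : ∀ i, ‖c i‖ ≤ M) : ‖T‖ ≤ M := by
  refine T.opNorm_le_bound hM0 fun x => ?_
  have hi : ∀ i, inner ℂ (b i) (T x) = c i * inner ℂ (b i) x := fun i => by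
    rw [← ContinuousLinearMap.adjoint_inner_left, adjoint_apply_hilbertBasis b hT, inner_smul_left,
      RingHomCompTriple.comp_apply, RingHom.id_apply]
  have h1 := hasSum_norm_inner_sq b (T x)
  have h2 := (hasSum_norm_inner_sq b x).mul_left (M ^ 2)
  have h3 : ‖T x‖ ^ 2 ≤ M ^ 2 * ‖x‖ ^ 2 := by
    refine hasSum_le (fun i => ?_) h1 h2
    rw [hi, norm_mul, mul_pow]
    gcongr
    exact hM i
  rw [← mul_pow] at h3
  exact le_of_sq_le_sq h3 (by positivity)

end Diagonal

/-! ### The monomial basis of the Fock space -/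

lemma differentiable_monomialFun (α : (j : Fin k) → Fin (n j) → ℕ) :
    Differentiable ℂ (monomialFun n α) := by
  unfold monomialFun
  fun_prop

/-- The monomial `z ^ α` as an element of the Fock space. -/
def monomialVec (α : (j : Fin k) → Fin (n j) → ℕ) : Fock n :=
  (⟨(memLp_monomialFun α).toLp, monomialFun n α, differentiable_monomialFun α,
    MemLp.coeFn_toLp _⟩ : fockSubmodule n)

lemma coeFn_incl_monomialVec (α : (j : Fin k) → Fin (n j) → ℕ) :
    ⇑(Fock.incl n (monomialVec α)) =ᵐ[gaussian n] monomialFun n α :=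
  MemLp.coeFn_toLp (memLp_monomialFun α)

lemma Fock.ext_ae {f h : Fock n} (hfh : ⇑(Fock.incl n f) =ᵐ[gaussian n] ⇑(Fock.incl n h)) :
    f = h :=
  Subtype.ext (Lp.ext hfh)

lemma Fock.inner_eq_integral (f h : Fock n) : inner ℂ f h
    = ∫ z, Fock.incl n h z * (starRingEnd ℂ) (Fock.incl n f z) ∂gaussian n :=
  L2.inner_def (𝕜 := ℂ) (Fock.incl n f) (Fock.incl n h)

lemma inner_toeplitz {φ : CSpace n → ℂ} (hφ : MemLp φ ∞ volume) (f h : Fock n) :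
    inner ℂ h (toeplitz n φ hφ f)
      = ∫ z, φ z * (Fock.incl n f z * (starRingEnd ℂ) (Fock.incl n h z)) ∂gaussian n := by
  have h1 : inner ℂ h (toeplitz n φ hφ f) = inner ℂ (Fock.incl n h)
      ((ContinuousLinearMap.mul ℂ ℂ).holderL (gaussian n) ∞ 2 2 (memLp_gaussian n hφ).toLp
        (Fock.incl n f)) :=
    Submodule.inner_orthogonalProjectionOnto_eq_of_mem_left (K := fockSubmodule n) h _
  rw [h1, L2.inner_def]
  refine integral_congr_ae ?_
  have h2 := (ContinuousLinearMap.mul ℂ ℂ).coeFn_holder (r := 2) (memLp_gaussian n hφ).toLp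
    (Fock.incl n f)
  filter_upwards [h2, (memLp_gaussian n hφ).coeFn_toLp] with z hz hz'
  have h3 : ((ContinuousLinearMap.mul ℂ ℂ).holderL (gaussian n) ∞ 2 2 (memLp_gaussian n hφ).toLp
        (Fock.incl n f)) z = φ z * Fock.incl n f z := by
    rw [← hz']
    exact hz
  rw [RCLike.inner_apply, h3, mul_assoc]

lemma inner_monomialVec (hn : ∀ j, 1 ≤ n j) (α β : (j : Fin k) → Fin (n j) → ℕ) [Decidable (α = β)] :
    inner ℂ (monomialVec β) (monomialVec α) = if α = β then (multiFactorial n α : ℂ) else 0 := by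
  rw [Fock.inner_eq_integral]
  have e : ∫ z, Fock.incl n (monomialVec α) z
        * (starRingEnd ℂ) (Fock.incl n (monomialVec β) z) ∂gaussian n
      = ∫ z, (fun _ => (1 : ℂ)) (sqRadii n z)
        * (monomialFun n α z * (starRingEnd ℂ) (monomialFun n β z)) ∂gaussian n := by
    refine integral_congr_ae ?_
    filter_upwards [coeFn_incl_monomialVec α, coeFn_incl_monomialVec β] with z h1 h2
    rw [h1, h2, one_mul]
  rw [e]
  split_ifs with h
  · subst h
    rw [integral_comp_sqRadii_mul_norm_sq hn measurable_const]
    simp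
  · exact integral_comp_sqRadii_mul_eq_zero (fun _ => 1) h

lemma Fock.eq_zero_of_forall_inner_monomialVec {f : Fock n}
    (h : ∀ α, inner ℂ (monomialVec α) f = 0) : f = 0 := by
  obtain ⟨g, hgd, hg⟩ : ∃ g : CSpace n → ℂ, Differentiable ℂ g ∧
      ⇑(Fock.incl n f) =ᵐ[gaussian n] g := f.2
  have hgm : MemLp g 2 (gaussian n) := (memLp_congr_ae hg).1 (Lp.memLp _)
  have hg0 : g = 0 := by
    refine eq_zero_of_forall_integral_monomialFun hgd hgm fun α => ?_
    rw [← h α, Fock.inner_eq_integral]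
    refine integral_congr_ae ?_
    filter_upwards [coeFn_incl_monomialVec α, hg] with z h1 h2
    rw [h1, h2]
  refine Fock.ext_ae ?_
  rw [hg0] at hg
  exact hg.trans (by rw [map_zero]; exact (Lp.coeFn_zero ℂ 2 (gaussian n)).symm)

/-- The normalized monomials `z ^ α / √(α!)` form a Hilbert basis of the Fock space. -/
lemma exists_hilbertBasis_monomialVec (hn : ∀ j, 1 ≤ n j) :
    ∃ b : HilbertBasis ((j : Fin k) → Fin (n j) → ℕ) ℂ (Fock n),
      ∀ α, b α = ((√(multiFactorial n α))⁻¹ : ℂ) • monomialVec α := by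
  classical
  have hpos : ∀ α : (j : Fin k) → Fin (n j) → ℕ, (√(multiFactorial n α) : ℂ) ≠ 0 := fun α => by
    exact_mod_cast (Real.sqrt_pos.2 (multiFactorial_pos α)).ne'
  have hon : Orthonormal ℂ fun α : (j : Fin k) → Fin (n j) → ℕ =>
      ((√(multiFactorial n α))⁻¹ : ℂ) • monomialVec α := by
    rw [orthonormal_iff_ite]
    intro α β
    rw [inner_smul_left, inner_smul_right, inner_monomialVec hn]
    by_cases h : α = β
    · subst h
      have h2 : (multiFactorial n α : ℂ) = (√(multiFactorial n α) : ℂ) * √(multiFactorial n α) := by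
        exact_mod_cast (Real.mul_self_sqrt (multiFactorial_pos α).le).symm
      rw [if_pos rfl, if_pos rfl, map_inv₀, Complex.conj_ofReal, h2]
      have := hpos α
      field_simp
    · rw [if_neg h, if_neg (Ne.symm h)]
      simp
  refine ⟨HilbertBasis.mkOfOrthogonalEqBot hon ?_, fun α => by
    rw [HilbertBasis.coe_mkOfOrthogonalEqBot]⟩
  rw [eq_bot_iff]
  intro f hf
  rw [Submodule.mem_bot]
  refine Fock.eq_zero_of_forall_inner_monomialVec fun α => ?_
  have h := (Submodule.mem_orthogonal _ _).1 hf _ (Submodule.subset_span ⟨α, rfl⟩)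
  rw [inner_smul_left, map_inv₀, Complex.conj_ofReal] at h
  exact (mul_eq_zero.1 h).resolve_left (inv_ne_zero (hpos α))

/-! ### Operators that are diagonal in the monomial basis -/

/-- `T` multiplies each monomial by a function of its degrees. -/
def IsMonomialDiagonal (T : Fock n →L[ℂ] Fock n) (γ : (Fin k → ℕ) → ℂ) : Prop :=
  ∀ α, T (monomialVec α) = γ (blockDegree α) • monomialVec α

/-- A Toeplitz operator with quasi-radial symbol is diagonal, and its eigenvalues are averages over
products of Gamma distributions. -/
lemma isMonomialDiagonal_toeplitz (hn : ∀ j, 1 ≤ n j) {φ : CSpace n → ℂ} (hφ : MemLp φ ∞ volume)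
    {a : (Fin k → ℝ) → ℂ} (ha : Measurable a) (hφa : φ =ᵐ[volume] a ∘ sqRadii n) :
    IsMonomialDiagonal (toeplitz n φ hφ)
      fun m => ∫ r, a r ∂gammaProd (fun j => n j - 1) m := by
  classical
  intro α
  rw [← sub_eq_zero]
  refine Fock.eq_zero_of_forall_inner_monomialVec fun β => ?_
  rw [inner_sub_right, inner_smul_right, inner_toeplitz, inner_monomialVec hn]
  have hφa' : φ =ᵐ[gaussian n] a ∘ sqRadii n := (withDensity_absolutelyContinuous _ _).ae_le hφa
  have e : ∫ z, φ z * (Fock.incl n (monomialVec α) z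
        * (starRingEnd ℂ) (Fock.incl n (monomialVec β) z)) ∂gaussian n
      = ∫ z, a (sqRadii n z)
        * (monomialFun n α z * (starRingEnd ℂ) (monomialFun n β z)) ∂gaussian n := by
    refine integral_congr_ae ?_
    filter_upwards [coeFn_incl_monomialVec α, coeFn_incl_monomialVec β, hφa'] with z h1 h2 h3
    rw [h1, h2, h3, Function.comp_apply]
  rw [e]
  split_ifs with h
  · subst h
    rw [integral_comp_sqRadii_mul_norm_sq hn ha]
    ring
  · rw [integral_comp_sqRadii_mul_eq_zero _ h]
    simp

/-- A multi-index with prescribed degrees. -/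
def stdIndex (hn : ∀ j, 1 ≤ n j) (m : Fin k → ℕ) : (j : Fin k) → Fin (n j) → ℕ :=
  fun j => Pi.single ⟨0, hn j⟩ (m j)

lemma blockDegree_stdIndex (hn : ∀ j, 1 ≤ n j) (m : Fin k → ℕ) :
    blockDegree (stdIndex hn m) = m := by
  funext j
  simp [blockDegree, stdIndex]

lemma isMonomialDiagonal_iff {b : HilbertBasis ((j : Fin k) → Fin (n j) → ℕ) ℂ (Fock n)}
    (hb : ∀ α, b α = ((√(multiFactorial n α))⁻¹ : ℂ) • monomialVec α)
    {T : Fock n →L[ℂ] Fock n} {γ : (Fin k → ℕ) → ℂ} :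
    IsMonomialDiagonal T γ ↔ ∀ α, T (b α) = γ (blockDegree α) • b α := by
  refine forall_congr' fun α => ?_
  have h : ((√(multiFactorial n α))⁻¹ : ℂ) ≠ 0 := inv_ne_zero <| by
    exact_mod_cast (Real.sqrt_pos.2 (multiFactorial_pos α)).ne'
  rw [hb, map_smul, smul_comm (γ _)]
  exact (smul_right_injective (Fock n) h).eq_iff.symm

lemma IsMonomialDiagonal.eq_inner (hn : ∀ j, 1 ≤ n j)
    {b : HilbertBasis ((j : Fin k) → Fin (n j) → ℕ) ℂ (Fock n)}
    (hb : ∀ α, b α = ((√(multiFactorial n α))⁻¹ : ℂ) • monomialVec α)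
    {T : Fock n →L[ℂ] Fock n} {γ : (Fin k → ℕ) → ℂ} (h : IsMonomialDiagonal T γ) (m : Fin k → ℕ) :
    γ m = inner ℂ (b (stdIndex hn m)) (T (b (stdIndex hn m))) := by
  rw [(isMonomialDiagonal_iff hb).1 h, inner_smul_right, blockDegree_stdIndex,
    inner_self_eq_norm_sq_to_K, b.orthonormal.1]
  simp

lemma IsMonomialDiagonal.unique (hn : ∀ j, 1 ≤ n j) {T : Fock n →L[ℂ] Fock n}
    {γ γ' : (Fin k → ℕ) → ℂ} (h : IsMonomialDiagonal T γ) (h' : IsMonomialDiagonal T γ') :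
    γ = γ' := by
  obtain ⟨b, hb⟩ := exists_hilbertBasis_monomialVec hn
  funext m
  rw [h.eq_inner hn hb, h'.eq_inner hn hb]

lemma IsMonomialDiagonal.star (hn : ∀ j, 1 ≤ n j) {T : Fock n →L[ℂ] Fock n}
    {γ : (Fin k → ℕ) → ℂ} (h : IsMonomialDiagonal T γ) :
    IsMonomialDiagonal (star T) fun m => (starRingEnd ℂ) (γ m) := by
  obtain ⟨b, hb⟩ := exists_hilbertBasis_monomialVec hn
  rw [isMonomialDiagonal_iff hb] at h ⊢
  exact adjoint_apply_hilbertBasis b h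

lemma IsMonomialDiagonal.norm_apply_le (hn : ∀ j, 1 ≤ n j) {T : Fock n →L[ℂ] Fock n}
    {γ : (Fin k → ℕ) → ℂ} (h : IsMonomialDiagonal T γ) (m : Fin k → ℕ) : ‖γ m‖ ≤ ‖T‖ := by
  obtain ⟨b, hb⟩ := exists_hilbertBasis_monomialVec hn
  rw [h.eq_inner hn hb]
  refine (norm_inner_le_norm _ _).trans ?_
  rw [b.orthonormal.1, one_mul]
  have := T.le_opNorm (b (stdIndex hn m))
  rwa [b.orthonormal.1, mul_one] at this

lemma IsMonomialDiagonal.opNorm_le (hn : ∀ j, 1 ≤ n j) {T : Fock n →L[ℂ] Fock n}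
    {γ : (Fin k → ℕ) → ℂ} (h : IsMonomialDiagonal T γ) {M : ℝ} (hM0 : 0 ≤ M)
    (hM : ∀ m, ‖γ m‖ ≤ M) : ‖T‖ ≤ M := by
  obtain ⟨b, hb⟩ := exists_hilbertBasis_monomialVec hn
  exact opNorm_le_of_diagonal b ((isMonomialDiagonal_iff hb).1 h) hM0 fun α => hM _

lemma IsMonomialDiagonal.sub {S T : Fock n →L[ℂ] Fock n} {γ δ : (Fin k → ℕ) → ℂ}
    (hS : IsMonomialDiagonal S γ) (hT : IsMonomialDiagonal T δ) :
    IsMonomialDiagonal (S - T) fun m => γ m - δ m := fun α => by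
  rw [sub_apply, hS, hT, sub_smul]

/-! ### Eigenvalue functions -/

lemma monomialVec_mem_homogeneousPart (α : (j : Fin k) → Fin (n j) → ℕ) :
    monomialVec α ∈ homogeneousPart n (blockDegree α) := by
  refine Submodule.subset_span ⟨fun j => MvPolynomial.monomial
    (Finsupp.equivFunOnFinite.symm (α j)) 1, fun j => ?_, ?_⟩
  · refine MvPolynomial.isHomogeneous_monomial _ ?_
    rw [Finsupp.degree_eq_sum]
    rfl
  · refine (coeFn_incl_monomialVec α).trans (Eventually.of_forall fun z => ?_)
    refine Finset.prod_congr rfl fun j _ => ?_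
    rw [MvPolynomial.eval_monomial, one_mul, Finsupp.prod_fintype _ _ (by simp)]
    rfl

lemma coeFn_incl_sum {ι : Type*} (s : Finset ι) (f : ι → Fock n) (g : ι → CSpace n → ℂ)
    (h : ∀ i ∈ s, ⇑(Fock.incl n (f i)) =ᵐ[gaussian n] g i) :
    ⇑(Fock.incl n (∑ i ∈ s, f i)) =ᵐ[gaussian n] fun z => ∑ i ∈ s, g i z := by
  classical
  induction s using Finset.induction_on with
  | empty =>
    simp only [Finset.sum_empty, map_zero]
    exact Lp.coeFn_zero ℂ 2 (gaussian n)
  | insert i s hi ih =>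
    simp only [Finset.sum_insert hi, map_add]
    refine (Lp.coeFn_add _ _).trans ?_
    filter_upwards [h i (Finset.mem_insert_self i s),
      ih fun j hj => h j (Finset.mem_insert_of_mem hj)] with z h1 h2
    rw [Pi.add_apply, h1, h2]

/-- A product of homogeneous polynomials is a linear combination of monomials with the same
degrees. -/
lemma homogeneousPart_le_span (m : Fin k → ℕ) : homogeneousPart n m
    ≤ Submodule.span ℂ {f | ∃ α, blockDegree α = m ∧ f = monomialVec α} := by
  classical
  refine Submodule.span_le.2 ?_
  rintro f ⟨p, hp, hf⟩
  set s := Fintype.piFinset fun j => (p j).support with hs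
  have hfs : f = ∑ d ∈ s, (∏ j, MvPolynomial.coeff (d j) (p j)) •
      monomialVec fun j i => d j i := by
    refine Fock.ext_ae (hf.trans (EventuallyEq.symm ?_))
    refine (coeFn_incl_sum s _ (fun d z => (∏ j, MvPolynomial.coeff (d j) (p j)) *
      monomialFun n (fun j i => d j i) z) fun d _ => ?_).trans (Eventually.of_forall fun z => ?_)
    · rw [map_smul]
      refine (Lp.coeFn_smul _ _).trans ?_
      filter_upwards [coeFn_incl_monomialVec fun j i => d j i] with z hz
      rw [Pi.smul_apply, hz, smul_eq_mul]
    · simp only [MvPolynomial.eval_eq']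
      rw [Finset.prod_univ_sum]
      refine Finset.sum_congr rfl fun d _ => ?_
      rw [monomialFun, ← Finset.prod_mul_distrib]
  rw [hfs]
  refine Submodule.sum_mem _ fun d hd => Submodule.smul_mem _ _ (Submodule.subset_span ⟨_, ?_, rfl⟩)
  funext j
  have hd' : d j ∈ (p j).support := Fintype.mem_piFinset.1 hd j
  have := hp j (MvPolynomial.mem_support_iff.1 hd')
  rw [← this, blockDegree, Finsupp.weight_apply, Finsupp.sum_fintype _ _ (by simp)]
  simp

lemma isEigenvalueFunction_iff {T : Fock n →L[ℂ] Fock n} {γ : (Fin k → ℕ) → ℂ} :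
    IsEigenvalueFunction n T γ ↔ IsMonomialDiagonal T γ := by
  constructor
  · exact fun h α => h _ _ (monomialVec_mem_homogeneousPart α)
  · intro h m f hf
    have key : Submodule.span ℂ {f | ∃ α, blockDegree α = m ∧ f = monomialVec α}
        ≤ LinearMap.eqLocus (T : Fock n →ₗ[ℂ] Fock n) (γ m • LinearMap.id) := by
      refine Submodule.span_le.2 ?_
      rintro _ ⟨α, rfl, rfl⟩
      exact h α
    exact key (homogeneousPart_le_span m hf)

/-! ### The algebra of diagonal operators with symbols in `C_{b,u}` -/

lemma coe_algebraMap_Cbu_apply (c : ℂ) (m : Fin k → ℕ) : (algebraMap ℂ (Cbu k) c).1 m = c := by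
  change (algebraMap ℂ (LInfty k) c) m = c
  rw [Algebra.algebraMap_eq_smul_one, lp.coeFn_smul, lp.infty_coeFn_one]
  simp

/-- The operators that multiply each monomial by a function in `C_{b,u}` of its degrees. -/
def diagonalAlgebra (hn : ∀ j, 1 ≤ n j) : StarSubalgebra ℂ (Fock n →L[ℂ] Fock n) where
  carrier := {T | ∃ σ : Cbu k, IsMonomialDiagonal T σ.1}
  mul_mem' := by
    rintro S T ⟨σ, hS⟩ ⟨τ, hT⟩
    refine ⟨σ * τ, fun α => ?_⟩
    rw [mul_apply_eq_comp, hT, map_smul, hS, smul_smul, mul_comm]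
    rfl
  add_mem' := by
    rintro S T ⟨σ, hS⟩ ⟨τ, hT⟩
    refine ⟨σ + τ, fun α => ?_⟩
    rw [add_apply, hS, hT, ← add_smul]
    rfl
  algebraMap_mem' c := by
    refine ⟨algebraMap ℂ _ c, fun α => ?_⟩
    rw [coe_algebraMap_Cbu_apply, Algebra.algebraMap_eq_smul_one]
    rfl
  star_mem' := by
    rintro T ⟨σ, hT⟩
    exact ⟨star σ, hT.star hn⟩

/-- The eigenvalues are matrix coefficients, so being diagonal passes to limits; the eigenvalue
functions converge uniformly, which preserves uniform continuity. -/
lemma isClosed_diagonalAlgebra (hn : ∀ j, 1 ≤ n j) :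
    IsClosed (diagonalAlgebra hn : Set (Fock n →L[ℂ] Fock n)) := by
  obtain ⟨b, hb⟩ := exists_hilbertBasis_monomialVec hn
  refine isClosed_of_closure_subset fun T hT => ?_
  set γ : (Fin k → ℕ) → ℂ := fun m => inner ℂ (b (stdIndex hn m)) (T (b (stdIndex hn m))) with hγ
  have hdiag : IsMonomialDiagonal T γ := by
    rw [isMonomialDiagonal_iff hb]
    intro α
    have hclosed : IsClosed {T : Fock n →L[ℂ] Fock n | T (b α) =
        (inner ℂ (b (stdIndex hn (blockDegree α))) (T (b (stdIndex hn (blockDegree α)))) : ℂ) •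
          b α} :=
      isClosed_eq (by fun_prop) (by fun_prop)
    refine closure_minimal ?_ hclosed hT
    rintro S ⟨σ, hS⟩
    rw [Set.mem_ofPred_eq, ← hS.eq_inner hn hb]
    exact (isMonomialDiagonal_iff hb).1 hS α
  have hmem : Memℓp γ ∞ :=
    memℓp_infty ⟨‖T‖, by rintro _ ⟨m, rfl⟩; exact hdiag.norm_apply_le hn m⟩
  refine ⟨⟨⟨γ, hmem⟩, fun ε hε => ?_⟩, hdiag⟩
  obtain ⟨S, ⟨σ, hS⟩, hST⟩ := Metric.mem_closure_iff.1 hT (ε / 3) (by positivity)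
  rw [dist_eq_norm] at hST
  obtain ⟨δ, hδ, H⟩ := σ.2 (ε / 3) (by positivity)
  refine ⟨δ, hδ, fun m m' hm => ?_⟩
  have h1 := ((hdiag.sub hS).norm_apply_le hn m).trans_lt hST
  have h2 := ((hdiag.sub hS).norm_apply_le hn m').trans_lt hST
  have h3 := H m m' hm
  rw [norm_sub_rev] at h2
  calc ‖γ m - γ m'‖ = ‖(γ m - σ.1 m) + (σ.1 m - σ.1 m') + (σ.1 m' - γ m')‖ := by
        congr 1; ring
    _ ≤ ‖γ m - σ.1 m‖ + ‖σ.1 m - σ.1 m'‖ + ‖σ.1 m' - γ m'‖ := norm_add₃_le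
    _ < ε := by linarith

/-- A quasi-radial Toeplitz operator has an eigenvalue function, given by averages over products of
Gamma distributions. -/
lemma exists_isMonomialDiagonal_of_mem (hn : ∀ j, 1 ≤ n j) {T : Fock n →L[ℂ] Fock n}
    (hT : T ∈ quasiRadialToeplitz n) : ∃ σ : Cbu k, IsMonomialDiagonal T σ.1 := by
  obtain ⟨φ, hφ, rfl⟩ := hT
  obtain ⟨a, ha, ⟨M, hM⟩, hφa⟩ := hφ.exists_ae_eq_comp_sqRadii hn
  obtain ⟨σ, hσ⟩ := exists_mem_Cbu_eq_integral (fun j => n j - 1) ha hM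
  refine ⟨σ, fun α => ?_⟩
  rw [hσ]
  exact isMonomialDiagonal_toeplitz hn hφ.memLp ha hφa α

lemma mem_eigenvalueFunctions_of_mem_gammaAverages (hn : ∀ j, 1 ≤ n j) {σ : LInfty k}
    (hσ : σ ∈ gammaAverages fun j => n j - 1) : ⇑σ ∈ eigenvalueFunctions n := by
  obtain ⟨a, ha, ⟨M, hM⟩, h⟩ := hσ
  have hφ : IsQuasiRadial n (a ∘ sqRadii n) := isQuasiRadial_comp_sqRadii ha hM
  refine ⟨_, ⟨_, hφ, rfl⟩, ?_⟩
  rw [isEigenvalueFunction_iff, funext h]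
  exact isMonomialDiagonal_toeplitz hn hφ.memLp ha EventuallyEq.rfl

lemma dense_eigenvalueFunctions (hn : ∀ j, 1 ≤ n j) :
    Dense {σ : Cbu k | ⇑σ.1 ∈ eigenvalueFunctions n} := by
  intro σ
  rw [Metric.mem_closure_iff]
  intro ε hε
  have h : σ.1 ∈ closure (gammaAverages fun j => n j - 1 : Set (LInfty k)) :=
    mem_closure_gammaAverages _ σ.2
  obtain ⟨τ, hτ, hd⟩ := Metric.mem_closure_iff.1 h ε hε
  obtain ⟨a, ha, ⟨M, hM⟩, hτa⟩ := id hτ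
  obtain ⟨τ', hτ'⟩ := exists_mem_Cbu_eq_integral (fun j => n j - 1) ha hM
  have e : τ'.1 = τ := lp.ext (funext fun m => (hτ' m).trans (hτa m).symm)
  refine ⟨τ', ?_, ?_⟩
  · rw [Set.mem_ofPred_eq, e]
    exact mem_eigenvalueFunctions_of_mem_gammaAverages hn hτ
  · rw [Subtype.dist_eq, e]
    exact hd

lemma toeplitzAlgebra_le_diagonalAlgebra (hn : ∀ j, 1 ≤ n j) :
    toeplitzAlgebra n ≤ diagonalAlgebra hn :=
  StarSubalgebra.topologicalClosure_minimal
    (StarAlgebra.adjoin_le fun _ hT => exists_isMonomialDiagonal_of_mem hn hT)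
    (isClosed_diagonalAlgebra hn)

/-- The eigenvalue function of a diagonal operator. -/
def diagonalSymbol {hn : ∀ j, 1 ≤ n j} (T : diagonalAlgebra hn) : Cbu k := T.2.choose

lemma isMonomialDiagonal_diagonalSymbol {hn : ∀ j, 1 ≤ n j} (T : diagonalAlgebra hn) :
    IsMonomialDiagonal T.1 (diagonalSymbol T).1 := T.2.choose_spec

lemma diagonalSymbol_eq {hn : ∀ j, 1 ≤ n j} {T : diagonalAlgebra hn} {σ : Cbu k}
    (h : IsMonomialDiagonal T.1 σ.1) : diagonalSymbol T = σ :=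
  Subtype.ext (lp.ext ((isMonomialDiagonal_diagonalSymbol T).unique hn h))

/-- The *-homomorphism that sends a diagonal operator to its eigenvalue function. -/
def diagonalSymbolHom (hn : ∀ j, 1 ≤ n j) : diagonalAlgebra hn →⋆ₐ[ℂ] Cbu k where
  toFun := diagonalSymbol
  map_one' := diagonalSymbol_eq fun α => (one_smul ℂ (monomialVec α)).symm
  map_mul' S T := diagonalSymbol_eq fun α => by
    change S.1 (T.1 _) = _
    rw [isMonomialDiagonal_diagonalSymbol T, map_smul, isMonomialDiagonal_diagonalSymbol S,
      smul_smul, mul_comm]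
    rfl
  map_zero' := diagonalSymbol_eq fun α => (zero_smul ℂ (monomialVec α)).symm
  map_add' S T := diagonalSymbol_eq fun α => by
    change S.1 _ + T.1 _ = _
    rw [isMonomialDiagonal_diagonalSymbol T, isMonomialDiagonal_diagonalSymbol S, ← add_smul]
    rfl
  commutes' c := diagonalSymbol_eq fun α => by
    rw [coe_algebraMap_Cbu_apply, Algebra.algebraMap_eq_smul_one]
    rfl
  map_star' T := diagonalSymbol_eq ((isMonomialDiagonal_diagonalSymbol T).star hn)

lemma isometry_diagonalSymbolHom (hn : ∀ j, 1 ≤ n j) : Isometry (diagonalSymbolHom hn) := by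
  refine AddMonoidHomClass.isometry_of_norm (diagonalSymbolHom hn) fun T => ?_
  have hT := isMonomialDiagonal_diagonalSymbol T
  refine le_antisymm ?_ ?_
  · exact lp.norm_le_of_forall_le (norm_nonneg _) fun m => hT.norm_apply_le hn m
  · exact hT.opNorm_le hn (norm_nonneg _) fun m =>
      lp.norm_apply_le_norm ENNReal.top_ne_zero (diagonalSymbol T).1 m

/-- The *-homomorphism from the Toeplitz algebra to `C_{b,u}` that sends an operator to its
eigenvalue function. -/
def toeplitzSymbolHom (hn : ∀ j, 1 ≤ n j) : toeplitzAlgebra n →⋆ₐ[ℂ] Cbu k :=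
  (diagonalSymbolHom hn).comp (StarSubalgebra.inclusion (toeplitzAlgebra_le_diagonalAlgebra hn))

lemma isometry_toeplitzSymbolHom (hn : ∀ j, 1 ≤ n j) : Isometry (toeplitzSymbolHom hn) :=
  (isometry_diagonalSymbolHom hn).comp fun _ _ => rfl

lemma isMonomialDiagonal_toeplitzSymbolHom (hn : ∀ j, 1 ≤ n j) (T : toeplitzAlgebra n) :
    IsMonomialDiagonal T.1 (toeplitzSymbolHom hn T).1 :=
  isMonomialDiagonal_diagonalSymbol (hn := hn)
    (StarSubalgebra.inclusion (toeplitzAlgebra_le_diagonalAlgebra hn) T)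

/-- The range is closed, since the Toeplitz algebra is complete, and it contains the dense set of
eigenvalue functions of Toeplitz operators. -/
lemma surjective_toeplitzSymbolHom (hn : ∀ j, 1 ≤ n j) :
    Function.Surjective (toeplitzSymbolHom hn) := by
  have hc : IsClosed (toeplitzAlgebra n : Set (Fock n →L[ℂ] Fock n)) :=
    StarSubalgebra.isClosed_topologicalClosure _
  have : CompleteSpace (toeplitzAlgebra n) := hc.completeSpace_coe
  have hr : IsClosed (Set.range (toeplitzSymbolHom hn)) :=
    (isometry_toeplitzSymbolHom hn).isClosedEmbedding.isClosed_range
  rw [← Set.range_eq_univ, ← hr.closure_eq]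
  refine ((dense_eigenvalueFunctions hn).mono ?_).closure_eq
  rintro σ ⟨T, hT, hσ⟩
  have hTA : T ∈ toeplitzAlgebra n :=
    StarSubalgebra.le_topologicalClosure _ (StarAlgebra.subset_adjoin ℂ _ hT)
  refine ⟨⟨T, hTA⟩, Subtype.ext (lp.ext ?_)⟩
  exact (isMonomialDiagonal_toeplitzSymbolHom hn ⟨T, hTA⟩).unique hn
    (isEigenvalueFunction_iff.1 hσ)

end FockToeplitz

end

theorem mainTheorem4 (k : ℕ) (hk : 1 ≤ k) (n : Fin k → ℕ) (hn : ∀ j, 1 ≤ n j) :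
    (∀ T ∈ FockToeplitz.quasiRadialToeplitz n,
      ∃! γ : (Fin k → ℕ) → ℂ, FockToeplitz.IsEigenvalueFunction n T γ) ∧
    (∀ γ ∈ FockToeplitz.eigenvalueFunctions n, ∃ σ : FockToeplitz.Cbu k, ⇑σ.1 = γ) ∧
    Dense {σ : FockToeplitz.Cbu k | ⇑σ.1 ∈ FockToeplitz.eigenvalueFunctions n} ∧
    (∃ Φ : FockToeplitz.toeplitzAlgebra n ≃⋆ₐ[ℂ] FockToeplitz.Cbu k,
      Isometry Φ ∧
      ∀ T : FockToeplitz.toeplitzAlgebra n,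
        FockToeplitz.IsEigenvalueFunction n T.1 ⇑(Φ T).1) := by
  open FockToeplitz in
  refine ⟨fun T hT => ?_, ?_, dense_eigenvalueFunctions hn,
    StarAlgEquiv.ofBijective (toeplitzSymbolHom hn)
      ⟨(isometry_toeplitzSymbolHom hn).injective, surjective_toeplitzSymbolHom hn⟩,
    isometry_toeplitzSymbolHom hn,
    fun T => isEigenvalueFunction_iff.2 (isMonomialDiagonal_toeplitzSymbolHom hn T)⟩
  · obtain ⟨σ, hσ⟩ := exists_isMonomialDiagonal_of_mem hn hT
    exact ⟨_, isEigenvalueFunction_iff.2 hσ,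
      fun γ hγ => (isEigenvalueFunction_iff.1 hγ).unique hn hσ⟩
  · rintro γ ⟨T, hT, hγ⟩
    obtain ⟨σ, hσ⟩ := exists_isMonomialDiagonal_of_mem hn hT
    exact ⟨σ, hσ.unique hn (isEigenvalueFunction_iff.1 hγ)⟩
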